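/- Let $\mathscr{G}\rightrightarrows\mathscr{G}^{(0)}$ be a Lie groupoid: $\mathscr{G}$ and $\mathscr{G}^{(0)}$ are finite-dimensional $C^\infty$ manifolds without boundary (Hausdorff, second countable), of dimensions $p+q$ and $p$; source $s$ and target $r$ are $C^\infty$ submersions; units $u$, inversion and product $m:\mathscr{G}^{(2)}=\{(\gamma,\eta):s(\gamma)=r(\eta)\}\to\mathscr{G}$ are $C^\infty$. Put $\mathscr{G}_x=s^{-1}(x)$. Fix a smooth Haar system given by 1-densities: measures $\mu_x$ on $\mathscr{G}_x$ given by a positive density along the fibres of $s$ that is smooth on $\mathscr{G}$, with $\int_{\mathscr{G}_x}f(\gamma)\,d\mu_x(\gamma)=\int_{\mathscr{G}_y}f(\gamma\eta)\,d\mu_y(\gamma)$ for $s(\eta)=x$, $r(\eta)=y$. Also write $\mu_x$ for the translation-invariant measure on $T_x\mathscr{G}_x$ given by the value of the density at the unit $x$. *Deformation to the normal cone.* For an embedded submanifold $X\subset M$ with $\dim X=p$, $\dim M=p+k$ and normal bundle $\mathscr{N}_X^M=T_XM/TX$, let $\mathscr{D}_X^M=\mathscr{N}_X^M\times\{0\}\sqcup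 M\times(0,1]$. An $X$-slice chart is a diffeomorphism $\phi$ of an open set $\mathscr{U}\subset M$ onto an open set $U\subset\mathbf{R}^p\times\mathbf{R}^k$ with $\phi(\mathscr{U}\cap X)=V:=U\cap(\mathbf{R}^p\times\{0\})$. Let $\Omega_V^U=\{(x,\xi,t)\in\mathbf{R}^p\times\mathbf{R}^k\times[0,1]:(x,t\xi)\in U\}$ and let $\theta_\phi:\Omega_V^U\to\mathscr{D}_X^M$ send $(x,\xi,t)$ to $(\phi^{-1}(x,t\xi),t)$ if $t>0$, and to the class of $d(\phi^{-1})_{(x,0)}(0,\xi)$ in the normal space at $\phi^{-1}(x,0)$ if $t=0$. $\mathscr{D}_X^M$ is a manifold with boundary for which the $\theta_\phi$ are diffeomorphisms onto open subsets and $M\times(0,1]$ is an open submanifold. *The spaces $\mathscr{S}_{r,c}$.* A conic compact of $M\times[0,1]$ relative to $X$ is a compact $K\subset M\times[0,1]$ with $K\cap(M\times\{0\})\subset X\times\{0\}$. Let $\mathscr{S}_{r,c}(\Omega_V^U)$ be the space of $g\in C^\infty(\Omega_V^U,\mathbf{C})$ such that there is a conic compact $K\subset U\times[0,1]$ relative to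 $V$ with $g(x,\xi,t)=0$ whenever $t\neq0$ and $(x,t\xi,t)\notin K$, and such that for all $k',m\in\mathbf{N}$ and multi-indices $l,\alpha$ the function $(1+\|\xi\|^2)^{k'}|\partial_x^l\partial_\xi^\alpha\partial_t^m g|$ is bounded on $\Omega_V^U$. Let $\mathscr{S}_{r,c}(\mathscr{D}_X^M)$ be the space of $g\in C^\infty(\mathscr{D}_X^M,\mathbf{C})$ such that there is a conic compact $K\subset M\times[0,1]$ relative to $X$ with $g(m,t)=0$ whenever $t\ne0$ and $(m,t)\notin K$, and such that for every $X$-slice chart $(\mathscr{U},\phi)$ and every $\chi\in C_c^\infty(\mathscr{U}\times[0,1])$ the function $(x,\xi,t)\mapsto g(\theta_\phi(x,\xi,t))\,\chi(\phi^{-1}(x,t\xi),t)$ is in $\mathscr{S}_{r,c}(\Omega_V^U)$. *Tangent groupoid.* Let $\mathscr{G}^T=\mathscr{D}_{\mathscr{G}^{(0)}}^{\mathscr{G}}$, with units $\mathscr{G}^{(0)}\times[0,1]$, source and target $(x,\xi,0)\mapsto(x,0)$ at $t=0$ and $(\gamma,t)\mapsto(s(\gamma),t)$, $(\gamma,t)\mapsto(r(\gamma),t)$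 for $t\ne0$, and product $(x,\eta,0)(x,\xi,0)=(x,\eta+\xi,0)$, $(\gamma,t)(\beta,t)=(\gamma\beta,t)$. The set $(\mathscr{G}^T)^{(2)}$ of composable pairs is identified with $\mathscr{D}_{\mathscr{G}^{(0)}}^{\mathscr{G}^{(2)}}$ through the two projections $\mathscr{G}^{(2)}\to\mathscr{G}$ and their differentials; this defines $\mathscr{S}_{r,c}((\mathscr{G}^T)^{(2)})$. The normal space $T_x\mathscr{G}/T_x\mathscr{G}^{(0)}$ is identified with $T_x\mathscr{G}_x$. **Statement.** (1) For $F\in\mathscr{S}_{r,c}((\mathscr{G}^T)^{(2)})$ all of the integrals $$m_{r,c}(F)(x,\xi,0)=\int_{T_x\mathscr{G}_x}F(x,\xi-\eta,\eta,0)\,d\mu_x(\eta),\qquad m_{r,c}(F)(\gamma,t)=\int_{\mathscr{G}_{s(\gamma)}}F(\gamma\delta^{-1},\delta,t)\,t^{-q}\,d\mu_{s(\gamma)}(\delta)\quad(0<t\le1)$$ converge absolutely, and $F\mapsto m_{r,c}(F)$ is a linear map $\mathscr{S}_{r,c}((\mathscr{G}^T)^{(2)})\to\mathscr{S}_{r,c}(\mathscr{G}^T)$.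 (2) For $f,g\in\mathscr{S}_{r,c}(\mathscr{G}^T)$ all of the integrals $$(f*g)(x,\xi,0)=\int_{T_x\mathscr{G}_x}f(x,\xi-\eta,0)\,g(x,\eta,0)\,d\mu_x(\eta),\qquad (f*g)(\gamma,t)=\int_{\mathscr{G}_{s(\gamma)}}f(\gamma\delta^{-1},t)\,g(\delta,t)\,t^{-q}\,d\mu_{s(\gamma)}(\delta)\quad(0<t\le1)$$ converge absolutely, $f*g\in\mathscr{S}_{r,c}(\mathscr{G}^T)$, and $*$ is bilinear and associative; so $\mathscr{S}_{r,c}(\mathscr{G}^T)$ is an associative $\mathbf{C}$-algebra. -/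

import Mathlib

open Set Manifold MeasureTheory
open scoped ContDiff Manifold Topology

noncomputable section

set_option linter.unusedSectionVars false
set_option linter.unusedVariables false

namespace TangentGroupoid

/-- `ℝⁿ` with its Euclidean norm. -/
abbrev Euc (n : ℕ) := EuclideanSpace ℝ (Fin n)

/-- Two submersions `s, r : G → X` with `dim X = p` and `dim G = p + q`. -/
structure SubmersionPair (p q : ℕ) (G X : Type*)
    [TopologicalSpace G] [ChartedSpace (Euc (p + q)) G]
    [TopologicalSpace X] [ChartedSpace (Euc p) X] where
  s : G → X
  r : G → X
  isSubmersion_s : IsSubmersion (𝓡 (p + q)) (𝓡 p) ∞ s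
  isSubmersion_r : IsSubmersion (𝓡 (p + q)) (𝓡 p) ∞ r

/-! ### The manifold of composable pairs

`G⁽²⁾` is the fibre product of the submersions `s` and `r`, with its structure of an embedded
submanifold of `G × G`. -/

section FibreProduct

variable {p q : ℕ} {G X : Type*}
  [TopologicalSpace G] [ChartedSpace (Euc (p + q)) G]
  [TopologicalSpace X] [ChartedSpace (Euc p) X]

/-- `G⁽²⁾ = {(γ, η) : s γ = r η}`. -/
@[ext]
structure SubmersionPair.Composable (σ : SubmersionPair p q G X) where
  fst : G
  snd : G
  comp : σ.s fst = σ.r snd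

namespace SubmersionPair

variable (σ : SubmersionPair p q G X)

/-- The inclusion `G⁽²⁾ → G × G`. -/
def val (c : σ.Composable) : G × G := (c.fst, c.snd)

/-- `G⁽²⁾` has the subspace topology. -/
instance : TopologicalSpace σ.Composable := TopologicalSpace.induced σ.val inferInstance

theorem isEmbedding_val : Topology.IsEmbedding σ.val :=
  ⟨⟨rfl⟩, fun _ _ h => Composable.ext (congrArg Prod.fst h) (congrArg Prod.snd h)⟩

theorem continuous_val : Continuous σ.val := σ.isEmbedding_val.continuous

theorem submersionAt (γ : G) :
    IsSubmersionAtOfComplement (Euc q) (𝓡 (p + q)) (𝓡 p) ∞ σ.s γ := by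
  have h := σ.isSubmersion_s.isSubmersionOfComplement_complement γ
  have e := h.equiv
  have : FiniteDimensional ℝ (Euc p × σ.isSubmersion_s.complement) :=
    LinearEquiv.finiteDimensional e.toLinearEquiv
  have : FiniteDimensional ℝ σ.isSubmersion_s.complement :=
    Module.Finite.of_surjective
      (LinearMap.snd ℝ (Euc p) σ.isSubmersion_s.complement) (fun x => ⟨(0, x), rfl⟩)
  have hd := e.toLinearEquiv.finrank_eq
  rw [Module.finrank_prod, finrank_euclideanSpace_fin, finrank_euclideanSpace_fin] at hd
  exact h.trans_F (ContinuousLinearEquiv.ofFinrankEq (by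
    rw [finrank_euclideanSpace_fin]; omega))

/-- The first component of the inverse of the chart of `composableChart`. -/
def chartInvFst (c₀ : σ.Composable) (z : Euc (p + q) × Euc q) : G :=
  (σ.submersionAt c₀.fst).domChart.symm ((σ.submersionAt c₀.fst).equiv.symm
    ((σ.submersionAt c₀.fst).codChart (σ.r ((chartAt (Euc (p + q)) c₀.snd).symm z.1)), z.2))

open Classical in
/-- The inverse of the chart of `composableChart`. -/
def chartInv (c₀ : σ.Composable) (z : Euc (p + q) × Euc q) : σ.Composable :=
  if h : σ.s (σ.chartInvFst c₀ z) = σ.r ((chartAt (Euc (p + q)) c₀.snd).symm z.1) then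
    ⟨σ.chartInvFst c₀ z, (chartAt (Euc (p + q)) c₀.snd).symm z.1, h⟩
  else c₀

/-- The target of the chart of `composableChart`. -/
def chartTarget (c₀ : σ.Composable) : Set (Euc (p + q) × Euc q) :=
  {z | z.1 ∈ (chartAt (Euc (p + q)) c₀.snd).target ∧
    σ.r ((chartAt (Euc (p + q)) c₀.snd).symm z.1) ∈ (σ.submersionAt c₀.fst).codChart.source ∧
    (σ.submersionAt c₀.fst).equiv.symm ((σ.submersionAt c₀.fst).codChart
      (σ.r ((chartAt (Euc (p + q)) c₀.snd).symm z.1)), z.2) ∈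
      (σ.submersionAt c₀.fst).domChart.target}

theorem codChart_s (c₀ : σ.Composable) {y : Euc (p + q)}
    (hy : y ∈ (σ.submersionAt c₀.fst).domChart.target) :
    (σ.submersionAt c₀.fst).codChart (σ.s ((σ.submersionAt c₀.fst).domChart.symm y)) =
      ((σ.submersionAt c₀.fst).equiv y).1 := by
  have hy' : y ∈ ((σ.submersionAt c₀.fst).domChart.extend (𝓡 (p + q))).target := by
    rw [OpenPartialHomeomorph.extend_target]
    simpa using hy
  have := (σ.submersionAt c₀.fst).writtenInCharts hy'
  simpa using this

theorem chartInv_val (c₀ : σ.Composable) {z : Euc (p + q) × Euc q} (hz : z ∈ σ.chartTarget c₀) :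
    σ.val (σ.chartInv c₀ z) =
      (σ.chartInvFst c₀ z, (chartAt (Euc (p + q)) c₀.snd).symm z.1) := by
  have h : σ.s (σ.chartInvFst c₀ z) = σ.r ((chartAt (Euc (p + q)) c₀.snd).symm z.1) := by
    apply (σ.submersionAt c₀.fst).codChart.injOn _ hz.2.1
    · rw [chartInvFst, σ.codChart_s c₀ hz.2.2]
      simp
    · exact (σ.submersionAt c₀.fst).source_subset_preimage_source
        ((σ.submersionAt c₀.fst).domChart.map_target hz.2.2)
  rw [chartInv, dif_pos h, val]

variable [IsManifold (𝓡 (p + q)) ∞ G] [IsManifold (𝓡 p) ∞ X]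

theorem contMDiff_s : ContMDiff (𝓡 (p + q)) (𝓡 p) ∞ σ.s := σ.isSubmersion_s.contMDiff
theorem contMDiff_r : ContMDiff (𝓡 (p + q)) (𝓡 p) ∞ σ.r := σ.isSubmersion_r.contMDiff

theorem contMDiffOn_base (c₀ : σ.Composable) :
    ContMDiffOn 𝓘(ℝ, Euc (p + q) × Euc q) (𝓡 (p + q)) ∞
      (fun z : Euc (p + q) × Euc q => (chartAt (Euc (p + q)) c₀.snd).symm z.1)
      (Prod.fst ⁻¹' (chartAt (Euc (p + q)) c₀.snd).target) :=
  (contMDiffOn_chart_symm (I := 𝓡 (p + q)) (n := ∞) (x := c₀.snd)).comp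
    (contDiff_fst.contMDiff.contMDiffOn) (fun _ h => h)

theorem contMDiffOn_arg (c₀ : σ.Composable) :
    ContMDiffOn 𝓘(ℝ, Euc (p + q) × Euc q) 𝓘(ℝ, Euc (p + q)) ∞
      (fun z : Euc (p + q) × Euc q => (σ.submersionAt c₀.fst).equiv.symm
        ((σ.submersionAt c₀.fst).codChart
          (σ.r ((chartAt (Euc (p + q)) c₀.snd).symm z.1)), z.2))
      {z | z.1 ∈ (chartAt (Euc (p + q)) c₀.snd).target ∧
        σ.r ((chartAt (Euc (p + q)) c₀.snd).symm z.1) ∈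
          (σ.submersionAt c₀.fst).codChart.source} := by
  have h1 : ContMDiffOn 𝓘(ℝ, Euc (p + q) × Euc q) (𝓡 p) ∞
      (fun z : Euc (p + q) × Euc q => (σ.submersionAt c₀.fst).codChart
          (σ.r ((chartAt (Euc (p + q)) c₀.snd).symm z.1)))
      {z | z.1 ∈ (chartAt (Euc (p + q)) c₀.snd).target ∧
        σ.r ((chartAt (Euc (p + q)) c₀.snd).symm z.1) ∈
          (σ.submersionAt c₀.fst).codChart.source} :=
    (contMDiffOn_of_mem_maximalAtlas (σ.submersionAt c₀.fst).codChart_mem_maximalAtlas).comp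
      (σ.contMDiff_r.comp_contMDiffOn ((σ.contMDiffOn_base c₀).mono fun z hz => hz.1))
      (fun z hz => hz.2)
  have h2 := h1.prodMk_space (contDiff_snd (𝕜 := ℝ) (E := Euc (p + q)) (F := Euc q)
    (n := ∞)).contMDiff.contMDiffOn
  exact (σ.submersionAt c₀.fst).equiv.symm.contDiff.contMDiff.comp_contMDiffOn h2

theorem isOpen_chartTarget (c₀ : σ.Composable) : IsOpen (σ.chartTarget c₀) := by
  have h1 : IsOpen {z : Euc (p + q) × Euc q | z.1 ∈ (chartAt (Euc (p + q)) c₀.snd).target ∧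
        σ.r ((chartAt (Euc (p + q)) c₀.snd).symm z.1) ∈
          (σ.submersionAt c₀.fst).codChart.source} :=
    (σ.contMDiff_r.comp_contMDiffOn (σ.contMDiffOn_base c₀)).continuousOn.isOpen_inter_preimage
      ((chartAt (Euc (p + q)) c₀.snd).open_target.preimage continuous_fst)
      (σ.submersionAt c₀.fst).codChart.open_source
  have h2 := (σ.contMDiffOn_arg c₀).continuousOn.isOpen_inter_preimage h1
    (σ.submersionAt c₀.fst).domChart.open_target
  convert h2 using 1
  ext z
  simp only [chartTarget, mem_ofPred_eq, mem_inter_iff, mem_preimage, and_assoc]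

theorem contMDiffOn_chartInvFst (c₀ : σ.Composable) :
    ContMDiffOn 𝓘(ℝ, Euc (p + q) × Euc q) (𝓡 (p + q)) ∞ (σ.chartInvFst c₀)
      (σ.chartTarget c₀) :=
  (contMDiffOn_symm_of_mem_maximalAtlas (σ.submersionAt c₀.fst).domChart_mem_maximalAtlas).comp
    ((σ.contMDiffOn_arg c₀).mono fun z hz => ⟨hz.1, hz.2.1⟩) (fun z hz => hz.2.2)

theorem contMDiffOn_chartInv_val (c₀ : σ.Composable) :
    ContMDiffOn 𝓘(ℝ, Euc (p + q) × Euc q) ((𝓡 (p + q)).prod (𝓡 (p + q))) ∞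
      (fun z => σ.val (σ.chartInv c₀ z)) (σ.chartTarget c₀) :=
  ((σ.contMDiffOn_chartInvFst c₀).prodMk
    ((σ.contMDiffOn_base c₀).mono fun z hz => hz.1)).congr
    fun z hz => σ.chartInv_val c₀ hz

/-- The chart of the space of composable pairs around `c₀ = (γ₀, η₀)`. In charts in which `s` is the
projection `(a, b) ↦ a` near `γ₀` it sends `(γ, η)` to the coordinates of `η` followed by the
coordinate `b` of `γ`. -/
def composableChart (c₀ : σ.Composable) :
    OpenPartialHomeomorph σ.Composable (Euc (p + q) × Euc q) where
  toFun c := (chartAt (Euc (p + q)) c₀.snd c.snd,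
    ((σ.submersionAt c₀.fst).equiv ((σ.submersionAt c₀.fst).domChart c.fst)).2)
  invFun := σ.chartInv c₀
  source := {c | c.fst ∈ (σ.submersionAt c₀.fst).domChart.source ∧
    c.snd ∈ (chartAt (Euc (p + q)) c₀.snd).source}
  target := σ.chartTarget c₀
  map_source' := by
    rintro ⟨γ, η, hc⟩ ⟨h1, h2⟩
    dsimp only at hc h1 h2
    have hs := σ.codChart_s c₀ ((σ.submersionAt c₀.fst).domChart.map_source h1)
    rw [(σ.submersionAt c₀.fst).domChart.left_inv h1] at hs
    have hr : σ.r ((chartAt (Euc (p + q)) c₀.snd).symm (chartAt (Euc (p + q)) c₀.snd η)) = σ.s γ := by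
      rw [(chartAt (Euc (p + q)) c₀.snd).left_inv h2, hc]
    refine ⟨(chartAt (Euc (p + q)) c₀.snd).map_source h2, ?_, ?_⟩
    · dsimp only
      rw [hr]
      exact (σ.submersionAt c₀.fst).source_subset_preimage_source h1
    · dsimp only
      rw [hr, hs, Prod.mk.eta, ContinuousLinearEquiv.symm_apply_apply]
      exact (σ.submersionAt c₀.fst).domChart.map_source h1
  map_target' := by
    intro z hz
    have hv := σ.chartInv_val c₀ hz
    rw [mem_ofPred_eq, show (σ.chartInv c₀ z).fst = _ from congrArg Prod.fst hv,
      show (σ.chartInv c₀ z).snd = _ from congrArg Prod.snd hv]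
    exact ⟨(σ.submersionAt c₀.fst).domChart.map_target hz.2.2,
      (chartAt (Euc (p + q)) c₀.snd).map_target hz.1⟩
  left_inv' := by
    rintro ⟨γ, η, hc⟩ ⟨h1, h2⟩
    dsimp only at hc h1 h2
    have hs := σ.codChart_s c₀ ((σ.submersionAt c₀.fst).domChart.map_source h1)
    rw [(σ.submersionAt c₀.fst).domChart.left_inv h1] at hs
    have hr : σ.r ((chartAt (Euc (p + q)) c₀.snd).symm (chartAt (Euc (p + q)) c₀.snd η)) = σ.s γ := by
      rw [(chartAt (Euc (p + q)) c₀.snd).left_inv h2, hc]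
    have hγ : σ.chartInvFst c₀ (chartAt (Euc (p + q)) c₀.snd η,
        ((σ.submersionAt c₀.fst).equiv ((σ.submersionAt c₀.fst).domChart γ)).2) = γ := by
      rw [chartInvFst, hr, hs, Prod.mk.eta, ContinuousLinearEquiv.symm_apply_apply,
        (σ.submersionAt c₀.fst).domChart.left_inv h1]
    rw [chartInv, dif_pos (by rw [hγ, hr])]
    exact Composable.ext hγ ((chartAt (Euc (p + q)) c₀.snd).left_inv h2)
  right_inv' := by
    intro z hz
    have hv := σ.chartInv_val c₀ hz
    rw [show (σ.chartInv c₀ z).fst = _ from congrArg Prod.fst hv,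
      show (σ.chartInv c₀ z).snd = _ from congrArg Prod.snd hv, chartInvFst, (chartAt (Euc (p + q)) c₀.snd).right_inv hz.1,
      (σ.submersionAt c₀.fst).domChart.right_inv hz.2.2]
    simp
  open_source :=
    ((σ.submersionAt c₀.fst).domChart.open_source.preimage
      (continuous_fst.comp σ.continuous_val)).inter
    ((chartAt (Euc (p + q)) c₀.snd).open_source.preimage
      (continuous_snd.comp σ.continuous_val))
  open_target := σ.isOpen_chartTarget c₀
  continuousOn_toFun := by
    refine ContinuousOn.prodMk ?_ ?_
    · exact (chartAt (Euc (p + q)) c₀.snd).continuousOn.comp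
        (continuous_snd.comp σ.continuous_val).continuousOn (fun c hc => hc.2)
    · refine (continuous_snd.comp (σ.submersionAt c₀.fst).equiv.continuous).comp_continuousOn ?_
      exact (σ.submersionAt c₀.fst).domChart.continuousOn.comp
        (continuous_fst.comp σ.continuous_val).continuousOn (fun c hc => hc.1)
  continuousOn_invFun :=
    σ.isEmbedding_val.isInducing.continuousOn_iff.2
      (σ.contMDiffOn_chartInv_val c₀).continuousOn

/-- The space of composable pairs as a manifold of dimension `(p + q) + q`. -/
instance : ChartedSpace (Euc (p + q) × Euc q) σ.Composable where
  atlas := range σ.composableChart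
  chartAt := σ.composableChart
  mem_chart_source c := ⟨(σ.submersionAt c.fst).mem_domChart_source, mem_chart_source _ c.snd⟩
  chart_mem_atlas c := mem_range_self c

theorem contMDiffOn_composableChart_ambient (c₀ : σ.Composable) :
    ContMDiffOn ((𝓡 (p + q)).prod (𝓡 (p + q))) 𝓘(ℝ, Euc (p + q) × Euc q) ∞
      (fun c : G × G => (chartAt (Euc (p + q)) c₀.snd c.2,
        ((σ.submersionAt c₀.fst).equiv ((σ.submersionAt c₀.fst).domChart c.1)).2))
      {c | c.1 ∈ (σ.submersionAt c₀.fst).domChart.source ∧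
        c.2 ∈ (chartAt (Euc (p + q)) c₀.snd).source} := by
  refine ContMDiffOn.prodMk_space ?_ ?_
  · exact (contMDiffOn_chart (I := 𝓡 (p + q)) (n := ∞) (x := c₀.snd)).comp
      contMDiff_snd.contMDiffOn (fun c hc => hc.2)
  · refine (contDiff_snd.comp (σ.submersionAt c₀.fst).equiv.contDiff).contMDiff.comp_contMDiffOn ?_
    exact (contMDiffOn_of_mem_maximalAtlas
      (σ.submersionAt c₀.fst).domChart_mem_maximalAtlas).comp
      contMDiff_fst.contMDiffOn (fun c hc => hc.1)

instance : IsManifold 𝓘(ℝ, Euc (p + q) × Euc q) ∞ σ.Composable := by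
  apply isManifold_of_contDiffOn
  rintro _ _ ⟨c, rfl⟩ ⟨d, rfl⟩
  rw [← contMDiffOn_iff_contDiffOn]
  refine ((σ.contMDiffOn_composableChart_ambient d).comp
    ((σ.contMDiffOn_chartInv_val c).mono ?_) ?_)
  · intro z hz
    simp only [modelWithCornersSelf_coe, range_id, inter_univ, mfld_simps] at hz
    exact hz.1
  · intro z hz
    simp only [modelWithCornersSelf_coe, range_id, inter_univ, mfld_simps] at hz
    exact hz.2

/-- The inclusion of the composable pairs into `G × G` is smooth. -/
theorem contMDiff_val : ContMDiff 𝓘(ℝ, Euc (p + q) × Euc q)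
    ((𝓡 (p + q)).prod (𝓡 (p + q))) ∞ σ.val := by
  intro c
  have h1 : ContMDiffAt 𝓘(ℝ, Euc (p + q) × Euc q) 𝓘(ℝ, Euc (p + q) × Euc q) ∞
      (chartAt (Euc (p + q) × Euc q) c) c :=
    (contMDiffOn_chart (I := 𝓘(ℝ, Euc (p + q) × Euc q)) (n := ∞) (x := c)).contMDiffAt
      (chart_source_mem_nhds _ c)
  have h2 := ((σ.contMDiffOn_chartInv_val c).contMDiffAt
    ((σ.isOpen_chartTarget c).mem_nhds
      ((σ.composableChart c).map_source (mem_chart_source (Euc (p + q) × Euc q) c))))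
  refine (h2.comp c h1).congr_of_eventuallyEq ?_
  filter_upwards [chart_source_mem_nhds (Euc (p + q) × Euc q) c] with d hd
  exact (congrArg σ.val ((σ.composableChart c).left_inv hd)).symm

/-- A map into the space of composable pairs is smooth as soon as it is smooth as a map
into `G × G`. -/
theorem contMDiff_of_val {E H N : Type*} [NormedAddCommGroup E] [NormedSpace ℝ E]
    [TopologicalSpace H] {I : ModelWithCorners ℝ E H} [TopologicalSpace N] [ChartedSpace H N]
    {f : N → σ.Composable}
    (hf : ContMDiff I ((𝓡 (p + q)).prod (𝓡 (p + q))) ∞ (fun n => σ.val (f n))) :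
    ContMDiff I 𝓘(ℝ, Euc (p + q) × Euc q) ∞ f := by
  have hc : Continuous f :=
    σ.isEmbedding_val.isInducing.continuous_iff.2 hf.continuous
  intro n
  rw [contMDiffAt_iff_target]
  refine ⟨hc.continuousAt, ?_⟩
  have hmem := mem_chart_source (Euc (p + q) × Euc q) (f n)
  have hopen : IsOpen {c : G × G | c.1 ∈ (σ.submersionAt (f n).fst).domChart.source ∧
        c.2 ∈ (chartAt (Euc (p + q)) (f n).snd).source} :=
    ((σ.submersionAt (f n).fst).domChart.open_source.preimage continuous_fst).inter
      ((chartAt (Euc (p + q)) (f n).snd).open_source.preimage continuous_snd)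
  have hat := (σ.contMDiffOn_composableChart_ambient (f n)).contMDiffAt
    (hopen.mem_nhds (x := σ.val (f n)) hmem)
  exact ContMDiffAt.comp (f := fun n => σ.val (f n)) n hat (hf n)

end SubmersionPair

end FibreProduct

/-! ### Lie groupoids -/

/-- A Lie groupoid `G ⇉ X` with `dim X = p` and `dim G = p + q`. The product is defined on
composable pairs only. -/
structure LieGroupoid (p q : ℕ) (G X : Type*)
    [TopologicalSpace G] [ChartedSpace (Euc (p + q)) G] [IsManifold (𝓡 (p + q)) ∞ G]
    [TopologicalSpace X] [ChartedSpace (Euc p) X] [IsManifold (𝓡 p) ∞ X]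
    extends SubmersionPair p q G X where
  u : X → G
  inv : G → G
  mul : toSubmersionPair.Composable → G
  s_u : ∀ x, s (u x) = x
  r_u : ∀ x, r (u x) = x
  s_inv : ∀ γ, s (inv γ) = r γ
  r_inv : ∀ γ, r (inv γ) = s γ
  r_mul : ∀ c, r (mul c) = r c.fst
  s_mul : ∀ c, s (mul c) = s c.snd
  mul_assoc : ∀ γ η δ (h₁ : s γ = r η) (h₂ : s η = r δ),
    mul ⟨γ, mul ⟨η, δ, h₂⟩, h₁.trans (r_mul ⟨η, δ, h₂⟩).symm⟩ =
      mul ⟨mul ⟨γ, η, h₁⟩, δ, (s_mul ⟨γ, η, h₁⟩).trans h₂⟩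
  mul_u : ∀ γ, mul ⟨γ, u (s γ), (r_u _).symm⟩ = γ
  u_mul : ∀ γ, mul ⟨u (r γ), γ, s_u _⟩ = γ
  mul_inv : ∀ γ, mul ⟨γ, inv γ, (r_inv γ).symm⟩ = u (r γ)
  inv_mul : ∀ γ, mul ⟨inv γ, γ, s_inv γ⟩ = u (s γ)
  contMDiff_u : ContMDiff (𝓡 p) (𝓡 (p + q)) ∞ u
  contMDiff_inv : ContMDiff (𝓡 (p + q)) (𝓡 (p + q)) ∞ inv
  contMDiff_mul : ContMDiff 𝓘(ℝ, Euc (p + q) × Euc q) (𝓡 (p + q)) ∞ mul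

/-! ### Deformation to the normal cone -/

section DeformationToNormalCone

variable (P E : Type*) [NormedAddCommGroup P] [NormedSpace ℝ P]
  [NormedAddCommGroup E] [NormedSpace ℝ E]
  {X M : Type*} [TopologicalSpace X] [ChartedSpace P X] [TopologicalSpace M] [ChartedSpace E M]

/-- The normal space `T_{ι x} M / T_x X` at a point of the submanifold `ι : X → M`. -/
abbrev NormalSpace (ι : X → M) (x : X) : Type _ :=
  TangentSpace 𝓘(ℝ, E) (ι x) ⧸ LinearMap.range (mfderiv 𝓘(ℝ, P) 𝓘(ℝ, E) ι x).toLinearMap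

/-- The underlying set of the deformation to the normal cone of `ι : X → M`: the disjoint union of
the normal bundle (at `t = 0`) and of `M × (0, 1]`. -/
inductive DNC (ι : X → M) where
  | zero (x : X) (ξ : NormalSpace P E ι x) : DNC ι
  | pos (m : M) (t : Ioc (0 : ℝ) 1) : DNC ι

variable {E}

/-- The map of normal spaces induced by the differential of a map `F : M → M'` that is the identity
on the common submanifold `X`. -/
def normalMap {E' M' : Type*} [NormedAddCommGroup E'] [NormedSpace ℝ E'] [TopologicalSpace M']
    [ChartedSpace E' M'] (F : M → M') (hF : MDifferentiable 𝓘(ℝ, E) 𝓘(ℝ, E') F)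
    (ι : X → M) (hι : MDifferentiable 𝓘(ℝ, P) 𝓘(ℝ, E) ι) (x : X) :
    NormalSpace P E ι x →ₗ[ℝ] NormalSpace P E' (fun x => F (ι x)) x :=
  Submodule.mapQ _ _ (mfderiv 𝓘(ℝ, E) 𝓘(ℝ, E') F (ι x)).toLinearMap (by
    rintro _ ⟨v, rfl⟩
    refine ⟨v, ?_⟩
    have h := mfderiv_comp x (hF (ι x)) (hι x)
    exact congrArg (fun L => L v) h)

/-- Functoriality: `(x, ξ, 0) ↦ (x, d_N F ξ, 0)` and `(m, t) ↦ (F m, t)`. -/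
def DNC.map {E' M' : Type*} [NormedAddCommGroup E'] [NormedSpace ℝ E'] [TopologicalSpace M']
    [ChartedSpace E' M'] (F : M → M') (hF : MDifferentiable 𝓘(ℝ, E) 𝓘(ℝ, E') F)
    (ι : X → M) (hι : MDifferentiable 𝓘(ℝ, P) 𝓘(ℝ, E) ι) :
    DNC P E ι → DNC P E' (fun x => F (ι x))
  | .zero x ξ => .zero x (normalMap P F hF ι hι x ξ)
  | .pos m t => .pos (F m) t

variable {P} {Q : Type*} [NormedAddCommGroup Q] [NormedSpace ℝ Q]

variable (E) in
/-- `φ` is an `X`-slice chart: a diffeomorphism of an open subset of `M` onto an open subset of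
`P × Q` that maps the points of `X` onto the points of its image in `P × {0}`. -/
structure IsSliceChart (ι : X → M) (φ : OpenPartialHomeomorph M (P × Q)) : Prop where
  contMDiffOn : ContMDiffOn 𝓘(ℝ, E) 𝓘(ℝ, P × Q) ∞ φ φ.source
  contMDiffOn_symm : ContMDiffOn 𝓘(ℝ, P × Q) 𝓘(ℝ, E) ∞ φ.symm φ.target
  mem_range_iff : ∀ m ∈ φ.source, m ∈ range ι ↔ (φ m).2 = 0

/-- `Ω_V^U = {(x, ξ, t) : 0 ≤ t ≤ 1, (x, t ξ) ∈ U}`. -/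
def Omega (U : Set (P × Q)) : Set (P × Q × ℝ) :=
  {z | z.2.2 ∈ Icc (0 : ℝ) 1 ∧ (z.1, z.2.2 • z.2.1) ∈ U}

/-- The space `𝒮_{r,c}(Ω_V^U)`, where `V = U ∩ (P × {0})`. The bounds on all derivatives of order
`n` of `g` are those on all its partial derivatives of order `n`, up to constants; derivatives are
taken up to the boundary of `Ω_V^U`. -/
structure IsSrcLocal (U : Set (P × Q)) (g : P × Q × ℝ → ℂ) : Prop where
  contDiffOn : ContDiffOn ℝ ∞ g (Omega U)
  conic_compact_support : ∃ K : Set ((P × Q) × ℝ), IsCompact K ∧ K ⊆ U ×ˢ Icc (0 : ℝ) 1 ∧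
    (∀ y : P × Q, (y, (0 : ℝ)) ∈ K → y.2 = 0) ∧
    ∀ z ∈ Omega U, z.2.2 ≠ 0 → ((z.1, z.2.2 • z.2.1), z.2.2) ∉ K → g z = 0
  rapid_decay : ∀ k n : ℕ, ∃ C : ℝ, ∀ z ∈ Omega U,
    (1 + ‖z.2.1‖ ^ 2) ^ k * ‖iteratedFDerivWithin ℝ n g (Omega U) z‖ ≤ C

open Classical in
/-- The function `g` on the deformation read in the chart of the deformation that is given by the
slice chart `φ`, as a function on `Omega φ.target`: it is `g (φ⁻¹ (x, t ξ), t)` for `t > 0`, and for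
`t = 0` it is `g (v, [d(φ⁻¹) (0, ξ)], 0)`, where `v` is the point of `X` with `φ v = (x, 0)`. -/
def localRep {ι : X → M} (g : DNC P E ι → ℂ) (φ : OpenPartialHomeomorph M (P × Q)) :
    P × Q × ℝ → ℂ := fun z =>
  if ht : z.2.2 ∈ Ioc (0 : ℝ) 1 then g (.pos (φ.symm (z.1, z.2.2 • z.2.1)) ⟨z.2.2, ht⟩)
  else if hv : ∃ v : X, ι v = φ.symm (z.1, 0) then
    g (.zero hv.choose (Submodule.Quotient.mk
      (mfderiv 𝓘(ℝ, P × Q) 𝓘(ℝ, E) φ.symm (z.1, 0) ((0, z.2.1) : P × Q) : E)))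
  else 0

open Classical in
/-- The restriction of `g` to `M × (0, 1]`, extended by zero to `M × ℝ`. -/
def posPart {ι : X → M} (g : DNC P E ι → ℂ) : M × ℝ → ℂ := fun z =>
  if ht : z.2 ∈ Ioc (0 : ℝ) 1 then g (.pos z.1 ⟨z.2, ht⟩) else 0

/-- Membership in `𝒮_{r,c}(𝒟_X^M)`. The first two conditions say that `g` is smooth on the
deformation, whose smooth structure is given by the open subset `M × (0, 1]` and by the charts that
come from slice charts. -/
structure IsSrc (Q : Type*) [NormedAddCommGroup Q] [NormedSpace ℝ Q] {ι : X → M}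
    (g : DNC P E ι → ℂ) : Prop where
  contMDiffOn_pos :
    ContMDiffOn (𝓘(ℝ, E).prod 𝓘(ℝ, ℝ)) 𝓘(ℝ, ℂ) ∞ (posPart g) (univ ×ˢ Ioc (0 : ℝ) 1)
  contDiffOn_localRep : ∀ φ : OpenPartialHomeomorph M (P × Q), IsSliceChart E ι φ →
    ContDiffOn ℝ ∞ (localRep g φ) (Omega φ.target)
  conic_compact_support : ∃ K : Set (M × ℝ), IsCompact K ∧ K ⊆ univ ×ˢ Icc (0 : ℝ) 1 ∧
    (∀ m : M, (m, (0 : ℝ)) ∈ K → m ∈ range ι) ∧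
    ∀ (m : M) (t : Ioc (0 : ℝ) 1), (m, (t : ℝ)) ∉ K → g (.pos m t) = 0
  rapid_decay : ∀ φ : OpenPartialHomeomorph M (P × Q), IsSliceChart E ι φ →
    ∀ χ : M × ℝ → ℂ,
      ContMDiffOn (𝓘(ℝ, E).prod 𝓘(ℝ, ℝ)) 𝓘(ℝ, ℂ) ∞ χ (φ.source ×ˢ Icc (0 : ℝ) 1) →
      (∃ L : Set (M × ℝ), IsCompact L ∧ L ⊆ φ.source ×ˢ Icc (0 : ℝ) 1 ∧
        ∀ w ∈ φ.source ×ˢ Icc (0 : ℝ) 1, w ∉ L → χ w = 0) →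
      IsSrcLocal φ.target fun z =>
        localRep g φ z * χ (φ.symm (z.1, z.2.2 • z.2.1), z.2.2)

theorem uniqueDiffOn_Omega {U : Set (P × Q)} (hU : IsOpen U) : UniqueDiffOn ℝ (Omega U) := by
  have h1 : UniqueDiffOn ℝ ((univ : Set P) ×ˢ ((univ : Set Q) ×ˢ Icc (0 : ℝ) 1)) :=
    uniqueDiffOn_univ.prod (uniqueDiffOn_univ.prod (uniqueDiffOn_Icc zero_lt_one))
  have h2 : IsOpen {z : P × Q × ℝ | (z.1, z.2.2 • z.2.1) ∈ U} :=
    hU.preimage (by fun_prop : Continuous fun z : P × Q × ℝ => (z.1, z.2.2 • z.2.1))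
  convert h1.inter h2 using 1
  ext z
  simp [Omega]

theorem IsSrcLocal.add {U : Set (P × Q)} (hU : IsOpen U) {g h : P × Q × ℝ → ℂ}
    (hg : IsSrcLocal U g) (hh : IsSrcLocal U h) : IsSrcLocal U (fun z => g z + h z) where
  contDiffOn := hg.contDiffOn.add hh.contDiffOn
  conic_compact_support := by
    obtain ⟨K, hK, hKU, hK0, hKg⟩ := hg.conic_compact_support
    obtain ⟨L, hL, hLU, hL0, hLh⟩ := hh.conic_compact_support
    refine ⟨K ∪ L, hK.union hL, union_subset hKU hLU, ?_, ?_⟩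
    · rintro y (hy | hy)
      exacts [hK0 y hy, hL0 y hy]
    · intro z hz ht hn
      rw [hKg z hz ht fun h => hn (Or.inl h), hLh z hz ht fun h => hn (Or.inr h), add_zero]
  rapid_decay := by
    intro k n
    obtain ⟨C, hC⟩ := hg.rapid_decay k n
    obtain ⟨D, hD⟩ := hh.rapid_decay k n
    refine ⟨C + D, fun z hz => ?_⟩
    have e : iteratedFDerivWithin ℝ n (fun z => g z + h z) (Omega U) z =
        iteratedFDerivWithin ℝ n g (Omega U) z + iteratedFDerivWithin ℝ n h (Omega U) z :=
      iteratedFDerivWithin_add_apply ((hg.contDiffOn z hz).of_le (mod_cast le_top))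
        ((hh.contDiffOn z hz).of_le (mod_cast le_top)) (uniqueDiffOn_Omega hU) hz
    rw [e]
    calc _ ≤ (1 + ‖z.2.1‖ ^ 2) ^ k * (‖iteratedFDerivWithin ℝ n g (Omega U) z‖ +
          ‖iteratedFDerivWithin ℝ n h (Omega U) z‖) := by gcongr; exact norm_add_le _ _
      _ ≤ _ := by rw [mul_add]; exact add_le_add (hC z hz) (hD z hz)

theorem IsSrcLocal.const_mul {U : Set (P × Q)} (hU : IsOpen U) {g : P × Q × ℝ → ℂ} (c : ℂ)
    (hg : IsSrcLocal U g) : IsSrcLocal U (fun z => c * g z) where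
  contDiffOn := contDiffOn_const.mul hg.contDiffOn
  conic_compact_support := by
    obtain ⟨K, hK, hKU, hK0, hKg⟩ := hg.conic_compact_support
    exact ⟨K, hK, hKU, hK0, fun z hz ht hn => by rw [hKg z hz ht hn, mul_zero]⟩
  rapid_decay := by
    intro k n
    obtain ⟨C, hC⟩ := hg.rapid_decay k n
    refine ⟨‖c‖ * C, fun z hz => ?_⟩
    have e : iteratedFDerivWithin ℝ n (c • g) (Omega U) z =
        c • iteratedFDerivWithin ℝ n g (Omega U) z :=
      iteratedFDerivWithin_const_smul_apply ((hg.contDiffOn z hz).of_le (mod_cast le_top))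
        (uniqueDiffOn_Omega hU) hz
    change _ * ‖iteratedFDerivWithin ℝ n (c • g) (Omega U) z‖ ≤ _
    rw [e, norm_smul, mul_left_comm]
    exact mul_le_mul_of_nonneg_left (hC z hz) (norm_nonneg c)

theorem localRep_add {ι : X → M} (g h : DNC P E ι → ℂ) (φ : OpenPartialHomeomorph M (P × Q))
    (z : P × Q × ℝ) : localRep (g + h) φ z = localRep g φ z + localRep h φ z := by
  unfold localRep; split_ifs <;> simp

theorem localRep_smul {ι : X → M} (c : ℂ) (g : DNC P E ι → ℂ)
    (φ : OpenPartialHomeomorph M (P × Q)) (z : P × Q × ℝ) :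
    localRep (c • g) φ z = c * localRep g φ z := by
  unfold localRep; split_ifs <;> simp

theorem posPart_add {ι : X → M} (g h : DNC P E ι → ℂ) :
    posPart (g + h) = posPart g + posPart h := by
  funext z; simp only [posPart, Pi.add_apply]; split_ifs <;> simp

theorem posPart_smul {ι : X → M} (c : ℂ) (g : DNC P E ι → ℂ) :
    posPart (c • g) = c • posPart g := by
  funext z; simp only [posPart, Pi.smul_apply]; split_ifs <;> simp

theorem IsSrc.add {ι : X → M} {g h : DNC P E ι → ℂ} (hg : IsSrc Q g) (hh : IsSrc Q h) :
    IsSrc Q (g + h) where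
  contMDiffOn_pos := by
    rw [posPart_add]
    exact hg.contMDiffOn_pos.add hh.contMDiffOn_pos
  contDiffOn_localRep φ hφ := by
    simp only [funext (localRep_add g h φ)]
    exact (hg.contDiffOn_localRep φ hφ).add (hh.contDiffOn_localRep φ hφ)
  conic_compact_support := by
    obtain ⟨K, hK, hKU, hK0, hKg⟩ := hg.conic_compact_support
    obtain ⟨L, hL, hLU, hL0, hLh⟩ := hh.conic_compact_support
    refine ⟨K ∪ L, hK.union hL, union_subset hKU hLU, ?_, ?_⟩
    · rintro y (hy | hy)
      exacts [hK0 y hy, hL0 y hy]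
    · intro m t hn
      rw [Pi.add_apply, hKg m t fun h => hn (Or.inl h), hLh m t fun h => hn (Or.inr h), add_zero]
  rapid_decay φ hφ χ h1 h2 := by
    have := (hg.rapid_decay φ hφ χ h1 h2).add φ.open_target (hh.rapid_decay φ hφ χ h1 h2)
    simpa only [localRep_add, add_mul] using this

theorem IsSrc.smul {ι : X → M} (c : ℂ) {g : DNC P E ι → ℂ} (hg : IsSrc Q g) :
    IsSrc Q (c • g) where
  contMDiffOn_pos := by
    rw [posPart_smul]
    exact (contDiff_const_smul (𝕜 := ℝ) c).contMDiff.comp_contMDiffOn hg.contMDiffOn_pos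
  contDiffOn_localRep φ hφ := by
    simp only [funext (localRep_smul c g φ)]
    exact contDiffOn_const.mul (hg.contDiffOn_localRep φ hφ)
  conic_compact_support := by
    obtain ⟨K, hK, hKU, hK0, hKg⟩ := hg.conic_compact_support
    exact ⟨K, hK, hKU, hK0, fun m t hn => by rw [Pi.smul_apply, hKg m t hn, smul_zero]⟩
  rapid_decay φ hφ χ h1 h2 := by
    have := (hg.rapid_decay φ hφ χ h1 h2).const_mul φ.open_target c
    simpa only [localRep_smul, mul_assoc] using this

theorem IsSrcLocal.zero (U : Set (P × Q)) : IsSrcLocal U (fun _ => 0) where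
  contDiffOn := contDiffOn_const
  conic_compact_support := ⟨∅, isCompact_empty, empty_subset _, fun _ h => h.elim, fun _ _ _ _ => rfl⟩
  rapid_decay k n := ⟨0, fun z hz => by simp⟩

theorem localRep_zero {ι : X → M} (φ : OpenPartialHomeomorph M (P × Q)) (z : P × Q × ℝ) :
    localRep (0 : DNC P E ι → ℂ) φ z = 0 := by
  unfold localRep; split_ifs <;> simp

theorem IsSrc.zero {ι : X → M} : IsSrc Q (0 : DNC P E ι → ℂ) where
  contMDiffOn_pos := by
    have : posPart (0 : DNC P E ι → ℂ) = fun _ => 0 := by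
      funext z; simp [posPart]
    rw [this]
    exact contMDiffOn_const
  contDiffOn_localRep φ hφ := by
    simp only [funext (localRep_zero (ι := ι) φ)]
    exact contDiffOn_const
  conic_compact_support := ⟨∅, isCompact_empty, empty_subset _, fun _ h => h.elim, fun _ _ _ => rfl⟩
  rapid_decay φ hφ χ h1 h2 := by
    simpa only [localRep_zero, zero_mul] using IsSrcLocal.zero φ.target

variable (P E Q) in
/-- The vector space `𝒮_{r,c}(𝒟_X^M)`; the normal spaces of `X` in `M` are modelled on `Q`. -/
def Src (ι : X → M) : Submodule ℂ (DNC P E ι → ℂ) where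
  carrier := {g | IsSrc Q g}
  add_mem' := IsSrc.add
  zero_mem' := IsSrc.zero
  smul_mem' c _ := IsSrc.smul c

end DeformationToNormalCone

/-! ### The tangent groupoid -/

namespace LieGroupoid

variable {p q : ℕ} {G X : Type*}
  [TopologicalSpace G] [ChartedSpace (Euc (p + q)) G] [IsManifold (𝓡 (p + q)) ∞ G]
  [TopologicalSpace X] [ChartedSpace (Euc p) X] [IsManifold (𝓡 p) ∞ X]
  (𝒢 : LieGroupoid p q G X)

/-- `G⁽²⁾`. -/
abbrev Comp : Type _ := 𝒢.toSubmersionPair.Composable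

/-- The tangent groupoid `Gᵀ`, that is the deformation to the normal cone of `u : X → G`. -/
abbrev Tangent : Type _ := DNC (Euc p) (Euc (p + q)) 𝒢.u

/-- The source map of the tangent groupoid. -/
def sT : 𝒢.Tangent → X × Icc (0 : ℝ) 1
  | .zero x _ => (x, ⟨0, le_rfl, zero_le_one⟩)
  | .pos γ t => (𝒢.s γ, ⟨t, t.2.1.le, t.2.2⟩)

/-- The target map of the tangent groupoid. -/
def rT : 𝒢.Tangent → X × Icc (0 : ℝ) 1
  | .zero x _ => (x, ⟨0, le_rfl, zero_le_one⟩)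
  | .pos γ t => (𝒢.r γ, ⟨t, t.2.1.le, t.2.2⟩)

/-- `(Gᵀ)⁽²⁾`. -/
structure TangentComp where
  fst : 𝒢.Tangent
  snd : 𝒢.Tangent
  comp : 𝒢.sT fst = 𝒢.rT snd

/-- The pair `((x, η, 0), (x, ξ, 0))`. -/
def TangentComp.zero (x : X) (η ξ : NormalSpace (Euc p) (Euc (p + q)) 𝒢.u x) : 𝒢.TangentComp :=
  ⟨.zero x η, .zero x ξ, rfl⟩

/-- The pair `((γ, t), (β, t))`. -/
def TangentComp.pos (c : 𝒢.Comp) (t : Ioc (0 : ℝ) 1) : 𝒢.TangentComp :=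
  ⟨.pos c.fst t, .pos c.snd t, Prod.ext c.comp rfl⟩

/-- The inclusion `x ↦ (x, x)` of the units into `G⁽²⁾`. -/
def u₂ (x : X) : 𝒢.Comp := ⟨𝒢.u x, 𝒢.u x, (𝒢.s_u x).trans (𝒢.r_u x).symm⟩

theorem contMDiff_u₂ : ContMDiff (𝓡 p) 𝓘(ℝ, Euc (p + q) × Euc q) ∞ 𝒢.u₂ :=
  𝒢.contMDiff_of_val (𝒢.contMDiff_u.prodMk 𝒢.contMDiff_u)

theorem contMDiff_fst : ContMDiff 𝓘(ℝ, Euc (p + q) × Euc q) (𝓡 (p + q)) ∞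
    (fun c : 𝒢.Comp => c.fst) :=
  _root_.contMDiff_fst.comp 𝒢.contMDiff_val

theorem contMDiff_snd : ContMDiff 𝓘(ℝ, Euc (p + q) × Euc q) (𝓡 (p + q)) ∞
    (fun c : 𝒢.Comp => c.snd) :=
  _root_.contMDiff_snd.comp 𝒢.contMDiff_val

/-- The canonical identification of the deformation to the normal cone of the units in `G⁽²⁾` with
`(Gᵀ)⁽²⁾`; it is given by the deformations of the two projections `G⁽²⁾ → G`. -/
def compIdent : DNC (Euc p) (Euc (p + q) × Euc q) 𝒢.u₂ → 𝒢.TangentComp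
  | .zero x ζ => TangentComp.zero 𝒢 x
      (normalMap (Euc p) (fun c : 𝒢.Comp => c.fst)
        (𝒢.contMDiff_fst.mdifferentiable (by simp)) 𝒢.u₂
        (𝒢.contMDiff_u₂.mdifferentiable (by simp)) x ζ)
      (normalMap (Euc p) (fun c : 𝒢.Comp => c.snd)
        (𝒢.contMDiff_snd.mdifferentiable (by simp)) 𝒢.u₂
        (𝒢.contMDiff_u₂.mdifferentiable (by simp)) x ζ)
  | .pos c t => TangentComp.pos 𝒢 c t

/-- `𝒮_{r,c}(Gᵀ)`. -/
abbrev SrcT : Submodule ℂ (𝒢.Tangent → ℂ) := Src (Euc p) (Euc (p + q)) (Euc q) 𝒢.u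

/-- `𝒮_{r,c}((Gᵀ)⁽²⁾)`: the functions on `(Gᵀ)⁽²⁾` that belong to `𝒮_{r,c}` of the deformation to the
normal cone of the units in `G⁽²⁾` under the identification `compIdent`. -/
def SrcT₂ : Submodule ℂ (𝒢.TangentComp → ℂ) :=
  (Src (Euc p) (Euc (p + q) × Euc q) (Euc q × Euc q) 𝒢.u₂).comap
    (LinearMap.funLeft ℂ ℂ 𝒢.compIdent)

/-! ### Haar systems -/

/-- `G_x = {γ : s γ = x}`. -/
abbrev Fibre (x : X) : Type _ := {γ : G // 𝒢.s γ = x}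

/-- `T_x G_x`, as the kernel of the differential of `s` at the unit `x`. -/
abbrev FibreTangent (x : X) : Submodule ℝ (Euc (p + q)) :=
  LinearMap.ker (mfderiv (𝓡 (p + q)) (𝓡 p) 𝒢.s (𝒢.u x) : Euc (p + q) →L[ℝ] Euc p).toLinearMap

/-- Charts `φ` of `G` and `ψ` of `X` (smooth, with smooth inverses) in which `s` is the projection
`(a, b) ↦ a`. -/
structure IsFibredChart (φ : OpenPartialHomeomorph G (Euc p × Euc q))
    (ψ : OpenPartialHomeomorph X (Euc p)) : Prop where
  contMDiffOn : ContMDiffOn (𝓡 (p + q)) 𝓘(ℝ, Euc p × Euc q) ∞ φ φ.source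
  contMDiffOn_symm : ContMDiffOn 𝓘(ℝ, Euc p × Euc q) (𝓡 (p + q)) ∞ φ.symm φ.target
  contMDiffOn_base : ContMDiffOn (𝓡 p) (𝓡 p) ∞ ψ ψ.source
  contMDiffOn_base_symm : ContMDiffOn (𝓡 p) (𝓡 p) ∞ ψ.symm ψ.target
  mapsTo : MapsTo 𝒢.s φ.source ψ.source
  base_s : ∀ γ ∈ φ.source, ψ (𝒢.s γ) = (φ γ).1

/-- `b ↦ d(φ⁻¹)_w (0, b)`. -/
def fibreDeriv (φ : OpenPartialHomeomorph G (Euc p × Euc q)) (w : Euc p × Euc q)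
    (b : Euc q) : Euc (p + q) :=
  mfderiv 𝓘(ℝ, Euc p × Euc q) (𝓡 (p + q)) φ.symm w ((0, b) : Euc p × Euc q)

/-- A smooth Haar system given by 1-densities: a right invariant family of measures `fibre x` on the
fibres `G_x` that are given by a smooth positive density along the fibres of `s`, together with the
constant measures `tangent x` on the vector spaces `T_x G_x` given by the value of that density at
the unit `x`. In fibred charts the density is `ρ(a, b) db`. -/
structure HaarSystem [MeasurableSpace G] where
  fibre : ∀ x : X, Measure (𝒢.Fibre x)
  tangent : ∀ x : X, Measure (𝒢.FibreTangent x)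
  right_invariant : ∀ η : G,
    (fibre (𝒢.r η)).map (fun γ => (⟨𝒢.mul ⟨γ.1, η, γ.2⟩, 𝒢.s_mul _⟩ : 𝒢.Fibre (𝒢.s η))) =
      fibre (𝒢.s η)
  smooth_density : ∀ (φ : OpenPartialHomeomorph G (Euc p × Euc q))
    (ψ : OpenPartialHomeomorph X (Euc p)), 𝒢.IsFibredChart φ ψ →
    ∃ ρ : Euc p × Euc q → ℝ, ContDiffOn ℝ ∞ ρ φ.target ∧ (∀ w ∈ φ.target, 0 < ρ w) ∧
      (∀ x ∈ ψ.source, ((fibre x).map Subtype.val).restrict φ.source =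
        ((volume.restrict {b | (ψ x, b) ∈ φ.target}).withDensity
          fun b => ENNReal.ofReal (ρ (ψ x, b))).map fun b => φ.symm (ψ x, b)) ∧
      ∀ x : X, 𝒢.u x ∈ φ.source → (tangent x).map Subtype.val =
        ENNReal.ofReal (ρ (φ (𝒢.u x))) •
          (volume : Measure (Euc q)).map (fibreDeriv φ (φ (𝒢.u x)))

/-! ### Integration along the fibres and convolution -/

/-- The class of a vector of `T_x G_x` in the normal space of the units at `x`. -/
def toNormal (x : X) (η : 𝒢.FibreTangent x) : NormalSpace (Euc p) (Euc (p + q)) 𝒢.u x :=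
  Submodule.Quotient.mk (η : Euc (p + q))

/-- The composable pair `(γ δ⁻¹, δ)`. -/
def divPair (γ : G) (δ : 𝒢.Fibre (𝒢.s γ)) : 𝒢.Comp :=
  ⟨𝒢.mul ⟨γ, 𝒢.inv δ.1, δ.2.symm.trans (𝒢.r_inv δ.1).symm⟩, δ.1,
    (𝒢.s_mul _).trans (𝒢.s_inv δ.1)⟩

/-- `η ↦ F(x, ξ - η, η, 0)` on `T_x G_x`. -/
def integrandZero (F : 𝒢.TangentComp → ℂ) (x : X)
    (ξ : NormalSpace (Euc p) (Euc (p + q)) 𝒢.u x) : 𝒢.FibreTangent x → ℂ :=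
  fun η => F (TangentComp.zero 𝒢 x (ξ - 𝒢.toNormal x η) (𝒢.toNormal x η))

/-- `δ ↦ F(γ δ⁻¹, δ, t) t^{-q}` on `G_{s γ}`. -/
def integrandPos (F : 𝒢.TangentComp → ℂ) (γ : G) (t : Ioc (0 : ℝ) 1) :
    𝒢.Fibre (𝒢.s γ) → ℂ :=
  fun δ => F (TangentComp.pos 𝒢 (𝒢.divPair γ δ) t) * (((t : ℝ) ^ q)⁻¹ : ℝ)

variable [MeasurableSpace G] {𝒢}

/-- All integrals that define the integral of `F` along the fibres of the product converge. -/
structure HaarSystem.FibreIntegrable (μ : 𝒢.HaarSystem) (F : 𝒢.TangentComp → ℂ) : Prop where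
  zero : ∀ x ξ, Integrable (𝒢.integrandZero F x ξ) (μ.tangent x)
  pos : ∀ γ t, Integrable (𝒢.integrandPos F γ t) (μ.fibre (𝒢.s γ))

/-- `m_{r,c}(F)`, the integral of `F` along the fibres of the product of the tangent groupoid. -/
def HaarSystem.fibreIntegral (μ : 𝒢.HaarSystem) (F : 𝒢.TangentComp → ℂ) : 𝒢.Tangent → ℂ
  | .zero x ξ => ∫ η, 𝒢.integrandZero F x ξ η ∂μ.tangent x
  | .pos γ t => ∫ δ, 𝒢.integrandPos F γ t δ ∂μ.fibre (𝒢.s γ)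

/-- The function `(a, b) ↦ f(a) g(b)` on `(Gᵀ)⁽²⁾`. -/
def prodComp (f g : 𝒢.Tangent → ℂ) : 𝒢.TangentComp → ℂ := fun c => f c.fst * g c.snd

/-- The convolution product, i.e. `(f * g)(x, ξ, 0) = ∫ f(x, ξ - η, 0) g(x, η, 0) dμ_x(η)` and
`(f * g)(γ, t) = ∫ f(γ δ⁻¹, t) g(δ, t) t^{-q} dμ_{s γ}(δ)`. -/
def HaarSystem.conv (μ : 𝒢.HaarSystem) (f g : 𝒢.Tangent → ℂ) : 𝒢.Tangent → ℂ :=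
  μ.fibreIntegral (prodComp f g)

end LieGroupoid

end TangentGroupoid

end

noncomputable section

namespace TangentGroupoid

/-! Everything is read in blown-up coordinates `(x, ξ, t)`, where a function on the deformation is
smooth up to `t = 0` and rapidly decreasing in `ξ`. A smooth map that respects the submanifolds
becomes `(x, ξ, t) ↦ (T (x, tξ), B (x, tξ) ξ, t)` there, with `B` supplied by Hadamard's lemma
(`exists_localRep_eq_blowMap`). Locally its derivatives grow at most polynomially in `ξ`, so
composition with it preserves decay in the variable `B ξ`, and this is decay in `ξ` as soon as `B`
is injective. `TameOn` is the calculus of these weighted estimates. Applied to changes of slice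
charts it reduces membership in `Src` to one slice chart around each point of the submanifold,
besides smoothness for `t > 0` and conic compact support (`isSrc_of_tameOn_localRep`).

For the fibre integral, take a chart of `G` in which `s` is the projection `(a, b) ↦ a` and the
units are `b = 0`. A pair `(γ, δ)` is described by the coordinates `(a, b)` of `γδ` and `(a, d)` of
`δ` (`compChart`), so that multiplication becomes `(a, b, d) ↦ (a, b)`. Near a unit the conic
support confines the integrand to this one chart. The substitution `d = tη` turns the integral into
`∫ F(a, (ξ, η), t) ρ(a, tη) dη`: the factor `t^{-q}` cancels the Jacobian. The same formula at `t =
0` is the integral over `T_x G_x`, because division has normal derivative `(ξ, η) ↦ ξ - η` at the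
units. Integrating out `η` keeps smoothness and decay (`TameOn.integral`). For `t > 0` a partition
of unity in `δ` reduces smoothness to differentiation under a compactly supported integral.

Convolution is the fibre integral of `f(γ) g(δ)`. The normal derivatives of the two projections are
jointly injective, so decay of `f` and `g` in their own variables gives decay of the product in all
of them (`prodComp_mem`). Associativity for `t > 0` is Fubini together with right invariance. It
extends to `t = 0` by continuity, since both sides are already known to lie in the space. -/

/-! ### Differentiation under the integral sign on convex sets -/

/-- The mean value inequality on the convex set `S` bounds the remainder quotient by `2 * b`, and
dominated convergence applies. Derivatives are taken within `S` because the parameter `t` runs over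
an interval with end points. -/
theorem hasFDerivWithinAt_integral_of_dominated {V Y F : Type*} [NormedAddCommGroup V]
    [NormedSpace ℝ V] [NormedAddCommGroup F] [NormedSpace ℝ F] [MeasurableSpace Y]
    {ν : Measure Y} {S : Set V} (hS : Convex ℝ S) {f : V → Y → F} {f' : V → Y → V →L[ℝ] F}
    {b : Y → ℝ} (hb : Integrable b ν)
    (hf : ∀ v ∈ S, ∀ η, HasFDerivWithinAt (fun v => f v η) (f' v η) S v)
    (hfi : ∀ v ∈ S, Integrable (f v) ν)
    (hf' : ∀ v ∈ S, AEStronglyMeasurable (f' v) ν)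
    (hfb : ∀ᵐ η ∂ν, ∀ v ∈ S, ‖f' v η‖ ≤ b η) {x : V} (hx : x ∈ S) :
    HasFDerivWithinAt (fun v => ∫ η, f v η ∂ν) (∫ η, f' x η ∂ν) S x := by
  have hf'i : Integrable (f' x) ν := hb.mono' (hf' x hx) (hfb.mono fun η h => h x hx)
  rw [hasFDerivWithinAt_iff_tendsto]
  have key : Filter.Tendsto
      (fun x' => ∫ η, ‖x' - x‖⁻¹ * ‖f x' η - f x η - f' x η (x' - x)‖ ∂ν) (𝓝[S] x)
      (𝓝 (∫ η, (0 : ℝ) ∂ν)) := by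
    refine tendsto_integral_filter_of_dominated_convergence (fun η => 2 * b η) ?_ ?_
      (hb.const_mul 2) ?_
    · filter_upwards [self_mem_nhdsWithin] with x' hx'
      exact ((((hfi x' hx').sub (hfi x hx)).sub (hf'i.apply_continuousLinearMap _)).norm.const_mul
        _).aestronglyMeasurable
    · filter_upwards [self_mem_nhdsWithin] with x' hx'
      filter_upwards [hfb] with η hη
      have h1 : ‖f x' η - f x η‖ ≤ b η * ‖x' - x‖ :=
        hS.norm_image_sub_le_of_norm_hasFDerivWithin_le (fun v hv => hf v hv η)
          (fun v hv => hη v hv) hx hx'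
      have h2 : ‖f' x η (x' - x)‖ ≤ b η * ‖x' - x‖ :=
        (f' x η).le_of_opNorm_le (hη x hx) _
      have h0 : 0 ≤ b η := (norm_nonneg _).trans (hη x hx)
      rw [norm_mul, norm_norm, norm_inv, norm_norm]
      have h3 : ‖f x' η - f x η - f' x η (x' - x)‖ ≤ 2 * b η * ‖x' - x‖ :=
        (norm_sub_le _ _).trans (by linarith)
      -- At `x' = x` the quotient is `0`, by the convention `0⁻¹ = 0`.
      rcases eq_or_ne ‖x' - x‖ 0 with h | h
      · rw [h]; simpa using h0
      · have hp : 0 < ‖x' - x‖ := lt_of_le_of_ne (norm_nonneg _) h.symm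
        rw [inv_mul_le_iff₀ hp]; linarith
    · filter_upwards with η
      exact (hasFDerivWithinAt_iff_tendsto.1 (hf x hx η))
  rw [integral_zero] at key
  refine squeeze_zero_norm' ?_ key
  filter_upwards [self_mem_nhdsWithin] with x' hx'
  rw [norm_mul, norm_inv, norm_norm, norm_norm, integral_const_mul]
  refine mul_le_mul_of_nonneg_left ?_ (by positivity)
  have e : (∫ η, f x' η ∂ν) - (∫ η, f x η ∂ν) - (∫ η, f' x η ∂ν) (x' - x) =
      ∫ η, f x' η - f x η - f' x η (x' - x) ∂ν := by
    rw [ContinuousLinearMap.integral_apply hf'i, ← integral_sub (hfi x' hx') (hfi x hx)]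
    exact (integral_sub ((hfi x' hx').sub (hfi x hx)) (hf'i.apply_continuousLinearMap _)).symm
  rw [e]
  exact norm_integral_le_integral_norm _

/-- Completeness of the target is transported along the isometry. The use is for currying of
multilinear maps. -/
theorem integral_linearIsometryEquiv_comp {Y E₁ F₁ : Type*} [NormedAddCommGroup E₁]
    [NormedSpace ℝ E₁] [CompleteSpace E₁] [NormedAddCommGroup F₁] [NormedSpace ℝ F₁]
    [MeasurableSpace Y] {ν : Measure Y} (e : E₁ ≃ₗᵢ[ℝ] F₁) {f : Y → E₁} (hf : Integrable f ν) :
    ∫ η, e (f η) ∂ν = e (∫ η, f η ∂ν) := by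
  have : CompleteSpace F₁ := e.toIsometryEquiv.completeSpace_iff.1 ‹_›
  exact e.toContinuousLinearEquiv.toContinuousLinearMap.integral_comp_comm hf

theorem aestronglyMeasurable_linearIsometryEquiv_comp {Y E₁ F₁ : Type*} [NormedAddCommGroup E₁]
    [NormedSpace ℝ E₁] [NormedAddCommGroup F₁] [NormedSpace ℝ F₁]
    [MeasurableSpace Y] {ν : Measure Y} (e : E₁ ≃ₗᵢ[ℝ] F₁) {f : Y → E₁}
    (hf : AEStronglyMeasurable f ν) : AEStronglyMeasurable (fun η => e (f η)) ν :=
  e.continuous.comp_aestronglyMeasurable hf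

/-- The integrals of the derivatives of `h`, precomposed with `A`, form a Taylor series of the
integral. The affine form `A v + B η` makes each derivative in `v` a pullback along `A`, which
produces the factor `‖A‖ ^ n`; in `η` only continuity is needed. -/
theorem contDiffOn_integral {V Z Y F : Type*} [NormedAddCommGroup V] [NormedSpace ℝ V]
    [NormedAddCommGroup Z] [NormedSpace ℝ Z] [NormedAddCommGroup F] [NormedSpace ℝ F]
    [CompleteSpace F] [TopologicalSpace Y] [SecondCountableTopology Y] [MeasurableSpace Y]
    [OpensMeasurableSpace Y] {ν : Measure Y} {S : Set V} (hS : Convex ℝ S)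
    (hSu : UniqueDiffOn ℝ S) {S' : Set Z} (hS' : UniqueDiffOn ℝ S') {h : Z → F}
    (hh : ContDiffOn ℝ ∞ h S') (A : V →L[ℝ] Z) {B : Y → Z} (hB : Continuous B)
    (hAB : ∀ v ∈ S, ∀ η, A v + B η ∈ S') {b : ℕ → Y → ℝ} (hb : ∀ n, Integrable (b n) ν)
    (hbd : ∀ n, ∀ᵐ η ∂ν, ∀ v ∈ S, ‖iteratedFDerivWithin ℝ n h S' (A v + B η)‖ ≤ b n η) :
    ContDiffOn ℝ ∞ (fun v => ∫ η, h (A v + B η) ∂ν) S ∧ ∀ n, ∀ v ∈ S,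
      ‖iteratedFDerivWithin ℝ n (fun v => ∫ η, h (A v + B η) ∂ν) S v‖ ≤
        ‖A‖ ^ n * ∫ η, ‖iteratedFDerivWithin ℝ n h S' (A v + B η)‖ ∂ν := by
  have hcD : ∀ n : ℕ, ContinuousOn (iteratedFDerivWithin ℝ n h S') S' := fun n =>
    hh.continuousOn_iteratedFDerivWithin (mod_cast le_top) hS'
  have hcY : ∀ n : ℕ, ∀ v ∈ S, Continuous fun η => iteratedFDerivWithin ℝ n h S' (A v + B η) :=
    fun n v hv => (hcD n).comp_continuous (continuous_const.add hB) (hAB v hv)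
  have hDi : ∀ n : ℕ, ∀ v ∈ S,
      Integrable (fun η => iteratedFDerivWithin ℝ n h S' (A v + B η)) ν := fun n v hv =>
    (hb n).mono' (hcY n v hv).aestronglyMeasurable ((hbd n).mono fun η hη => hη v hv)
  let L : ∀ n : ℕ, ContinuousMultilinearMap ℝ (fun _ : Fin n => Z) F →L[ℝ]
      ContinuousMultilinearMap ℝ (fun _ : Fin n => V) F :=
    fun n => ContinuousMultilinearMap.compContinuousLinearMapL fun _ => A
  have hL : ∀ n (g : ContinuousMultilinearMap ℝ (fun _ : Fin n => Z) F), ‖L n g‖ ≤ ‖A‖ ^ n * ‖g‖ := by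
    intro n g
    have := ContinuousMultilinearMap.norm_compContinuousLinearMap_le g (fun _ : Fin n => A)
    rw [Finset.prod_const, Finset.card_univ, Fintype.card_fin] at this
    rw [mul_comm]; exact this
  let p : V → FormalMultilinearSeries ℝ V F := fun v n =>
    ∫ η, L n (iteratedFDerivWithin ℝ n h S' (A v + B η)) ∂ν
  have hder : ∀ n : ℕ, ∀ v ∈ S, ∀ η, HasFDerivWithinAt
      (fun v => L n (iteratedFDerivWithin ℝ n h S' (A v + B η)))
      ((L n).comp (((iteratedFDerivWithin ℝ (n + 1) h S' (A v + B η)).curryLeft).comp A)) S v := by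
    intro n v hv η
    have h1 := (hh.ftaylorSeriesWithin hS').fderivWithin n (mod_cast WithTop.coe_lt_top n)
      (A v + B η) (hAB v hv η)
    have h2 : HasFDerivWithinAt (fun v => A v + B η) A S v :=
      (A.hasFDerivWithinAt).add_const _
    exact (L n).hasFDerivAt.comp_hasFDerivWithinAt v (h1.comp v h2 fun w hw => hAB w hw η)
  -- Differentiating the pulled back `n`-th coefficient gives the curried pullback of the next one;
  -- this is the compatibility demanded of a Taylor series.
  have hcurry : ∀ (n : ℕ) (g : ContinuousMultilinearMap ℝ (fun _ : Fin (n + 1) => Z) F),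
      (L n).comp (g.curryLeft.comp A) = (L (n + 1) g).curryLeft := by
    intro n g
    ext v m
    simp only [L, ContinuousLinearMap.comp_apply,
      ContinuousMultilinearMap.compContinuousLinearMapL_apply,
      ContinuousMultilinearMap.compContinuousLinearMap_apply,
      ContinuousMultilinearMap.curryLeft_apply]
    congr 1
    ext i
    refine Fin.cases ?_ (fun j => ?_) i <;> simp
  have hLi : ∀ n : ℕ, ∀ v ∈ S,
      Integrable (fun η => L n (iteratedFDerivWithin ℝ n h S' (A v + B η))) ν :=
    fun n v hv => (L n).integrable_comp (hDi n v hv)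
  have hp : HasFTaylorSeriesUpToOn ∞ (fun v => ∫ η, h (A v + B η) ∂ν) p S := by
    have hd : ∀ n : ℕ, ∀ v ∈ S, HasFDerivWithinAt (p · n) (p v n.succ).curryLeft S v := by
      intro n v hv
      have := hasFDerivWithinAt_integral_of_dominated hS (ν := ν)
        ((hb (n + 1)).const_mul (‖A‖ ^ (n + 1))) (hder n) (hLi n)
        (fun v hv => ?_) ?_ hv
      · rw [integral_congr_ae (Filter.Eventually.of_forall fun η => hcurry n _)] at this
        refine this.congr_fderiv ?_
        exact integral_linearIsometryEquiv_comp
          (F₁ := V →L[ℝ] V [×n]→L[ℝ] F)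
          (continuousMultilinearCurryLeftEquiv ℝ (fun _ : Fin (n + 1) => V) F) (hLi (n + 1) v hv)
      · simp only [hcurry]
        exact aestronglyMeasurable_linearIsometryEquiv_comp
          (F₁ := V →L[ℝ] V [×n]→L[ℝ] F)
          (continuousMultilinearCurryLeftEquiv ℝ (fun _ : Fin (n + 1) => V) F)
          ((L (n + 1)).continuous.comp (hcY (n + 1) v hv)).aestronglyMeasurable
      · filter_upwards [hbd (n + 1)] with η hη v hv
        rw [hcurry, ContinuousMultilinearMap.curryLeft_norm]
        exact (hL _ _).trans (mul_le_mul_of_nonneg_left (hη v hv) (by positivity))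
    refine ⟨fun v hv => ?_, fun n _ => hd n, fun n _ v hv => (hd n v hv).continuousWithinAt⟩
    change (continuousMultilinearCurryFin0 ℝ V F) (p v 0) = _
    have := ((continuousMultilinearCurryFin0 ℝ V
          F).toContinuousLinearEquiv.toContinuousLinearMap.integral_comp_comm (hLi 0 v hv)).symm
    refine this.trans ?_
    congr 1
  refine ⟨hp.contDiffOn, fun n v hv => ?_⟩
  rw [← hp.eq_iteratedFDerivWithin_of_uniqueDiffOn (mod_cast le_top) hSu hv]
  refine (norm_integral_le_integral_norm _).trans ?_
  rw [← integral_const_mul]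
  exact integral_mono (hLi n v hv).norm ((hDi n v hv).norm.const_mul _) fun η => hL _ _

/-! ### Bounds for iterated derivatives at a point -/

section PointwiseBounds

variable {D E F H : Type*} [NormedAddCommGroup D] [NormedSpace ℝ D] [NormedAddCommGroup E]
  [NormedSpace ℝ E] [NormedAddCommGroup F] [NormedSpace ℝ F] [NormedAddCommGroup H]
  [NormedSpace ℝ H]

/-- Smoothness at a point gives smoothness of order `n` near it, and intersecting with an open set
does not change derivatives within `s`. The Leibniz bound is thus available for functions that are
smooth at some points of `s` only. -/
theorem norm_iteratedFDerivWithin_bilinear_le_of_contDiffWithinAt (B : E →L[ℝ] F →L[ℝ] H)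
    {f : D → E} {g : D → F} {s : Set D} {x : D} (hf : ContDiffWithinAt ℝ ∞ f s x)
    (hg : ContDiffWithinAt ℝ ∞ g s x) (hs : UniqueDiffOn ℝ s) (hx : x ∈ s) (n : ℕ) :
    ‖iteratedFDerivWithin ℝ n (fun y => B (f y) (g y)) s x‖ ≤
      ‖B‖ * ∑ i ∈ Finset.range (n + 1), (n.choose i : ℝ) * ‖iteratedFDerivWithin ℝ i f s x‖ *
        ‖iteratedFDerivWithin ℝ (n - i) g s x‖ := by
  obtain ⟨u, hu, hxu, hfu⟩ := hf.contDiffOn' (m := n) (mod_cast le_top) (by simp)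
  obtain ⟨v, hv, hxv, hgv⟩ := hg.contDiffOn' (m := n) (mod_cast le_top) (by simp)
  rw [insert_eq_of_mem hx] at hfu hgv
  have hxw : x ∈ u ∩ v := ⟨hxu, hxv⟩
  have hw : IsOpen (u ∩ v) := hu.inter hv
  have := B.norm_iteratedFDerivWithin_le_of_bilinear (n := n)
    (hfu.mono (inter_subset_inter_right s inter_subset_left))
    (hgv.mono (inter_subset_inter_right s inter_subset_right)) (hs.inter hw) ⟨hx, hxw⟩ le_rfl
  simpa only [iteratedFDerivWithin_inter_open hw hxw] using this

/-- The same localisation for the chain rule. The open set `w` comes from continuity of `f` and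
keeps its values where `g` is smooth. -/
theorem norm_iteratedFDerivWithin_comp_le_of_contDiffWithinAt {g : F → H} {f : E → F} {s : Set E}
    {t : Set F} {x : E} (hg : ContDiffWithinAt ℝ ∞ g t (f x)) (hf : ContDiffWithinAt ℝ ∞ f s x)
    (ht : UniqueDiffOn ℝ t) (hs : UniqueDiffOn ℝ s) (hst : MapsTo f s t) (hx : x ∈ s) {n : ℕ}
    {C K : ℝ} (hC : ∀ i ≤ n, ‖iteratedFDerivWithin ℝ i g t (f x)‖ ≤ C)
    (hK : ∀ i, 1 ≤ i → i ≤ n → ‖iteratedFDerivWithin ℝ i f s x‖ ≤ K ^ i) :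
    ‖iteratedFDerivWithin ℝ n (g ∘ f) s x‖ ≤ n.factorial * C * K ^ n := by
  obtain ⟨u, hu, hxu, hgu⟩ := hg.contDiffOn' (m := n) (mod_cast le_top) (by simp)
  obtain ⟨v, hv, hxv, hfv⟩ := hf.contDiffOn' (m := n) (mod_cast le_top) (by simp)
  rw [insert_eq_of_mem hx] at hfv
  rw [insert_eq_of_mem (hst hx)] at hgu
  obtain ⟨w, hw, hwe⟩ := continuousOn_iff'.1 hfv.continuousOn u hu
  have hxw : x ∈ w ∩ v := ⟨(hwe.subset ⟨hxu, hx, hxv⟩).1, hxv⟩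
  have hwv : IsOpen (w ∩ v) := hw.inter hv
  have hmap : MapsTo f (s ∩ (w ∩ v)) (t ∩ u) := fun y hy =>
    ⟨hst hy.1, (hwe.symm.subset ⟨hy.2.1, hy.1, hy.2.2⟩).1⟩
  have := norm_iteratedFDerivWithin_comp_le (n := n) (x := x) (C := C) (D := K) hgu
    (hfv.mono (inter_subset_inter_right s inter_subset_right)) le_rfl (ht.inter hu)
    (hs.inter hwv) hmap ⟨hx, hxw⟩
  simp only [iteratedFDerivWithin_inter_open hwv hxw, iteratedFDerivWithin_inter_open hu hxu]
    at this
  exact this hC hK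

end PointwiseBounds

/-! ### Functions with weighted bounds on all derivatives -/

section Tame

variable {P Q F : Type*} [NormedAddCommGroup P] [NormedSpace ℝ P] [NormedAddCommGroup Q]
  [NormedSpace ℝ Q] [NormedAddCommGroup F] [NormedSpace ℝ F]

variable (P Q) in
/-- `P × Q × [0, 1]`. -/
def Slab : Set (P × Q × ℝ) := {z | z.2.2 ∈ Icc (0 : ℝ) 1}

/-- `(x, ξ, t) ↦ ((x, t ξ), t)`. -/
def blow (z : P × Q × ℝ) : (P × Q) × ℝ := ((z.1, z.2.2 • z.2.1), z.2.2)

theorem slab_eq : Slab P Q = univ ×ˢ (univ ×ˢ Icc (0 : ℝ) 1) := by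
  ext z; simp [Slab]

theorem uniqueDiffOn_slab : UniqueDiffOn ℝ (Slab P Q) := by
  rw [slab_eq]
  exact uniqueDiffOn_univ.prod (uniqueDiffOn_univ.prod (uniqueDiffOn_Icc zero_lt_one))

theorem convex_slab : Convex ℝ (Slab P Q) := by
  rw [slab_eq]
  exact convex_univ.prod (convex_univ.prod (convex_Icc 0 1))

theorem contDiff_blow : ContDiff ℝ ∞ (blow : P × Q × ℝ → (P × Q) × ℝ) := by
  unfold blow; fun_prop

theorem continuous_blow : Continuous (blow : P × Q × ℝ → (P × Q) × ℝ) := contDiff_blow.continuous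

/-- Smoothness on the points of the slab that lie over `U`, with bounds
`w ^ k ‖D ^ n h‖ ≤ C (1 + ‖ξ‖) ^ N` for all `k` and `n`, where `N` depends on `n` only. -/
structure TameOn (w : P × Q × ℝ → ℝ) (U : Set ((P × Q) × ℝ)) (h : P × Q × ℝ → F) : Prop where
  contDiffWithinAt : ∀ z ∈ Slab P Q, blow z ∈ U → ContDiffWithinAt ℝ ∞ h (Slab P Q) z
  bound : ∀ n : ℕ, ∃ N : ℕ, ∀ k : ℕ, ∃ C : ℝ, ∀ z ∈ Slab P Q, blow z ∈ U →
    w z ^ k * ‖iteratedFDerivWithin ℝ n h (Slab P Q) z‖ ≤ C * (1 + ‖z.2.1‖) ^ N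

variable {w w₁ w₂ : P × Q × ℝ → ℝ} {U V : Set ((P × Q) × ℝ)}

theorem one_le_weight (z : P × Q × ℝ) (N : ℕ) : 1 ≤ (1 + ‖z.2.1‖) ^ N :=
  one_le_pow₀ (by linarith [norm_nonneg z.2.1])

/-- Bounds up to a finite order at once, with a nonnegative constant. -/
theorem TameOn.bound_le {h : P × Q × ℝ → F} (hh : TameOn w U h) (hw : ∀ z, 0 ≤ w z) (n : ℕ) :
    ∃ N : ℕ, ∀ k : ℕ, ∃ C : ℝ, 0 ≤ C ∧ ∀ i ≤ n, ∀ z ∈ Slab P Q, blow z ∈ U →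
      w z ^ k * ‖iteratedFDerivWithin ℝ i h (Slab P Q) z‖ ≤ C * (1 + ‖z.2.1‖) ^ N := by
  choose N hN using hh.bound
  refine ⟨∑ i ∈ Finset.range (n + 1), N i, fun k => ?_⟩
  choose C hC using fun n => hN n k
  refine ⟨∑ i ∈ Finset.range (n + 1), |C i|, Finset.sum_nonneg fun i _ => abs_nonneg _,
    fun i hi z hz hU => ?_⟩
  have hi' : i ∈ Finset.range (n + 1) := Finset.mem_range.2 (by omega)
  calc _ ≤ C i * (1 + ‖z.2.1‖) ^ N i := hC i z hz hU
    _ ≤ |C i| * (1 + ‖z.2.1‖) ^ N i := by gcongr; exact le_abs_self _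
    _ ≤ _ := by
      refine mul_le_mul ?_ ?_ (by positivity) (Finset.sum_nonneg fun i _ => abs_nonneg _)
      · exact Finset.single_le_sum (f := fun i => |C i|) (fun i _ => abs_nonneg _) hi'
      · exact pow_le_pow_right₀ (by linarith [norm_nonneg z.2.1])
          (Finset.single_le_sum (f := N) (fun i _ => Nat.zero_le _) hi')

theorem TameOn.mono {h : P × Q × ℝ → F} (hh : TameOn w U h) (hVU : V ⊆ U) : TameOn w V h where
  contDiffWithinAt z hz hV := hh.contDiffWithinAt z hz (hVU hV)
  bound n := by
    obtain ⟨N, hN⟩ := hh.bound n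
    refine ⟨N, fun k => ?_⟩
    obtain ⟨C, hC⟩ := hN k
    exact ⟨C, fun z hz hV => hC z hz (hVU hV)⟩

/-- A bound with a larger weight is stronger; the constant enters as `|c| ^ k`, which is absorbed
since `C` may depend on `k`. -/
theorem TameOn.of_weight_le {h : P × Q × ℝ → F} (hh : TameOn w₁ U h) (h₁ : ∀ z, 0 ≤ w₁ z)
    (h₂ : ∀ z, 0 ≤ w₂ z)
    (c : ℝ) (hw : ∀ z ∈ Slab P Q, blow z ∈ U → w₂ z ≤ c * w₁ z) : TameOn w₂ U h where
  contDiffWithinAt := hh.contDiffWithinAt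
  bound n := by
    obtain ⟨N, hN⟩ := hh.bound n
    refine ⟨N, fun k => ?_⟩
    obtain ⟨C, hC⟩ := hN k
    refine ⟨|c| ^ k * C, fun z hz hU => ?_⟩
    calc _ ≤ (|c| * w₁ z) ^ k * ‖iteratedFDerivWithin ℝ n h (Slab P Q) z‖ := by
          gcongr
          · exact h₂ z
          · exact (hw z hz hU).trans (mul_le_mul_of_nonneg_right (le_abs_self c) (h₁ z))
      _ = |c| ^ k * (w₁ z ^ k * ‖iteratedFDerivWithin ℝ n h (Slab P Q) z‖) := by ring
      _ ≤ |c| ^ k * (C * (1 + ‖z.2.1‖) ^ N) :=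
          mul_le_mul_of_nonneg_left (hC z hz hU) (by positivity)
      _ = _ := by ring

/-- In the Leibniz formula each factor takes the `k`-th power of its own weight, so weights
multiply, while the polynomial losses `N` and `M` add and remain independent of `k`. -/
theorem TameOn.bilinear {F' H : Type*} [NormedAddCommGroup F'] [NormedSpace ℝ F']
    [NormedAddCommGroup H] [NormedSpace ℝ H] (B : F →L[ℝ] F' →L[ℝ] H) {f : P × Q × ℝ → F}
    {g : P × Q × ℝ → F'} (hf : TameOn w₁ U f) (hg : TameOn w₂ U g) (h₁ : ∀ z, 0 ≤ w₁ z)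
    (h₂ : ∀ z, 0 ≤ w₂ z) : TameOn (fun z => w₁ z * w₂ z) U fun z => B (f z) (g z) where
  contDiffWithinAt z hz hU :=
    B.isBoundedBilinearMap.contDiff.comp_contDiffWithinAt
      ((hf.contDiffWithinAt z hz hU).prodMk (hg.contDiffWithinAt z hz hU))
  bound n := by
    obtain ⟨N, hN⟩ := hf.bound_le h₁ n
    obtain ⟨M, hM⟩ := hg.bound_le h₂ n
    refine ⟨N + M, fun k => ?_⟩
    obtain ⟨C, hC0, hC⟩ := hN k
    obtain ⟨D, hD0, hD⟩ := hM k
    refine ⟨‖B‖ * ∑ i ∈ Finset.range (n + 1), (n.choose i : ℝ) * (C * D), fun z hz hU => ?_⟩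
    calc _ ≤ (w₁ z * w₂ z) ^ k * (‖B‖ * ∑ i ∈ Finset.range (n + 1), (n.choose i : ℝ) *
          ‖iteratedFDerivWithin ℝ i f (Slab P Q) z‖ *
          ‖iteratedFDerivWithin ℝ (n - i) g (Slab P Q) z‖) := by
          have := mul_nonneg (h₁ z) (h₂ z)
          gcongr
          exact norm_iteratedFDerivWithin_bilinear_le_of_contDiffWithinAt B
            (hf.contDiffWithinAt z hz hU) (hg.contDiffWithinAt z hz hU) uniqueDiffOn_slab hz n
      _ = ‖B‖ * ∑ i ∈ Finset.range (n + 1), (n.choose i : ℝ) *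
          ((w₁ z ^ k * ‖iteratedFDerivWithin ℝ i f (Slab P Q) z‖) *
          (w₂ z ^ k * ‖iteratedFDerivWithin ℝ (n - i) g (Slab P Q) z‖)) := by
          rw [mul_left_comm, Finset.mul_sum]
          congr 1
          refine Finset.sum_congr rfl fun i _ => ?_
          rw [mul_pow]; ring
      _ ≤ ‖B‖ * ∑ i ∈ Finset.range (n + 1), (n.choose i : ℝ) *
          ((C * (1 + ‖z.2.1‖) ^ N) * (D * (1 + ‖z.2.1‖) ^ M)) := by
          refine mul_le_mul_of_nonneg_left (Finset.sum_le_sum fun i hi => ?_) (norm_nonneg B)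
          have hi' : i ≤ n := Nat.lt_succ_iff.1 (Finset.mem_range.1 hi)
          refine mul_le_mul_of_nonneg_left (mul_le_mul (hC i hi' z hz hU)
            (hD (n - i) (by omega) z hz hU) ?_ (by positivity)) (by positivity)
          exact mul_nonneg (pow_nonneg (h₂ z) k) (norm_nonneg _)
      _ = _ := by
          rw [mul_assoc ‖B‖, Finset.sum_mul]
          congr 1
          refine Finset.sum_congr rfl fun i _ => ?_
          rw [pow_add]; ring

theorem TameOn.prodMk {F' : Type*} [NormedAddCommGroup F'] [NormedSpace ℝ F']
    {f : P × Q × ℝ → F} {g : P × Q × ℝ → F'} (hf : TameOn w U f) (hg : TameOn w U g)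
    (hw : ∀ z, 0 ≤ w z) : TameOn w U fun z => (f z, g z) where
  contDiffWithinAt z hz hU := (hf.contDiffWithinAt z hz hU).prodMk (hg.contDiffWithinAt z hz hU)
  bound n := by
    obtain ⟨N, hN⟩ := hf.bound_le hw n
    obtain ⟨M, hM⟩ := hg.bound_le hw n
    refine ⟨N + M, fun k => ?_⟩
    obtain ⟨C, hC0, hC⟩ := hN k
    obtain ⟨D, hD0, hD⟩ := hM k
    refine ⟨C + D, fun z hz hU => ?_⟩
    rw [iteratedFDerivWithin_prodMk (hf.contDiffWithinAt z hz hU) (hg.contDiffWithinAt z hz hU)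
      uniqueDiffOn_slab hz (mod_cast le_top), ContinuousMultilinearMap.opNorm_prod,
      mul_max_of_nonneg _ _ (pow_nonneg (hw z) k)]
    have a := one_le_weight z N
    have b := one_le_weight z M
    rw [pow_add]
    refine max_le ((hC n le_rfl z hz hU).trans ?_) ((hD n le_rfl z hz hU).trans ?_)
    · exact mul_le_mul (by linarith) (le_mul_of_one_le_right (by linarith) b) (by linarith)
        (by linarith)
    · exact mul_le_mul (by linarith) (le_mul_of_one_le_left (by linarith) a) (by linarith)
        (by linarith)

/-- The first derivative is constant and the higher ones vanish, so only linear growth of `L` itself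
has to be assumed. -/
theorem TameOn.clm (L : P × Q × ℝ →L[ℝ] F) {C : ℝ}
    (hL : ∀ z ∈ Slab P Q, blow z ∈ U → ‖L z‖ ≤ C * (1 + ‖z.2.1‖)) :
    TameOn (fun _ => 1) U L where
  contDiffWithinAt z hz hU := L.contDiff.contDiffWithinAt
  bound n := by
    refine ⟨1, fun k => ?_⟩
    have hgen : ∀ z ∈ Slab P Q, iteratedFDerivWithin ℝ n L (Slab P Q) z = iteratedFDeriv ℝ n L z :=
      fun z hz => iteratedFDerivWithin_eq_iteratedFDeriv uniqueDiffOn_slab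
        L.contDiff.contDiffAt hz
    rcases n with - | n
    · exact ⟨C, fun z hz hU => by simpa using hL z hz hU⟩
    · refine ⟨‖iteratedFDeriv ℝ (n + 1) L 0‖, fun z hz hU => ?_⟩
      rw [hgen z hz, one_pow, one_mul, pow_one]
      have : iteratedFDeriv ℝ (n + 1) L z = iteratedFDeriv ℝ (n + 1) L 0 := by
        ext m
        rw [iteratedFDeriv_succ_apply_right, iteratedFDeriv_succ_apply_right,
          show fderiv ℝ L = fun _ => L from funext fun y => L.fderiv]
        rcases n with - | n
        · simp
        · simp [iteratedFDeriv_const_of_ne]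
      rw [this]
      exact le_mul_of_one_le_right (norm_nonneg _) (by linarith [norm_nonneg z.2.1])

/-- By Faà di Bruno the derivatives of `f` cost a polynomial factor, to the power `n` at most, and
the decay of `g` is measured by its weight at `f z`. That weight need not control `z`, hence the
pulled back weight in the conclusion. -/
theorem TameOn.comp {Z' : Type*} [NormedAddCommGroup Z'] [NormedSpace ℝ Z']
    {g : Z' → F} {f : P × Q × ℝ → Z'} {S' A' : Set Z'} (hS' : UniqueDiffOn ℝ S') {w' : Z' → ℝ}
    (hw' : ∀ z, 0 ≤ w' z)
    (hf : TameOn (fun _ => 1) U f) (hfS : MapsTo f (Slab P Q) S')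
    (hfA : ∀ z ∈ Slab P Q, blow z ∈ U → f z ∈ A')
    (hg : ∀ z ∈ A', ContDiffWithinAt ℝ ∞ g S' z)
    (hgb : ∀ n k : ℕ, ∃ C : ℝ, ∀ z ∈ A', w' z ^ k * ‖iteratedFDerivWithin ℝ n g S' z‖ ≤ C) :
    TameOn (fun z => w' (f z)) U (fun z => g (f z)) where
  contDiffWithinAt z hz hU :=
    (hg (f z) (hfA z hz hU)).comp z (hf.contDiffWithinAt z hz hU) hfS
  bound n := by
    obtain ⟨N, hN⟩ := hf.bound_le (fun _ => zero_le_one) n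
    obtain ⟨D, hD0, hD⟩ := hN 0
    choose C hC using hgb
    refine ⟨N * n, fun k => ?_⟩
    have hC' : ∀ i ≤ n, ∀ z ∈ A', w' z ^ k * ‖iteratedFDerivWithin ℝ i g S' z‖ ≤
        ∑ j ∈ Finset.range (n + 1), |C j k| := fun i hi z hz =>
      (hC i k z hz).trans ((le_abs_self _).trans (Finset.single_le_sum (f := fun j => |C j k|)
        (fun j _ => abs_nonneg _) (Finset.mem_range.2 (by omega))))
    set C₀ := ∑ j ∈ Finset.range (n + 1), |C j k| with hC₀
    have hC₀0 : 0 ≤ C₀ := Finset.sum_nonneg fun j _ => abs_nonneg _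
    refine ⟨n.factorial * C₀ * (1 + D) ^ n, fun z hz hU => ?_⟩
    -- The base is at least `1` thanks to `1 + D`, so it is bounded by its own `i`-th power as the
    -- chain rule estimate requires.
    have hder : ∀ i, 1 ≤ i → i ≤ n → ‖iteratedFDerivWithin ℝ i f (Slab P Q) z‖ ≤
        ((1 + D) * (1 + ‖z.2.1‖) ^ N) ^ i := by
      intro i hi hin
      have h1 := hD i hin z hz hU
      rw [pow_zero, one_mul] at h1
      have h2 : 1 ≤ (1 + D) * (1 + ‖z.2.1‖) ^ N :=
        one_le_mul_of_one_le_of_one_le (by linarith) (one_le_weight z N)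
      calc _ ≤ D * (1 + ‖z.2.1‖) ^ N := h1
        _ ≤ (1 + D) * (1 + ‖z.2.1‖) ^ N := by gcongr; linarith
        _ ≤ _ := le_self_pow₀ h2 (by omega)
    -- The bounds for `g` are divided by `w' (f z) ^ k`. Where the weight vanishes only `k = 0` has
    -- content.
    rcases eq_or_lt_of_le (hw' (f z)) with h0 | hpos
    · rcases k with - | k
      · have hb := norm_iteratedFDerivWithin_comp_le_of_contDiffWithinAt (hg (f z) (hfA z hz hU))
          (hf.contDiffWithinAt z hz hU) hS' uniqueDiffOn_slab hfS hz (C := C₀)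
          (fun i hi => by simpa using hC' i hi (f z) (hfA z hz hU)) hder
        rw [pow_zero, one_mul]
        refine hb.trans (le_of_eq ?_)
        rw [mul_pow, pow_mul]; ring
      · rw [← h0]
        have : 0 ≤ (n.factorial : ℝ) * C₀ * (1 + D) ^ n * (1 + ‖z.2.1‖) ^ (N * n) := by positivity
        simpa using this
    · have hk : 0 < w' (f z) ^ k := pow_pos hpos k
      have hb := norm_iteratedFDerivWithin_comp_le_of_contDiffWithinAt (hg (f z) (hfA z hz hU))
        (hf.contDiffWithinAt z hz hU) hS' uniqueDiffOn_slab hfS hz (C := C₀ / w' (f z) ^ k)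
        (fun i hi => by
          rw [le_div_iff₀ hk, mul_comm]
          exact hC' i hi (f z) (hfA z hz hU)) hder
      calc _ ≤ w' (f z) ^ k * (n.factorial * (C₀ / w' (f z) ^ k) *
            ((1 + D) * (1 + ‖z.2.1‖) ^ N) ^ n) := mul_le_mul_of_nonneg_left hb hk.le
        _ = _ := by
          rw [mul_pow, ← pow_mul]
          field_simp

/-- Openness of `U` makes the two functions agree near each point over `U`, hence in all
derivatives. -/
theorem TameOn.congr {h h' : P × Q × ℝ → F} (hh : TameOn w U h) (hU : IsOpen U)
    (e : ∀ z ∈ Slab P Q, blow z ∈ U → h' z = h z) : TameOn w U h' := by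
  have ev : ∀ z ∈ Slab P Q, blow z ∈ U → h' =ᶠ[𝓝[Slab P Q] z] h := by
    intro z hz hzU
    filter_upwards [self_mem_nhdsWithin,
      nhdsWithin_le_nhds ((hU.preimage continuous_blow).mem_nhds hzU)] with y hy hyU
    exact e y hy hyU
  refine ⟨fun z hz hzU => (hh.contDiffWithinAt z hz hzU).congr_of_eventuallyEq (ev z hz hzU)
    (e z hz hzU), fun n => ?_⟩
  obtain ⟨N, hN⟩ := hh.bound n
  refine ⟨N, fun k => ?_⟩
  obtain ⟨C, hC⟩ := hN k
  refine ⟨C, fun z hz hzU => ?_⟩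
  rw [(ev z hz hzU).iteratedFDerivWithin_eq (e z hz hzU)]
  exact hC z hz hzU

/-- Rapid decay in `ξ` of all derivatives. -/
theorem TameOn.rapid {h : P × Q × ℝ → F} (hh : TameOn (fun z => 1 + ‖z.2.1‖) U h) (k n : ℕ) :
    ∃ C : ℝ, ∀ z ∈ Slab P Q, blow z ∈ U →
      (1 + ‖z.2.1‖) ^ k * ‖iteratedFDerivWithin ℝ n h (Slab P Q) z‖ ≤ C := by
  obtain ⟨N, hN⟩ := hh.bound n
  obtain ⟨C, hC⟩ := hN (k + N)
  refine ⟨C, fun z hz hU => ?_⟩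
  have h1 := hC z hz hU
  have h2 : 0 < (1 + ‖z.2.1‖) ^ N := by positivity
  rw [pow_add, mul_right_comm] at h1
  exact le_of_mul_le_mul_right h1 h2

end Tame

/-! ### Local bounds, Hadamard's lemma and blown up maps -/

/-- A closed ball inside `O` meets `S` in a compact set, on which every derivative is bounded. One
radius serves all orders. -/
theorem exists_ball_bound_iteratedFDerivWithin {Z F : Type*} [NormedAddCommGroup Z]
    [NormedSpace ℝ Z] [FiniteDimensional ℝ Z] [NormedAddCommGroup F] [NormedSpace ℝ F]
    {S O : Set Z} (hS : UniqueDiffOn ℝ S) (hSc : IsClosed S) (hO : IsOpen O) {g : Z → F}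
    (hg : ContDiffOn ℝ ∞ g (S ∩ O)) {x : Z} (hx : x ∈ O) :
    ∃ r > 0, Metric.closedBall x r ⊆ O ∧
      ∀ n : ℕ, ∃ C : ℝ, ∀ z ∈ S ∩ Metric.closedBall x r, ‖iteratedFDerivWithin ℝ n g S z‖ ≤ C := by
  have : ProperSpace Z := FiniteDimensional.proper ℝ Z
  obtain ⟨r, hr, hrO⟩ := Metric.nhds_basis_closedBall.mem_iff.1 (hO.mem_nhds hx)
  refine ⟨r, hr, hrO, fun n => ?_⟩
  have hc : ContinuousOn (iteratedFDerivWithin ℝ n g (S ∩ O)) (S ∩ Metric.closedBall x r) :=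
    (hg.continuousOn_iteratedFDerivWithin (m := n) (mod_cast le_top) (hS.inter hO)).mono
      (inter_subset_inter_right S hrO)
  obtain ⟨C, hC⟩ := ((isCompact_closedBall x r).inter_left hSc).exists_bound_of_continuousOn hc
  refine ⟨C, fun z hz => ?_⟩
  rw [← iteratedFDerivWithin_inter_open hO (hrO hz.2)]
  exact hC z hz

section Hadamard

variable {P Q F : Type*} [NormedAddCommGroup P] [NormedSpace ℝ P] [NormedAddCommGroup Q]
  [NormedSpace ℝ Q] [NormedAddCommGroup F] [NormedSpace ℝ F] [FiniteDimensional ℝ P]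
  [FiniteDimensional ℝ Q]

/-- Multiplication by a bump function. The last clause records that zeros of `f` survive, so a
globalised function still vanishes on the slice. -/
theorem exists_contDiff_eventuallyEq {Z : Type*} [NormedAddCommGroup Z] [NormedSpace ℝ Z]
    [FiniteDimensional ℝ Z] {O : Set Z} (hO : IsOpen O) {f : Z → F} (hf : ContDiffOn ℝ ∞ f O)
    {x : Z} (hx : x ∈ O) :
    ∃ g : Z → F, ContDiff ℝ ∞ g ∧ (∀ᶠ y in 𝓝 x, g y = f y) ∧ ∀ y, f y = 0 ∨ y ∉ O → g y = 0 := by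
  obtain ⟨r, hr, hrO⟩ := Metric.nhds_basis_closedBall.mem_iff.1 (hO.mem_nhds hx)
  let k : ContDiffBump x := ⟨r / 2, r, by positivity, by linarith⟩
  refine ⟨fun y => k y • f y, ?_, ?_, ?_⟩
  · refine contDiff_iff_contDiffAt.2 fun y => ?_
    by_cases hy : y ∈ O
    · exact k.contDiff.contDiffAt.smul (hf.contDiffAt (hO.mem_nhds hy))
    · have : (fun y => k y • f y) =ᶠ[𝓝 y] fun _ => 0 := by
        filter_upwards [(Metric.isClosed_closedBall.isOpen_compl).mem_nhds
          (fun h => hy (hrO h) : y ∈ (Metric.closedBall x r)ᶜ)] with z hz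
        rw [k.zero_of_le_dist, zero_smul]
        exact (not_le.1 fun h => hz (Metric.mem_closedBall.2 h)).le
      exact contDiffAt_const.congr_of_eventuallyEq this
  · filter_upwards [k.eventuallyEq_one] with y hy
    simp only [hy, Pi.one_apply, one_smul]
  · rintro y (hy | hy)
    · simp only [hy, smul_zero]
    · simp only
      rw [k.zero_of_le_dist, zero_smul]
      exact (not_le.1 fun h => hy (hrO h)).le

/-- This integral is the quotient in Hadamard's lemma. It is smooth because all derivatives of the
integrand are bounded on the product of a unit ball and `[0, 1]`. -/
theorem contDiff_integral_fderiv_smul [CompleteSpace F] {f : P × Q → F} (hf : ContDiff ℝ ∞ f) :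
    ContDiff ℝ ∞ fun y : P × Q => ∫ s in Icc (0 : ℝ) 1,
      (fderiv ℝ f (y.1, s • y.2)).comp (ContinuousLinearMap.inr ℝ P Q) := by
  have hh : ContDiff ℝ ∞ fun w : (P × Q) × ℝ =>
      (fderiv ℝ f (w.1.1, w.2 • w.1.2)).comp (ContinuousLinearMap.inr ℝ P Q) := by
    have h1 : ContDiff ℝ ∞ (fderiv ℝ f) := hf.fderiv_right (by simp)
    have h2 : ContDiff ℝ ∞ fun w : (P × Q) × ℝ => (w.1.1, w.2 • w.1.2) := by fun_prop
    exact (h1.comp h2).clm_comp contDiff_const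
  set h := fun w : (P × Q) × ℝ =>
      (fderiv ℝ f (w.1.1, w.2 • w.1.2)).comp (ContinuousLinearMap.inr ℝ P Q) with hdef
  refine contDiff_iff_contDiffAt.2 fun y => ?_
  have hbd : ∀ n : ℕ, ∃ C : ℝ, ∀ w ∈ Metric.closedBall y 1 ×ˢ Icc (0 : ℝ) 1,
      ‖iteratedFDerivWithin ℝ n h univ w‖ ≤ C := fun n => by
    have : ProperSpace (P × Q) := FiniteDimensional.proper ℝ _
    refine ((isCompact_closedBall y 1).prod isCompact_Icc).exists_bound_of_continuousOn
      (ContinuousOn.mono (hh.contDiffOn.continuousOn_iteratedFDerivWithin (m := n)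
        (mod_cast le_top) uniqueDiffOn_univ) (subset_univ _))
  choose C hC using hbd
  have := (contDiffOn_integral (ν := volume.restrict (Icc (0 : ℝ) 1)) (convex_ball y 1)
    Metric.isOpen_ball.uniqueDiffOn uniqueDiffOn_univ hh.contDiffOn
    (ContinuousLinearMap.inl ℝ (P × Q) ℝ) (B := fun s => (0, s)) (by fun_prop)
    (fun _ _ _ => mem_univ _) (b := fun n _ => C n) (fun n => integrable_const _)
    (fun n => by
      filter_upwards [ae_restrict_mem measurableSet_Icc] with s hs v hv
      refine hC n _ ⟨?_, ?_⟩
      · simpa using (Metric.mem_ball.1 hv).le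
      · simpa using hs)).1
  refine (this.contDiffAt (Metric.ball_mem_nhds y one_pos)).congr_of_eventuallyEq
    (Filter.Eventually.of_forall fun v => ?_)
  simp [hdef]

/-- The fundamental theorem of calculus for `s ↦ f (y.1, s • y.2)`. -/
theorem apply_eq_integral_fderiv_smul [CompleteSpace F] {f : P × Q → F} (hf : ContDiff ℝ ∞ f)
    {y : P × Q} (h0 : f (y.1, 0) = 0) :
    (∫ s in Icc (0 : ℝ) 1, (fderiv ℝ f (y.1, s • y.2)).comp (ContinuousLinearMap.inr ℝ P Q)) y.2 =
      f y := by
  have hc : Continuous fun s : ℝ =>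
      (fderiv ℝ f (y.1, s • y.2)).comp (ContinuousLinearMap.inr ℝ P Q) := by
    have h1 : ContDiff ℝ ∞ (fderiv ℝ f) := hf.fderiv_right (by simp)
    have h2 : Continuous fun s : ℝ => (y.1, s • y.2) := by fun_prop
    exact (h1.continuous.comp h2).clm_comp continuous_const
  rw [ContinuousLinearMap.integral_apply (hc.continuousOn.integrableOn_compact isCompact_Icc),
    integral_Icc_eq_integral_Ioc, ← intervalIntegral.integral_of_le zero_le_one,
    intervalIntegral.integral_eq_sub_of_hasDerivAt (f := fun s : ℝ => f (y.1, s • y.2))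
      (fun s _ => ?_) ((hc.clm_apply continuous_const).intervalIntegrable _ _)]
  · simp [h0]
  · have h1 : HasDerivAt (fun s : ℝ => (y.1, s • y.2)) ((0 : P), y.2) s :=
      (hasDerivAt_const s y.1).prodMk (by simpa using (hasDerivAt_id s).smul_const y.2)
    have h2 := ((hf.differentiable (by simp)) (y.1, s • y.2)).hasFDerivAt.comp_hasDerivAt s h1
    simpa [Function.comp_def] using h2

/-- Hadamard's lemma with parameters. -/
theorem exists_contDiff_eq_apply [CompleteSpace F] {O : Set (P × Q)} (hO : IsOpen O)
    {f : P × Q → F} (hf : ContDiffOn ℝ ∞ f O) {x : P} (hx : (x, 0) ∈ O)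
    (h0 : ∀ a, (a, 0) ∈ O → f (a, 0) = 0) :
    ∃ B : P × Q → Q →L[ℝ] F, ContDiff ℝ ∞ B ∧ (∀ᶠ y in 𝓝 (x, (0 : Q)), f y = B y y.2) ∧
      ∀ᶠ y in 𝓝 (x, (0 : Q)), y.2 = 0 → ∀ ξ, B y ξ = fderiv ℝ f y (0, ξ) := by
  obtain ⟨g, hg, hgf, hg0⟩ := exists_contDiff_eventuallyEq hO hf hx
  have hB := contDiff_integral_fderiv_smul hg
  -- The cut off function vanishes on the whole slice: inside `O` because `f` does, outside because
  -- the cutoff does.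
  have he : ∀ y : P × Q, (∫ s in Icc (0 : ℝ) 1,
      (fderiv ℝ g (y.1, s • y.2)).comp (ContinuousLinearMap.inr ℝ P Q)) y.2 = g y := fun y =>
    apply_eq_integral_fderiv_smul hg (hg0 _ (by
      by_cases h : (y.1, (0 : Q)) ∈ O
      exacts [Or.inl (h0 _ h), Or.inr h]))
  refine ⟨_, hB, ?_, ?_⟩
  · filter_upwards [hgf] with y hy
    rw [he, hy]
  · filter_upwards [hgf.eventually_nhds] with y hy hy2 ξ
    rw [← Filter.EventuallyEq.fderiv_eq (show g =ᶠ[𝓝 y] f from hy)]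
    simp [hy2]
    rw [← hy2]

end Hadamard

section BlowMap

variable {P Q P' Q' F : Type*} [NormedAddCommGroup P] [NormedSpace ℝ P] [NormedAddCommGroup Q]
  [NormedSpace ℝ Q] [NormedAddCommGroup P'] [NormedSpace ℝ P'] [NormedAddCommGroup Q']
  [NormedSpace ℝ Q'] [NormedAddCommGroup F] [NormedSpace ℝ F]

/-- `(x, ξ, t) ↦ (T (x, t ξ), B (x, t ξ) ξ, t)`. -/
def blowMap (T : P × Q → P') (B : P × Q → Q →L[ℝ] Q') (z : P × Q × ℝ) : P' × Q' × ℝ :=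
  (T (z.1, z.2.2 • z.2.1), B (z.1, z.2.2 • z.2.1) z.2.1, z.2.2)

theorem mapsTo_blowMap (T : P × Q → P') (B : P × Q → Q →L[ℝ] Q') :
    MapsTo (blowMap T B) (Slab P Q) (Slab P' Q') := fun _ hz => hz

/-- By linearity of `B` in `ξ` the factor `t` passes through, so `blowMap T B` covers the map `y ↦
(T y, B y y.2)` downstairs. -/
theorem blow_blowMap (T : P × Q → P') (B : P × Q → Q →L[ℝ] Q') (z : P × Q × ℝ) :
    blow (blowMap T B z) =
      ((T (blow z).1, B (blow z).1 (blow z).1.2), (blow z).2) := by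
  simp [blow, blowMap]

variable {U : Set ((P × Q) × ℝ)}

theorem tameOn_snd_fst : TameOn (fun _ => 1) U fun z : P × Q × ℝ => z.2.1 :=
  TameOn.clm ((ContinuousLinearMap.fst ℝ Q ℝ).comp (ContinuousLinearMap.snd ℝ P (Q × ℝ)))
    (C := 1) fun z _ _ => by simp

theorem tameOn_snd_snd : TameOn (fun _ => 1) U fun z : P × Q × ℝ => z.2.2 :=
  TameOn.clm ((ContinuousLinearMap.snd ℝ Q ℝ).comp (ContinuousLinearMap.snd ℝ P (Q × ℝ)))
    (C := 1) fun z hz _ => by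
      have h : |z.2.2| ≤ 1 := abs_le.2 ⟨by linarith [hz.1], hz.2⟩
      simpa using h.trans (by linarith [norm_nonneg z.2.1])

/-- Boundedness of `U` controls `x`. The term `t • ξ` is a product of linear functions whose
derivative in `t` is `ξ`; this unbounded derivative is the reason for the polynomial losses in
`TameOn`. -/
theorem tameOn_blow (hU : Bornology.IsBounded U) : TameOn (fun _ => 1) U blow := by
  have h1 : TameOn (fun _ => 1) U fun z : P × Q × ℝ => z.1 := by
    obtain ⟨C, hC⟩ := hU.exists_norm_le
    refine TameOn.clm (ContinuousLinearMap.fst ℝ P (Q × ℝ)) (C := |C|) fun z _ hz => ?_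
    have h2 : ‖z.1‖ ≤ ‖blow z‖ := by
      simp only [blow, Prod.norm_def]
      exact (le_max_left _ _).trans (le_max_left _ _)
    have h3 := (h2.trans (hC _ hz)).trans (le_abs_self C)
    simpa using h3.trans (le_mul_of_one_le_right (abs_nonneg C)
      (by linarith [norm_nonneg z.2.1]))
  have h2 := TameOn.bilinear (ContinuousLinearMap.lsmul ℝ ℝ) (tameOn_snd_snd (U := U))
    (tameOn_snd_fst (P := P) (Q := Q)) (fun _ => zero_le_one) fun _ => zero_le_one
  simp only [mul_one] at h2
  exact (h1.prodMk h2 fun _ => zero_le_one).prodMk tameOn_snd_snd fun _ => zero_le_one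

variable [FiniteDimensional ℝ P] [FiniteDimensional ℝ Q]

/-- Functions that are smooth downstairs have bounded derivatives upstairs. -/
theorem exists_tameOn_comp_blow {O : Set ((P × Q) × ℝ)} (hO : IsOpen O) {g : (P × Q) × ℝ → F}
    (hg : ContDiffOn ℝ ∞ g ((univ ×ˢ Icc (0 : ℝ) 1) ∩ O)) {y : (P × Q) × ℝ} (hy : y ∈ O) :
    ∃ r > 0, TameOn (fun _ => 1) (Metric.ball y r) fun z => g (blow z) := by
  obtain ⟨r, hr, hrO, hC⟩ := exists_ball_bound_iteratedFDerivWithin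
    (uniqueDiffOn_univ.prod (uniqueDiffOn_Icc zero_lt_one)) (isClosed_univ.prod isClosed_Icc) hO
    hg hy
  refine ⟨r, hr, TameOn.comp (S' := (univ ×ˢ Icc (0 : ℝ) 1))
    (A' := (univ ×ˢ Icc (0 : ℝ) 1) ∩ Metric.closedBall y r)
    (uniqueDiffOn_univ.prod (uniqueDiffOn_Icc zero_lt_one)) (w' := fun _ => 1)
    (fun _ => zero_le_one) (tameOn_blow Metric.isBounded_ball) (fun z hz => ⟨mem_univ _, hz⟩)
    (fun z hz hU => ⟨⟨mem_univ _, hz⟩, Metric.ball_subset_closedBall hU⟩) ?_ ?_⟩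
  · intro z hz
    exact (contDiffWithinAt_inter (hO.mem_nhds (hrO hz.2))).1 (hg z ⟨hz.1, hrO hz.2⟩)
  · intro n k
    obtain ⟨C, hC⟩ := hC n
    exact ⟨C, fun z hz => by simpa using hC z hz⟩

theorem exists_tameOn_comp_blow_fst {g : P × Q → F} (hg : ContDiff ℝ ∞ g)
    (y : (P × Q) × ℝ) :
    ∃ r > 0, TameOn (fun _ => 1) (Metric.ball y r) fun z => g (blow z).1 :=
  exists_tameOn_comp_blow isOpen_univ (g := fun w => g w.1)
    (hg.comp contDiff_fst).contDiffOn (mem_univ y)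

/-- `T` and `B` enter through functions downstairs, whose derivatives are locally under control, and
`B` is then applied bilinearly to `ξ`. -/
theorem exists_tameOn_blowMap {T : P × Q → P'} {B : P × Q → Q →L[ℝ] Q'} (hT : ContDiff ℝ ∞ T)
    (hB : ContDiff ℝ ∞ B) (y : (P × Q) × ℝ) :
    ∃ r > 0, TameOn (fun _ => 1) (Metric.ball y r) (blowMap T B) := by
  obtain ⟨r₁, hr₁, h₁⟩ := exists_tameOn_comp_blow_fst hT y
  obtain ⟨r₂, hr₂, h₂⟩ := exists_tameOn_comp_blow_fst hB y
  refine ⟨min r₁ r₂, lt_min hr₁ hr₂, ?_⟩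
  have h₁' := h₁.mono (Metric.ball_subset_ball (min_le_left r₁ r₂))
  have h₂' := h₂.mono (Metric.ball_subset_ball (min_le_right r₁ r₂))
  have h₃ := TameOn.bilinear (ContinuousLinearMap.id ℝ (Q →L[ℝ] Q')) h₂'
    (tameOn_snd_fst (P := P) (Q := Q)) (fun _ => zero_le_one) fun _ => zero_le_one
  simp only [mul_one] at h₃
  exact h₁'.prodMk (h₃.prodMk tameOn_snd_snd fun _ => zero_le_one) fun _ => zero_le_one

/-- An injective linear map on a finite-dimensional space is bounded below, and a small perturbation
stays bounded below. -/
theorem eventually_norm_le_mul_norm_apply {Y : Type*} [TopologicalSpace Y]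
    {B : Y → Q →L[ℝ] Q'} {y : Y} (hB : ContinuousAt B y) (hinj : Function.Injective (B y)) :
    ∃ c : ℝ, 0 < c ∧ ∀ᶠ y' in 𝓝 y, ∀ ξ, ‖ξ‖ ≤ c * ‖B y' ξ‖ := by
  obtain ⟨K, hK, hA⟩ := (B y).toLinearMap.exists_antilipschitzWith (LinearMap.ker_eq_bot.2 hinj)
  have hK' : (0 : ℝ) < K := hK
  -- A perturbation of norm below `1 / (2K)` costs at most half of the lower bound `1 / K`.
  refine ⟨2 * K, by positivity, ?_⟩
  have h1 := Metric.tendsto_nhds.1 hB (1 / (2 * K)) (by positivity)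
  filter_upwards [h1] with y' hy' ξ
  have h2 : ‖ξ‖ ≤ K * ‖B y ξ‖ := by simpa using hA.le_mul_dist ξ 0
  have h3 : ‖B y ξ‖ ≤ ‖B y' ξ‖ + 1 / (2 * K) * ‖ξ‖ := by
    have h4 : ‖(B y' - B y) ξ‖ ≤ 1 / (2 * K) * ‖ξ‖ :=
      (B y' - B y).le_of_opNorm_le (by rw [← dist_eq_norm]; exact hy'.le) ξ
    have h5 : B y ξ = B y' ξ - (B y' - B y) ξ := by simp
    rw [h5]
    exact (norm_sub_le _ _).trans (by linarith)
  have h6 : K * (1 / (2 * K) * ‖ξ‖) = ‖ξ‖ / 2 := by field_simp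
  nlinarith

end BlowMap

/-! ### Slice charts and the deformation to the normal cone -/

section LocalRep

variable {P E E' Q Q' : Type*} [NormedAddCommGroup P] [NormedSpace ℝ P]
  [NormedAddCommGroup E] [NormedSpace ℝ E] [NormedAddCommGroup E'] [NormedSpace ℝ E']
  [NormedAddCommGroup Q] [NormedSpace ℝ Q] [NormedAddCommGroup Q'] [NormedSpace ℝ Q']
  {X M M' : Type*} [TopologicalSpace X] [ChartedSpace P X] [TopologicalSpace M] [ChartedSpace E M]
  [TopologicalSpace M'] [ChartedSpace E' M']

theorem localRep_of_pos {ι : X → M} (g : DNC P E ι → ℂ) (φ : OpenPartialHomeomorph M (P × Q))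
    {x : P} {ξ : Q} {t : ℝ} (ht : t ∈ Ioc (0 : ℝ) 1) :
    localRep g φ (x, ξ, t) = g (.pos (φ.symm (x, t • ξ)) ⟨t, ht⟩) := by
  simp only [localRep]
  rw [dif_pos ht]

theorem localRep_of_zero {ι : X → M} (hι : Function.Injective ι) (g : DNC P E ι → ℂ)
    (φ : OpenPartialHomeomorph M (P × Q)) {x : P} (ξ : Q) {v : X} (hv : ι v = φ.symm (x, 0)) :
    localRep g φ (x, ξ, 0) = g (.zero v (Submodule.Quotient.mk
      (mfderiv 𝓘(ℝ, P × Q) 𝓘(ℝ, E) φ.symm (x, 0) ((0, ξ) : P × Q) : E))) := by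
  simp only [localRep]
  rw [dif_neg (by simp), dif_pos ⟨v, hv⟩]
  have h : (⟨v, hv⟩ : ∃ v : X, ι v = φ.symm (x, 0)).choose = v :=
    hι ((⟨v, hv⟩ : ∃ v : X, ι v = φ.symm (x, 0)).choose_spec.trans hv.symm)
  rw [h]

theorem posPart_of_pos {ι : X → M} (g : DNC P E ι → ℂ) (m : M) {t : ℝ} (ht : t ∈ Ioc (0 : ℝ) 1) :
    posPart g (m, t) = g (.pos m ⟨t, ht⟩) :=
  dif_pos ht

theorem localRep_eq_posPart {ι : X → M} (g : DNC P E ι → ℂ) (φ : OpenPartialHomeomorph M (P × Q))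
    {z : P × Q × ℝ} (ht : z.2.2 ∈ Ioc (0 : ℝ) 1) :
    localRep g φ z = posPart g (φ.symm (blow z).1, (blow z).2) :=
  (localRep_of_pos g φ ht).trans (posPart_of_pos g _ ht).symm

theorem omega_eq (U : Set (P × Q)) : Omega U = Slab P Q ∩ {z | (blow z).1 ∈ U} := by
  ext z; rfl

theorem isOpen_blow_fst_mem {U : Set (P × Q)} (hU : IsOpen U) :
    IsOpen {z : P × Q × ℝ | (blow z).1 ∈ U} :=
  hU.preimage (continuous_fst.comp continuous_blow)

theorem IsSliceChart.exists_eq {ι : X → M} {φ : OpenPartialHomeomorph M (P × Q)}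
    (hφ : IsSliceChart E ι φ) {x : P} (hx : (x, (0 : Q)) ∈ φ.target) :
    ∃ v, ι v = φ.symm (x, 0) := by
  refine (hφ.mem_range_iff _ (φ.map_target hx)).2 ?_
  rw [φ.right_inv hx]

theorem IsSliceChart.apply_eq {ι : X → M} {φ : OpenPartialHomeomorph M (P × Q)}
    (hφ : IsSliceChart E ι φ) {v : X} (hv : ι v ∈ φ.source) : φ (ι v) = ((φ (ι v)).1, 0) :=
  Prod.ext rfl ((hφ.mem_range_iff _ hv).1 ⟨v, rfl⟩)

/-- Vectors tangent to the slice are tangent to the submanifold. -/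
theorem IsSliceChart.mfderiv_symm_mem_range {ι : X → M} {σ : M → X}
    (hι : ContMDiff 𝓘(ℝ, P) 𝓘(ℝ, E) ∞ ι) (hσ : ContMDiff 𝓘(ℝ, E) 𝓘(ℝ, P) ∞ σ)
    (hσι : ∀ x, σ (ι x) = x) {φ : OpenPartialHomeomorph M (P × Q)} (hφ : IsSliceChart E ι φ)
    {x : P} (hx : (x, (0 : Q)) ∈ φ.target) {v : X} (hv : ι v = φ.symm (x, 0)) (a : P) :
    (mfderiv 𝓘(ℝ, P × Q) 𝓘(ℝ, E) φ.symm (x, 0) ((a, 0) : P × Q) : E) ∈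
      LinearMap.range (mfderiv 𝓘(ℝ, P) 𝓘(ℝ, E) ι v).toLinearMap := by
  have hd : MDifferentiableAt 𝓘(ℝ, P × Q) 𝓘(ℝ, E) φ.symm (x, 0) :=
    (hφ.contMDiffOn_symm.contMDiffAt (φ.open_target.mem_nhds hx)).mdifferentiableAt (by simp)
  have hinl : MDifferentiableAt 𝓘(ℝ, P) 𝓘(ℝ, P × Q) (fun a : P => (a, (0 : Q))) x :=
    (ContinuousLinearMap.inl ℝ P Q).mdifferentiableAt
  have hs : MDifferentiableAt 𝓘(ℝ, P) 𝓘(ℝ, P) (fun a : P => σ (φ.symm (a, 0))) x :=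
    ((hσ _).mdifferentiableAt (by simp)).comp x
      (MDifferentiableAt.comp (f := fun a : P => (a, (0 : Q))) x hd hinl)
  have hsx : σ (φ.symm (x, 0)) = v := by rw [← hv, hσι]
  have h1 := mfderiv_comp (f := fun a : P => (a, (0 : Q))) x hd hinl
  have h2 := mfderiv_comp (f := fun a : P => σ (φ.symm (a, 0))) x
    ((hι _).mdifferentiableAt (by simp)) hs
  -- The slice factors through `ι` by the retraction `σ`; the chain rule then exhibits a preimage of
  -- the slice vector under `dι`.
  have he : (fun a : P => φ.symm (a, (0 : Q))) =ᶠ[𝓝 x] ι ∘ fun a : P => σ (φ.symm (a, 0)) := by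
    have : ∀ᶠ a in 𝓝 x, (a, (0 : Q)) ∈ φ.target :=
      (φ.open_target.preimage (Continuous.prodMk_left (0 : Q))).mem_nhds hx
    filter_upwards [this] with b hb
    obtain ⟨w, hw⟩ := hφ.exists_eq hb
    rw [Function.comp_apply, ← hw, hσι]
  have h3 := he.mfderiv_eq (I := 𝓘(ℝ, P)) (I' := 𝓘(ℝ, E))
  have h4 : mfderiv 𝓘(ℝ, P) 𝓘(ℝ, P × Q) (fun a : P => (a, (0 : Q))) x =
      ContinuousLinearMap.inl ℝ P Q :=
    (ContinuousLinearMap.inl ℝ P Q).mfderiv_eq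
  subst hsx
  refine ⟨mfderiv 𝓘(ℝ, P) 𝓘(ℝ, P) (fun a : P => σ (φ.symm (a, 0))) x a, ?_⟩
  have h5 := congrArg (fun L : P →L[ℝ] E => L a) (h2.symm.trans (h3.symm.trans h1))
  refine h5.trans ?_
  rw [h4]
  rfl

/-- In slice charts, the map of deformations induced by a smooth map is, near a point of the
submanifold, of the form `(x, ξ, t) ↦ (T (x, t ξ), B (x, t ξ) ξ, t)`. -/
theorem exists_localRep_eq_blowMap [FiniteDimensional ℝ P] [FiniteDimensional ℝ Q]
    [FiniteDimensional ℝ Q'] [IsManifold 𝓘(ℝ, E) ∞ M] [IsManifold 𝓘(ℝ, E') ∞ M']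
    {ι : X → M} {ι' : X → M'} {Fm : M → M'} {σ : M' → X}
    (hFm : ContMDiff 𝓘(ℝ, E) 𝓘(ℝ, E') ∞ Fm) (hι' : ContMDiff 𝓘(ℝ, P) 𝓘(ℝ, E') ∞ ι')
    (hσ : ContMDiff 𝓘(ℝ, E') 𝓘(ℝ, P) ∞ σ) (hFι : ∀ x, Fm (ι x) = ι' x)
    (hσι : ∀ x, σ (ι' x) = x) {g : DNC P E ι → ℂ} {f : DNC P E' ι' → ℂ}
    (hpos : ∀ m t, g (.pos m t) = f (.pos (Fm m) t))
    (hzero : ∀ x (v : E), g (.zero x (Submodule.Quotient.mk v)) =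
      f (.zero x (Submodule.Quotient.mk (mfderiv 𝓘(ℝ, E) 𝓘(ℝ, E') Fm (ι x) v : E'))))
    {φ : OpenPartialHomeomorph M (P × Q)} (hφ : IsSliceChart E ι φ)
    {φ' : OpenPartialHomeomorph M' (P × Q')} (hφ' : IsSliceChart E' ι' φ') {x₀ : X}
    (hx : ι x₀ ∈ φ.source) (hx' : ι' x₀ ∈ φ'.source) :
    ∃ (T : P × Q → P) (B : P × Q → Q →L[ℝ] Q'), ContDiff ℝ ∞ T ∧ ContDiff ℝ ∞ B ∧
      (∀ᶠ y in 𝓝 (φ (ι x₀)), φ' (Fm (φ.symm y)) = (T y, B y y.2)) ∧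
      (∀ᶠ y in 𝓝 (φ (ι x₀)), y.2 = 0 → ∀ ξ,
        B y ξ = (fderiv ℝ (fun y => φ' (Fm (φ.symm y))) y (0, ξ)).2) ∧
      ∀ᶠ y in 𝓝 (φ (ι x₀)), ∀ z ∈ Slab P Q, (blow z).1 = y →
        localRep g φ z = localRep f φ' (blowMap T B z) := by
  have hιinj : Function.Injective ι := fun x y h => by
    rw [← hσι x, ← hFι, h, hFι, hσι]
  have hι'inj : Function.Injective ι' := fun x y h => by rw [← hσι x, h, hσι]
  set O : Set (P × Q) := φ.target ∩ φ.symm ⁻¹' (Fm ⁻¹' φ'.source) with hOdef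
  have hO : IsOpen O := φ.isOpen_inter_preimage_symm (φ'.open_source.preimage hFm.continuous)
  have hy₀ := hφ.apply_eq hx
  have hxO : φ (ι x₀) ∈ O := ⟨φ.map_source hx, by
    simpa only [mem_preimage, φ.left_inv hx, hFι] using hx'⟩
  have hmid : ContMDiffOn 𝓘(ℝ, P × Q) 𝓘(ℝ, E') ∞ (fun y => Fm (φ.symm y)) φ.target :=
    hFm.comp_contMDiffOn hφ.contMDiffOn_symm
  have hT : ContDiffOn ℝ ∞ (fun y => φ' (Fm (φ.symm y))) O := by
    rw [← contMDiffOn_iff_contDiffOn]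
    exact hφ'.contMDiffOn.comp (hmid.mono inter_subset_left) fun y hy => hy.2
  have hT0 : ∀ a : P, (a, (0 : Q)) ∈ O → (φ' (Fm (φ.symm (a, 0)))).2 = 0 := by
    intro a ha
    obtain ⟨v, hv⟩ := hφ.exists_eq ha.1
    exact (hφ'.mem_range_iff _ ha.2).1 ⟨v, by rw [← hv, hFι]⟩
  obtain ⟨T, hTs, hTe, -⟩ := exists_contDiff_eventuallyEq hO hT.fst hxO
  rw [hy₀] at hxO
  -- The normal component vanishes on the slice, so Hadamard's lemma factors it as `B y y.2`; the
  -- tangential component `T` only needs a global extension.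
  obtain ⟨B, hB, hBe, hBd⟩ := exists_contDiff_eq_apply hO hT.snd hxO hT0
  rw [← hy₀] at hxO hBe hBd
  have hev : ∀ᶠ y in 𝓝 (φ (ι x₀)), φ' (Fm (φ.symm y)) = (T y, B y y.2) := by
    filter_upwards [hTe, hBe] with y h1 h2
    exact Prod.ext h1.symm h2
  have hdT : ∀ y ∈ O, DifferentiableAt ℝ (fun y => φ' (Fm (φ.symm y))) y := fun y hy =>
    (hT.contDiffAt (hO.mem_nhds hy)).differentiableAt (by simp)
  have hevd : ∀ᶠ y in 𝓝 (φ (ι x₀)), y.2 = 0 → ∀ ξ,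
        B y ξ = (fderiv ℝ (fun y => φ' (Fm (φ.symm y))) y (0, ξ)).2 := by
    filter_upwards [hBd, hO.mem_nhds hxO] with y h1 h2 hy ξ
    rw [h1 hy]
    have := ((hdT y h2).hasFDerivAt.snd).fderiv
    rw [this]
    rfl
  refine ⟨T, B, hTs, hB, hev, hevd, ?_⟩
  filter_upwards [hev, hevd, hO.mem_nhds hxO] with y h1 h2 hyO z hz hzy
  obtain ⟨x, ξ, t⟩ := z
  subst hzy
  rcases eq_or_lt_of_le hz.1 with ht | ht
  · simp only at ht
    subst ht
    simp only [blow, zero_smul] at h1 h2 hyO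
    obtain ⟨v, hv⟩ := hφ.exists_eq hyO.1
    have hsrc : φ'.symm (T (x, 0), 0) = Fm (φ.symm (x, 0)) := by
      have : (T (x, 0), (0 : Q')) = φ' (Fm (φ.symm (x, 0))) := by rw [h1, map_zero]
      rw [this, φ'.left_inv hyO.2]
    have htar : (T (x, 0), (0 : Q')) ∈ φ'.target := by
      have : (T (x, 0), (0 : Q')) = φ' (Fm (φ.symm (x, 0))) := by rw [h1, map_zero]
      rw [this]
      exact φ'.map_source hyO.2
    have hv' : ι' v = φ'.symm (T (x, 0), 0) := by rw [hsrc, ← hFι, hv]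
    simp only [blowMap, zero_smul]
    refine (localRep_of_zero hιinj g φ ξ hv).trans ((hzero v _).trans (Eq.trans ?_
      (localRep_of_zero hι'inj f φ' _ hv').symm))
    refine congrArg (fun w => f (.zero v w)) ((Submodule.Quotient.eq _).2 ?_)
    rw [hv]
    -- At `t = 0` two normal classes are compared. The representatives differ by the image of the
    -- tangential part of the derivative, and this is tangent to the submanifold.
    have e1 := hφ'.mfderiv_symm_mem_range hι' hσ hσι htar hv'
      (fderiv ℝ (fun y => φ' (Fm (φ.symm y))) (x, 0) (0, ξ)).1
    have hds : MDifferentiableAt 𝓘(ℝ, P × Q) 𝓘(ℝ, E) φ.symm (x, 0) :=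
      (hφ.contMDiffOn_symm.contMDiffAt (φ.open_target.mem_nhds hyO.1)).mdifferentiableAt (by simp)
    have hds' : MDifferentiableAt 𝓘(ℝ, P × Q') 𝓘(ℝ, E') φ'.symm (φ' (Fm (φ.symm (x, 0)))) :=
      (hφ'.contMDiffOn_symm.contMDiffAt
        (φ'.open_target.mem_nhds (φ'.map_source hyO.2))).mdifferentiableAt (by simp)
    have c1 := mfderiv_comp (x, (0 : Q)) ((hFm _).mdifferentiableAt (by simp)) hds
    have c2 := mfderiv_comp (f := fun y => φ' (Fm (φ.symm y))) (x, (0 : Q)) hds'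
      (hdT _ hyO).mdifferentiableAt
    have he : (Fm ∘ φ.symm) =ᶠ[𝓝 (x, (0 : Q))] φ'.symm ∘ fun y => φ' (Fm (φ.symm y)) := by
      filter_upwards [hO.mem_nhds hyO] with y hy
      exact (φ'.left_inv hy.2).symm
    have c3 := congrArg (fun L : P × Q →L[ℝ] E' => L (0, ξ))
      (c1.symm.trans (he.mfderiv_eq.trans c2))
    have c4 : (mfderiv 𝓘(ℝ, E) 𝓘(ℝ, E') Fm (φ.symm (x, 0))
        (mfderiv 𝓘(ℝ, P × Q) 𝓘(ℝ, E) φ.symm (x, 0) ((0, ξ) : P × Q) : E) : E') =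
        (mfderiv 𝓘(ℝ, P × Q') 𝓘(ℝ, E') φ'.symm (T (x, 0), 0)
          (fderiv ℝ (fun y => φ' (Fm (φ.symm y))) (x, 0) (0, ξ) : P × Q') : E') := by
      have : (T (x, 0), (0 : Q')) = φ' (Fm (φ.symm (x, 0))) := by rw [h1, map_zero]
      rw [this]
      refine c3.trans ?_
      rw [mfderiv_eq_fderiv]
      rfl
    have c5 : (0, B (x, 0) ξ) = fderiv ℝ (fun y => φ' (Fm (φ.symm y))) (x, 0) (0, ξ) -
        ((fderiv ℝ (fun y => φ' (Fm (φ.symm y))) (x, 0) (0, ξ)).1, (0 : Q')) := by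
      rw [h2 trivial]
      exact Prod.ext (by simp) (by simp)
    rw [c5]
    erw [c4, map_sub, sub_sub_cancel]
    exact e1
  -- For `t > 0` both sides are values at the same point, by linearity `B (t • ξ) = t • B ξ`.
  · have ht' : t ∈ Ioc (0 : ℝ) 1 := ⟨ht, hz.2⟩
    simp only [blowMap]
    rw [localRep_of_pos g φ ht', localRep_of_pos f φ' ht', hpos]
    congr 2
    simp only [blow] at h1 hyO
    rw [← map_smul, ← h1, φ'.left_inv hyO.2]

end LocalRep

/-! ### A local criterion for membership in `Src` -/

section Criterion

variable {P E Q Q' F : Type*} [NormedAddCommGroup P] [NormedSpace ℝ P]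
  [NormedAddCommGroup E] [NormedSpace ℝ E]
  [NormedAddCommGroup Q] [NormedSpace ℝ Q] [NormedAddCommGroup Q'] [NormedSpace ℝ Q']
  [NormedAddCommGroup F] [NormedSpace ℝ F]
  [FiniteDimensional ℝ P] [FiniteDimensional ℝ Q] [FiniteDimensional ℝ Q']

/-- Divide by `s` and let `s` tend to `0`. An identity for `B y y.2` near the slice determines `B`
on the slice. -/
theorem apply_eq_of_eventually {B : P × Q → Q →L[ℝ] F} {x : P} (hB : ContinuousAt B (x, 0))
    {ζ : Q} {η : F} (h : ∀ᶠ s in 𝓝 (0 : ℝ), B (x, s • ζ) (s • ζ) = s • η) : B (x, 0) ζ = η := by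
  have h1 : Filter.Tendsto (fun s : ℝ => (x, s • ζ)) (𝓝 0) (𝓝 (x, (0 : Q))) := by
    have : Continuous fun s : ℝ => (x, s • ζ) := by fun_prop
    simpa using this.tendsto 0
  have h2 : Filter.Tendsto (fun s : ℝ => B (x, s • ζ) ζ) (𝓝[≠] 0) (𝓝 (B (x, 0) ζ)) :=
    (((ContinuousLinearMap.apply ℝ F ζ).continuous.tendsto _).comp
      (hB.tendsto.comp h1)).mono_left nhdsWithin_le_nhds
  refine tendsto_nhds_unique h2 (tendsto_const_nhds.congr' ?_)
  filter_upwards [nhdsWithin_le_nhds h, self_mem_nhdsWithin] with s hs hs0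
  rw [map_smul] at hs
  exact (smul_right_injective F hs0 hs).symm

/-- After composition the function decays only in the variable `B ξ`, which is recorded by the
weight. No injectivity is assumed, since the projections of a pair are not injective one by one. -/
theorem TameOn.comp_blowMap {f : P × Q' × ℝ → F} {T : P × Q → P} {B : P × Q → Q →L[ℝ] Q'}
    (hT : ContDiff ℝ ∞ T) (hB : ContDiff ℝ ∞ B) {y : P × Q} {r : ℝ} (hr : 0 < r)
    (hf : TameOn (fun z => 1 + ‖z.2.1‖) (Metric.ball ((T y, B y y.2), (0 : ℝ)) r) f) :
    ∃ r' > 0, TameOn (fun z => 1 + ‖B (blow z).1 z.2.1‖) (Metric.ball (y, (0 : ℝ)) r')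
      fun z => f (blowMap T B z) := by
  obtain ⟨r₁, hr₁, h₁⟩ := exists_tameOn_blowMap hT hB (y, (0 : ℝ))
  have hc : Continuous fun w : (P × Q) × ℝ => ((T w.1, B w.1 w.1.2), w.2) := by
    have := hT.continuous
    have := hB.continuous
    fun_prop
  obtain ⟨r₂, hr₂, h₂⟩ := Metric.mem_nhds_iff.1
    (hc.continuousAt (x := (y, (0 : ℝ))) |>.preimage_mem_nhds (Metric.ball_mem_nhds _ hr))
  refine ⟨min r₁ r₂, lt_min hr₁ hr₂, ?_⟩
  refine TameOn.comp (S' := Slab P Q')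
    (A' := {z | z ∈ Slab P Q' ∧ blow z ∈ Metric.ball ((T y, B y y.2), (0 : ℝ)) r})
    uniqueDiffOn_slab (w' := fun z => 1 + ‖z.2.1‖) (fun z => by positivity)
    (h₁.mono (Metric.ball_subset_ball (min_le_left _ _))) (mapsTo_blowMap T B) ?_ ?_ ?_
  · intro z hz hU
    refine ⟨mapsTo_blowMap T B hz, ?_⟩
    rw [blow_blowMap]
    exact h₂ (Metric.ball_subset_ball (min_le_right r₁ r₂) hU)
  · exact fun z hz => hf.contDiffWithinAt z hz.1 hz.2
  · intro n k
    obtain ⟨C, hC⟩ := hf.rapid k n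
    exact ⟨C, fun z hz => hC z hz.1 hz.2⟩

/-- If the normal derivatives of a map are injective then rapid decay is pulled back to rapid
decay. -/
theorem TameOn.of_injective {h : P × Q × ℝ → F} {B : P × Q → Q →L[ℝ] Q'}
    (hB : ContDiff ℝ ∞ B) {y : P × Q} (hinj : Function.Injective (B y))
    {w : P × Q × ℝ → ℝ} (hw : ∀ z, 0 ≤ w z)
    {r : ℝ} (hr : 0 < r) (hh : TameOn w (Metric.ball (y, (0 : ℝ)) r) h)
    (hwB : ∀ z ∈ Slab P Q, 1 + ‖B (blow z).1 z.2.1‖ ≤ w z) :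
    ∃ r' > 0, TameOn (fun z => 1 + ‖z.2.1‖) (Metric.ball (y, (0 : ℝ)) r') h := by
  obtain ⟨c, hc, hcB⟩ := eventually_norm_le_mul_norm_apply hB.continuous.continuousAt hinj
  obtain ⟨r₁, hr₁, h₁⟩ := Metric.mem_nhds_iff.1 hcB
  refine ⟨min r r₁, lt_min hr hr₁, ?_⟩
  -- `1 + ‖ξ‖ ≤ 1 + c ‖B ξ‖ ≤ (1 + c) (1 + ‖B ξ‖)`.
  refine (hh.mono (Metric.ball_subset_ball (min_le_left r r₁))).of_weight_le hw
    (fun z => by positivity) (1 + c) fun z hz hU => ?_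
  have h2 : (blow z).1 ∈ Metric.ball y r₁ := by
    rw [Metric.mem_ball] at hU ⊢
    have : dist (blow z).1 y ≤ dist (blow z) (y, (0 : ℝ)) := by
      rw [Prod.dist_eq]; exact le_max_left _ _
    exact this.trans_lt (hU.trans_le (min_le_right _ _))
  have h3 := h₁ h2 z.2.1
  have h4 : 0 ≤ ‖B (blow z).1 z.2.1‖ := norm_nonneg _
  have h5 := mul_le_mul_of_nonneg_left (hwB z hz) (by positivity : 0 ≤ 1 + c)
  nlinarith

variable {X M : Type*} [TopologicalSpace X] [ChartedSpace P X] [TopologicalSpace M]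
  [ChartedSpace E M]

/-- Near a point with `t > 0` the vector `ξ = t⁻¹ (t ξ)` stays bounded, so decay is no condition and
smoothness downstairs suffices. -/
theorem tameOn_localRep_of_pos {ι : X → M} {g : DNC P E ι → ℂ}
    (hg : ContMDiffOn (𝓘(ℝ, E).prod 𝓘(ℝ, ℝ)) 𝓘(ℝ, ℂ) ∞ (posPart g) (univ ×ˢ Ioc (0 : ℝ) 1))
    {φ : OpenPartialHomeomorph M (P × Q)} (hφ : IsSliceChart E ι φ) {y : P × Q}
    (hy : y ∈ φ.target) {t : ℝ} (ht : 0 < t) :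
    ∃ r > 0, TameOn (fun z => 1 + ‖z.2.1‖) (Metric.ball (y, t) r) (localRep g φ) := by
  have hO : IsOpen (φ.target ×ˢ Ioi (0 : ℝ)) := φ.open_target.prod isOpen_Ioi
  have hs : ContDiffOn ℝ ∞ (fun w : (P × Q) × ℝ => posPart g (φ.symm w.1, w.2))
      ((univ ×ˢ Icc (0 : ℝ) 1) ∩ (φ.target ×ˢ Ioi (0 : ℝ))) := by
    rw [← contMDiffOn_iff_contDiffOn]
    have h1 : ContMDiffOn 𝓘(ℝ, (P × Q) × ℝ) (𝓘(ℝ, E).prod 𝓘(ℝ, ℝ)) ∞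
        (fun w : (P × Q) × ℝ => (φ.symm w.1, w.2))
        ((univ ×ˢ Icc (0 : ℝ) 1) ∩ (φ.target ×ˢ Ioi (0 : ℝ))) :=
      (hφ.contMDiffOn_symm.comp contDiff_fst.contMDiff.contMDiffOn fun w hw => hw.2.1).prodMk
        contDiff_snd.contMDiff.contMDiffOn
    exact hg.comp h1 fun w hw => ⟨mem_univ _, hw.2.2, hw.1.2.2⟩
  obtain ⟨r₁, hr₁, h₁⟩ := exists_tameOn_comp_blow hO hs (y := (y, t)) ⟨hy, ht⟩
  have hO' : IsOpen (φ.target ×ˢ Ioi (t / 2)) := φ.open_target.prod isOpen_Ioi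
  obtain ⟨r₂, hr₂, h₂⟩ := Metric.mem_nhds_iff.1 (hO'.mem_nhds
    (⟨hy, half_lt_self ht⟩ : (y, t) ∈ φ.target ×ˢ Ioi (t / 2)))
  refine ⟨min r₁ r₂, lt_min hr₁ hr₂, ?_⟩
  have h₃ : TameOn (fun _ => 1) (Metric.ball (y, t) (min r₁ r₂)) (localRep g φ) := by
    refine (h₁.mono (Metric.ball_subset_ball (min_le_left r₁ r₂))).congr Metric.isOpen_ball
      fun z hz hU => localRep_eq_posPart g φ ⟨?_, hz.2⟩
    have := (h₂ (Metric.ball_subset_ball (min_le_right r₁ r₂) hU)).2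
    exact (half_pos ht).trans this
  refine h₃.of_weight_le (fun _ => zero_le_one) (fun z => by positivity)
    (1 + (‖y‖ + r₁) / (t / 2)) fun z hz hU => ?_
  have h4 : t / 2 < z.2.2 := (h₂ (Metric.ball_subset_ball (min_le_right r₁ r₂) hU)).2
  have h5 : ‖(blow z).1‖ ≤ ‖y‖ + r₁ := by
    have h6 := Metric.mem_ball.1 (Metric.ball_subset_ball (min_le_left r₁ r₂) hU)
    have h7 : dist (blow z).1 y ≤ dist (blow z) (y, t) := by
      rw [Prod.dist_eq]; exact le_max_left _ _
    have h8 := norm_le_norm_add_norm_sub' (blow z).1 y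
    rw [← dist_eq_norm] at h8
    linarith
  have h6 : z.2.2 * ‖z.2.1‖ ≤ ‖y‖ + r₁ := by
    refine le_trans ?_ h5
    have : ‖z.2.2 • z.2.1‖ ≤ ‖(blow z).1‖ := by
      rw [Prod.norm_def (blow z).1]; exact le_max_right _ _
    rwa [norm_smul, Real.norm_of_nonneg (by linarith)] at this
  have h7 : ‖z.2.1‖ ≤ (‖y‖ + r₁) / (t / 2) := by
    rw [le_div_iff₀ (by positivity)]
    have := norm_nonneg z.2.1
    nlinarith
  simpa using h7

theorem TameOn.zero {w : P × Q × ℝ → ℝ} (U : Set ((P × Q) × ℝ)) :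
    TameOn w U fun _ => (0 : F) where
  contDiffWithinAt _ _ _ := contDiffWithinAt_const
  bound n := ⟨0, fun k => ⟨0, fun z _ _ => by simp⟩⟩

variable [IsManifold 𝓘(ℝ, E) ∞ M]

/-- The transition between two slice charts is a blown-up map, obtained from the identity of `M`.
Its normal part is injective at the point because the opposite transition provides a left inverse
there. -/
theorem tameOn_localRep_of_tameOn_localRep {ι : X → M} {σ : M → X}
    (hι : ContMDiff 𝓘(ℝ, P) 𝓘(ℝ, E) ∞ ι) (hσ : ContMDiff 𝓘(ℝ, E) 𝓘(ℝ, P) ∞ σ)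
    (hσι : ∀ x, σ (ι x) = x) {g : DNC P E ι → ℂ} {φ φ' : OpenPartialHomeomorph M (P × Q)}
    (hφ : IsSliceChart E ι φ) (hφ' : IsSliceChart E ι φ') {x : X} (hx : ι x ∈ φ.source)
    (hx' : ι x ∈ φ'.source) {r : ℝ} (hr : 0 < r)
    (hg : TameOn (fun z => 1 + ‖z.2.1‖) (Metric.ball (φ' (ι x), (0 : ℝ)) r) (localRep g φ')) :
    ∃ r' > 0, TameOn (fun z => 1 + ‖z.2.1‖) (Metric.ball (φ (ι x), (0 : ℝ)) r')
      (localRep g φ) := by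
  have hid : ∀ y (v : E), g (.zero y (Submodule.Quotient.mk v)) =
      g (.zero y (Submodule.Quotient.mk (mfderiv 𝓘(ℝ, E) 𝓘(ℝ, E) id (ι y) v : E))) := by
    intro y v
    rw [mfderiv_id]
    rfl
  obtain ⟨T, B, hT, hB, hTB, -, hloc⟩ := exists_localRep_eq_blowMap contMDiff_id hι hσ
    (fun _ => rfl) hσι (g := g) (f := g) (fun _ _ => rfl) hid hφ hφ' hx hx'
  obtain ⟨T', B', hT', hB', hTB', -, -⟩ := exists_localRep_eq_blowMap contMDiff_id hι hσ
    (fun _ => rfl) hσι (g := g) (f := g) (fun _ _ => rfl) hid hφ' hφ hx' hx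
  have hy := hφ.apply_eq hx
  have hinj : Function.Injective (B (φ (ι x))) := by
    have hC : ContinuousAt (fun y => (B' (T y, B y y.2)).comp (B y)) (φ (ι x)) := by
      have h1 := hT.continuous
      have h2 := hB.continuous
      exact (((hB'.continuous.comp (by fun_prop)).clm_comp h2)).continuousAt
    have hy' : (T (φ (ι x)), B (φ (ι x)) (φ (ι x)).2) = φ' (ι x) := by
      have := hTB.self_of_nhds
      rw [φ.left_inv hx] at this
      exact this.symm
    have hcont : ContinuousAt (fun y => (T y, B y y.2)) (φ (ι x)) := by
      have h1 := hT.continuous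
      have h2 := hB.continuous
      fun_prop
    have hsrc : ∀ᶠ y in 𝓝 (φ (ι x)), φ.symm y ∈ φ'.source :=
      (φ.continuousAt_symm (φ.map_source hx)).preimage_mem_nhds
        (φ'.open_source.mem_nhds (by rw [φ.left_inv hx]; exact hx'))
    -- Second component of the round trip through `φ'`. Taking derivatives at the slice turns it
    -- into `B' ∘ B = id`.
    have hev : ∀ᶠ y in 𝓝 (φ (ι x)), B' (T y, B y y.2) (B y y.2) = y.2 := by
      have hcont' : Filter.Tendsto (fun y => (T y, B y y.2)) (𝓝 (φ (ι x))) (𝓝 (φ' (ι x))) := by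
        rw [← hy']; exact hcont
      have h1 := hcont'.eventually hTB'
      filter_upwards [h1, hTB, hsrc, φ.open_target.mem_nhds (φ.map_source hx)] with y a1 a2 a3 a4
      rw [id] at a2
      rw [← a2, id, φ'.left_inv a3, φ.right_inv a4] at a1
      have := congrArg Prod.snd a1
      rw [a2] at this
      exact this.symm
    have hcomp : ∀ ζ, (B' (T (φ (ι x)), B (φ (ι x)) (φ (ι x)).2)).comp (B (φ (ι x))) ζ = ζ := by
      intro ζ
      rw [hy] at hev hC ⊢
      refine apply_eq_of_eventually (B := fun y => (B' (T y, B y y.2)).comp (B y)) hC ?_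
      have h1 : Filter.Tendsto (fun s : ℝ => ((φ (ι x)).1, s • ζ)) (𝓝 0)
          (𝓝 ((φ (ι x)).1, (0 : Q))) := by
        have : Continuous fun s : ℝ => ((φ (ι x)).1, s • ζ) := by fun_prop
        simpa using this.tendsto 0
      exact h1.eventually hev
    intro ζ ζ' h
    rw [← hcomp ζ, ← hcomp ζ', ContinuousLinearMap.comp_apply, ContinuousLinearMap.comp_apply, h]
  have hy' : (T (φ (ι x)), B (φ (ι x)) (φ (ι x)).2) = φ' (ι x) := by
    have := hTB.self_of_nhds
    rw [φ.left_inv hx] at this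
    exact this.symm
  rw [← hy'] at hg
  obtain ⟨r₁, hr₁, h₁⟩ := hg.comp_blowMap hT hB hr
  obtain ⟨r₂, hr₂, h₂⟩ := TameOn.of_injective hB hinj (fun z => by positivity) hr₁ h₁
    fun z hz => le_rfl
  obtain ⟨r₃, hr₃, h₃⟩ := Metric.mem_nhds_iff.1 hloc
  refine ⟨min r₂ r₃, lt_min hr₂ hr₃, (h₂.mono (Metric.ball_subset_ball (min_le_left _ _))).congr
    Metric.isOpen_ball fun z hz hU => h₃ ?_ z hz rfl⟩
  have h4 : dist (blow z).1 (φ (ι x)) ≤ dist (blow z) (φ (ι x), (0 : ℝ)) := by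
    rw [Prod.dist_eq]; exact le_max_left _ _
  exact h4.trans_lt ((Metric.mem_ball.1 hU).trans_le (min_le_right _ _))

/-- In an arbitrary slice chart three kinds of points occur. For `t > 0` smoothness is enough; at `t
= 0` on the submanifold the given chart is compared with the arbitrary one; at `t = 0` off the
submanifold the conic support makes `g` vanish nearby. A compactness argument over the support of
the cutoff then makes the bounds uniform. -/
theorem isSrc_of_tameOn_localRep [T2Space M] {ι : X → M} {σ : M → X}
    (hι : ContMDiff 𝓘(ℝ, P) 𝓘(ℝ, E) ∞ ι) (hσ : ContMDiff 𝓘(ℝ, E) 𝓘(ℝ, P) ∞ σ)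
    (hσι : ∀ x, σ (ι x) = x) {g : DNC P E ι → ℂ}
    (hg : ContMDiffOn (𝓘(ℝ, E).prod 𝓘(ℝ, ℝ)) 𝓘(ℝ, ℂ) ∞ (posPart g) (univ ×ˢ Ioc (0 : ℝ) 1))
    (hK : ∃ K : Set (M × ℝ), IsCompact K ∧ K ⊆ univ ×ˢ Icc (0 : ℝ) 1 ∧
      (∀ m : M, (m, (0 : ℝ)) ∈ K → m ∈ range ι) ∧
      ∀ (m : M) (t : Ioc (0 : ℝ) 1), (m, (t : ℝ)) ∉ K → g (.pos m t) = 0)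
    (hloc : ∀ x, ∃ φ : OpenPartialHomeomorph M (P × Q), IsSliceChart E ι φ ∧ ι x ∈ φ.source ∧
      ∃ r > 0, TameOn (fun z => 1 + ‖z.2.1‖) (Metric.ball (φ (ι x), (0 : ℝ)) r)
        (localRep g φ)) :
    IsSrc Q g := by
  obtain ⟨K, hKc, hKsub, hK0, hKg⟩ := hK
  have htame : ∀ φ : OpenPartialHomeomorph M (P × Q), IsSliceChart E ι φ → ∀ w : (P × Q) × ℝ,
      w.1 ∈ φ.target → w.2 ∈ Icc (0 : ℝ) 1 →
      ∃ r > 0, TameOn (fun z => 1 + ‖z.2.1‖) (Metric.ball w r) (localRep g φ) := by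
    rintro φ hφ ⟨y, t⟩ hy ht
    rcases eq_or_lt_of_le ht.1 with h0 | h0
    · simp only at h0 hy
      subst h0
      by_cases hy2 : y.2 = 0
      · have hye : y = (y.1, 0) := Prod.ext rfl hy2
        rw [hye] at hy
        obtain ⟨v, hv⟩ := hφ.exists_eq hy
        have hvs : ι v ∈ φ.source := by rw [hv]; exact φ.map_target hy
        obtain ⟨φ', hφ', hv', r, hr, h⟩ := hloc v
        have := tameOn_localRep_of_tameOn_localRep hι hσ hσι hφ hφ' hvs hv' hr h
        rwa [hv, φ.right_inv hy, ← hye] at this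
      -- Off the slice, a neighbourhood avoids `K` and has `t ξ ≠ 0`, hence contains only points
      -- with `t > 0`, where `g` is zero.
      · have hne : (φ.symm y, (0 : ℝ)) ∉ K := fun h =>
          hy2 (by rw [← φ.right_inv hy]; exact (hφ.mem_range_iff _ (φ.map_target hy)).1 (hK0 _ h))
        have hc : ContinuousAt (fun w : (P × Q) × ℝ => (φ.symm w.1, w.2)) (y, 0) :=
          ContinuousAt.prodMk
            ((φ.continuousAt_symm hy).comp (f := Prod.fst) (x := (y, (0 : ℝ))) continuousAt_fst)
            continuousAt_snd
        have h1 : ∀ᶠ w in 𝓝 (y, (0 : ℝ)), (φ.symm w.1, w.2) ∉ K :=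
          hc.preimage_mem_nhds (hKc.isClosed.isOpen_compl.mem_nhds hne)
        have h2 : ∀ᶠ w in 𝓝 (y, (0 : ℝ)), w.1.2 ≠ 0 :=
          (show Continuous fun w : (P × Q) × ℝ => w.1.2 by fun_prop).continuousAt.eventually_ne hy2
        obtain ⟨r, hr, h3⟩ := Metric.mem_nhds_iff.1 (h1.and h2)
        refine ⟨r, hr, (TameOn.zero _).congr Metric.isOpen_ball fun z hz hU => ?_⟩
        obtain ⟨h4, h5⟩ := h3 hU
        have hz0 : z.2.2 ∈ Ioc (0 : ℝ) 1 := by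
          refine ⟨lt_of_le_of_ne hz.1 fun h => h5 ?_, hz.2⟩
          simp only [blow, ← h, zero_smul]
        refine (localRep_of_pos g φ hz0).trans (hKg _ _ h4)
    · exact tameOn_localRep_of_pos hg hφ hy h0
  refine ⟨hg, fun φ hφ z hz => ?_, ⟨K, hKc, hKsub, hK0, hKg⟩, fun φ hφ χ hχ hL => ?_⟩
  · obtain ⟨r, hr, h⟩ := htame φ hφ (blow z) hz.2 hz.1
    rw [omega_eq]
    exact (h.contDiffWithinAt z hz.1 (Metric.mem_ball_self hr)).mono inter_subset_left
  obtain ⟨L, hLc, hLsub, hLχ⟩ := hL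
  set h : P × Q × ℝ → ℂ := fun z =>
    localRep g φ z * χ (φ.symm (z.1, z.2.2 • z.2.1), z.2.2) with hdef
  have hχs : ContDiffOn ℝ ∞ (fun w : (P × Q) × ℝ => χ (φ.symm w.1, w.2))
      ((univ ×ˢ Icc (0 : ℝ) 1) ∩ (φ.target ×ˢ univ)) := by
    rw [← contMDiffOn_iff_contDiffOn]
    have h1 : ContMDiffOn 𝓘(ℝ, (P × Q) × ℝ) (𝓘(ℝ, E).prod 𝓘(ℝ, ℝ)) ∞
        (fun w : (P × Q) × ℝ => (φ.symm w.1, w.2))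
        ((univ ×ˢ Icc (0 : ℝ) 1) ∩ (φ.target ×ˢ univ)) :=
      (hφ.contMDiffOn_symm.comp contDiff_fst.contMDiff.contMDiffOn fun w hw => hw.2.1).prodMk
        contDiff_snd.contMDiff.contMDiffOn
    exact hχ.comp h1 fun w hw => ⟨φ.map_target hw.2.1, hw.1.2⟩
  have hth : ∀ w : (P × Q) × ℝ, w.1 ∈ φ.target → w.2 ∈ Icc (0 : ℝ) 1 →
      ∃ r > 0, TameOn (fun z => 1 + ‖z.2.1‖) (Metric.ball w r) h := by
    intro w hw1 hw2
    obtain ⟨r₁, hr₁, h₁⟩ := htame φ hφ w hw1 hw2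
    obtain ⟨r₂, hr₂, h₂⟩ := exists_tameOn_comp_blow (φ.open_target.prod isOpen_univ) hχs
      (y := w) ⟨hw1, mem_univ _⟩
    refine ⟨min r₁ r₂, lt_min hr₁ hr₂, ?_⟩
    have := TameOn.bilinear (ContinuousLinearMap.mul ℝ ℂ)
      (h₁.mono (Metric.ball_subset_ball (min_le_left r₁ r₂)))
      (h₂.mono (Metric.ball_subset_ball (min_le_right r₁ r₂))) (fun z => by positivity)
      fun _ => zero_le_one
    simp only [mul_one] at this
    exact this
  have hcont : ContinuousOn (fun w : M × ℝ => (φ w.1, w.2)) (φ.source ×ˢ Icc (0 : ℝ) 1) :=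
    (φ.continuousOn.comp continuousOn_fst fun w hw => hw.1).prodMk continuousOn_snd
  have hzero : ∀ z ∈ Omega φ.target, blow z ∉ (fun w : M × ℝ => (φ w.1, w.2)) '' L → h z = 0 := by
    intro z hz hn
    have : χ (φ.symm (z.1, z.2.2 • z.2.1), z.2.2) = 0 :=
      hLχ _ ⟨φ.map_target hz.2, hz.1⟩ fun hm => hn ⟨_, hm, by
        simp only [blow]
        rw [φ.right_inv hz.2]⟩
    simp only [hdef, this, mul_zero]
  -- The set `L` confines the support to the chart and `K` makes it conic, so the witness is the
  -- image of `K ∩ L`.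
  refine ⟨fun z hz => ?_, ⟨(fun w : M × ℝ => (φ w.1, w.2)) '' (K ∩ L), ?_, ?_, ?_, ?_⟩,
    fun k n => ?_⟩
  · obtain ⟨r, hr, h'⟩ := hth (blow z) hz.2 hz.1
    rw [omega_eq]
    exact (h'.contDiffWithinAt z hz.1 (Metric.mem_ball_self hr)).mono inter_subset_left
  · exact (hLc.inter_left hKc.isClosed).image_of_continuousOn
      (hcont.mono (inter_subset_right.trans hLsub))
  · rintro _ ⟨w, hw, rfl⟩
    exact ⟨φ.map_source (hLsub hw.2).1, (hLsub hw.2).2⟩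
  · rintro y ⟨w, hw, he⟩
    obtain ⟨rfl, h0⟩ := Prod.mk.inj he
    obtain ⟨m, t⟩ := w
    simp only at h0
    subst h0
    exact (hφ.mem_range_iff _ (hLsub hw.2).1).1 (hK0 _ hw.1)
  · intro z hz ht hn
    by_cases hm : (φ.symm (z.1, z.2.2 • z.2.1), z.2.2) ∈ K
    · refine hzero z hz fun ⟨w, hw, he⟩ => hn ⟨w, ⟨?_, hw⟩, he⟩
      have h1 : φ w.1 = (z.1, z.2.2 • z.2.1) := congrArg Prod.fst he
      have h2 : w.2 = z.2.2 := congrArg Prod.snd he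
      rw [← h1, ← h2, φ.left_inv (hLsub hw).1] at hm
      exact hm
    · have ht' : z.2.2 ∈ Ioc (0 : ℝ) 1 := ⟨lt_of_le_of_ne hz.1.1 (Ne.symm ht), hz.1.2⟩
      have : localRep g φ z = 0 := (localRep_of_pos g φ ht').trans (hKg _ _ hm)
      simp only [hdef, this, zero_mul]
  · have hL'c : IsCompact ((fun w : M × ℝ => (φ w.1, w.2)) '' L) :=
      hLc.image_of_continuousOn (hcont.mono hLsub)
    -- Local bounds are glued over the compact image of `L`. The power `2 * k` appears because `1 +
    -- ‖ξ‖ ^ 2 ≤ (1 + ‖ξ‖) ^ 2`.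
    obtain ⟨C, hC⟩ : ∃ C : ℝ, ∀ z ∈ Slab P Q, blow z ∈ (fun w : M × ℝ => (φ w.1, w.2)) '' L →
        (1 + ‖z.2.1‖) ^ (2 * k) * ‖iteratedFDerivWithin ℝ n h (Slab P Q) z‖ ≤ C := by
      refine hL'c.induction_on (p := fun U => ∃ C : ℝ, ∀ z ∈ Slab P Q, blow z ∈ U →
        (1 + ‖z.2.1‖) ^ (2 * k) * ‖iteratedFDerivWithin ℝ n h (Slab P Q) z‖ ≤ C) ?_ ?_ ?_ ?_
      · exact ⟨0, fun z _ hz => hz.elim⟩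
      · rintro s s' hs ⟨C, hC⟩
        exact ⟨C, fun z hz hU => hC z hz (hs hU)⟩
      · rintro s s' ⟨C, hC⟩ ⟨D, hD⟩
        refine ⟨max C D, fun z hz hU => ?_⟩
        rcases hU with hU | hU
        · exact (hC z hz hU).trans (le_max_left _ _)
        · exact (hD z hz hU).trans (le_max_right _ _)
      · rintro _ ⟨w, hw, rfl⟩
        obtain ⟨r, hr, h'⟩ := hth (φ w.1, w.2) (φ.map_source (hLsub hw).1) (hLsub hw).2
        obtain ⟨C, hC⟩ := h'.rapid (2 * k) n
        exact ⟨_, mem_nhdsWithin_of_mem_nhds (Metric.ball_mem_nhds _ hr), C, hC⟩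
    refine ⟨max C 0, fun z hz => ?_⟩
    have e : iteratedFDerivWithin ℝ n h (Omega φ.target) z =
        iteratedFDerivWithin ℝ n h (Slab P Q) z := by
      rw [omega_eq]
      exact iteratedFDerivWithin_inter_open (isOpen_blow_fst_mem φ.open_target) hz.2
    by_cases hzL : blow z ∈ (fun w : M × ℝ => (φ w.1, w.2)) '' L
    · rw [e]
      refine le_trans ?_ ((hC z hz.1 hzL).trans (le_max_left _ _))
      refine mul_le_mul_of_nonneg_right ?_ (norm_nonneg _)
      rw [pow_mul]
      gcongr
      nlinarith [norm_nonneg z.2.1]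
    · have ev : h =ᶠ[𝓝[Omega φ.target] z] fun _ => 0 := by
        filter_upwards [self_mem_nhdsWithin, mem_nhdsWithin_of_mem_nhds
          ((hL'c.isClosed.isOpen_compl.preimage continuous_blow).mem_nhds hzL)] with z' h1 h2
        exact hzero z' h1 h2
      rw [ev.iteratedFDerivWithin_eq (hzero z hz hzL)]
      simp

end Criterion

/-! ### Smooth maps into the composable pairs -/

/-- The inclusion into `G × G` detects smoothness pointwise. This form suits division, which is
meaningful only where the sources agree. -/
theorem SubmersionPair.contMDiffAt_of_val {p q : ℕ} {G X : Type*}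
    [TopologicalSpace G] [ChartedSpace (Euc (p + q)) G] [IsManifold (𝓡 (p + q)) ∞ G]
    [TopologicalSpace X] [ChartedSpace (Euc p) X] [IsManifold (𝓡 p) ∞ X]
    (σ : SubmersionPair p q G X) {E H N : Type*} [NormedAddCommGroup E] [NormedSpace ℝ E]
    [TopologicalSpace H] {I : ModelWithCorners ℝ E H} [TopologicalSpace N] [ChartedSpace H N]
    {f : N → σ.Composable} {n : N}
    (hf : ContMDiffAt I ((𝓡 (p + q)).prod (𝓡 (p + q))) ∞ (fun n => σ.val (f n)) n) :
    ContMDiffAt I 𝓘(ℝ, Euc (p + q) × Euc q) ∞ f n := by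
  rw [contMDiffAt_iff_target]
  refine ⟨σ.isEmbedding_val.isInducing.continuousAt_iff.2 hf.continuousAt, ?_⟩
  have hmem := mem_chart_source (Euc (p + q) × Euc q) (f n)
  have hopen : IsOpen {c : G × G | c.1 ∈ (σ.submersionAt (f n).fst).domChart.source ∧
        c.2 ∈ (chartAt (Euc (p + q)) (f n).snd).source} :=
    ((σ.submersionAt (f n).fst).domChart.open_source.preimage continuous_fst).inter
      ((chartAt (Euc (p + q)) (f n).snd).open_source.preimage continuous_snd)
  have hat := (σ.contMDiffOn_composableChart_ambient (f n)).contMDiffAt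
    (hopen.mem_nhds (x := σ.val (f n)) hmem)
  exact ContMDiffAt.comp (f := fun n => σ.val (f n)) n hat hf

/-! ### Division in the groupoid -/

namespace LieGroupoid

variable {p q : ℕ} {G X : Type*}
  [TopologicalSpace G] [ChartedSpace (Euc (p + q)) G] [IsManifold (𝓡 (p + q)) ∞ G]
  [TopologicalSpace X] [ChartedSpace (Euc p) X] [IsManifold (𝓡 p) ∞ X]
  (𝒢 : LieGroupoid p q G X)

theorem u_injective : Function.Injective 𝒢.u := fun x y h => by rw [← 𝒢.s_u x, h, 𝒢.s_u]

theorem u₂_injective : Function.Injective 𝒢.u₂ := fun _ _ h =>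
  𝒢.u_injective (congrArg SubmersionPair.Composable.fst h)

theorem mul_congr {c d : 𝒢.Comp} (h₁ : c.fst = d.fst) (h₂ : c.snd = d.snd) :
    𝒢.mul c = 𝒢.mul d :=
  congrArg 𝒢.mul (SubmersionPair.Composable.ext h₁ h₂)

theorem mul_u₂ (x : X) : 𝒢.mul (𝒢.u₂ x) = 𝒢.u x := by
  refine Eq.trans ?_ (𝒢.mul_u (𝒢.u x))
  exact 𝒢.mul_congr rfl (congrArg 𝒢.u (𝒢.s_u x).symm)

theorem mul_divPair (γ : G) (δ : 𝒢.Fibre (𝒢.s γ)) : 𝒢.mul (𝒢.divPair γ δ) = γ := by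
  obtain ⟨δ, hδ⟩ := δ
  have h := 𝒢.mul_assoc γ (𝒢.inv δ) δ (hδ.symm.trans (𝒢.r_inv δ).symm) (𝒢.s_inv δ)
  rw [divPair, ← h]
  refine Eq.trans ?_ (𝒢.mul_u γ)
  exact 𝒢.mul_congr rfl ((𝒢.inv_mul δ).trans (congrArg 𝒢.u hδ))

theorem divPair_mul (c : 𝒢.Comp) :
    𝒢.divPair (𝒢.mul c) ⟨c.snd, (𝒢.s_mul c).symm⟩ = c := by
  refine SubmersionPair.Composable.ext ?_ rfl
  obtain ⟨γ, η, h⟩ := c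
  have h' := 𝒢.mul_assoc γ η (𝒢.inv η) h (𝒢.r_inv η).symm
  refine h'.symm.trans (Eq.trans ?_ (𝒢.mul_u γ))
  exact 𝒢.mul_congr rfl ((𝒢.mul_inv η).trans (congrArg 𝒢.u h.symm))

open Classical in
/-- The pair `(γ, η)`, if it is composable. -/
def mkComp (γ η : G) : 𝒢.Comp := if h : 𝒢.s γ = 𝒢.r η then ⟨γ, η, h⟩ else 𝒢.u₂ (𝒢.s γ)

/-- The pair `(γ δ⁻¹, δ)`, if `γ` and `δ` have the same source. -/
def divMap (γ δ : G) : 𝒢.Comp := 𝒢.mkComp (𝒢.mul (𝒢.mkComp γ (𝒢.inv δ))) δ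

theorem mkComp_of_eq {γ η : G} (h : 𝒢.s γ = 𝒢.r η) : 𝒢.mkComp γ η = ⟨γ, η, h⟩ := dif_pos h

theorem divMap_of_eq {γ δ : G} (h : 𝒢.s δ = 𝒢.s γ) : 𝒢.divMap γ δ = 𝒢.divPair γ ⟨δ, h⟩ := by
  have h1 : 𝒢.s γ = 𝒢.r (𝒢.inv δ) := h.symm.trans (𝒢.r_inv δ).symm
  rw [divMap, 𝒢.mkComp_of_eq h1, 𝒢.mkComp_of_eq ((𝒢.s_mul _).trans (𝒢.s_inv δ))]
  rfl

theorem divMap_mul (c : 𝒢.Comp) : 𝒢.divMap (𝒢.mul c) c.snd = c := by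
  rw [𝒢.divMap_of_eq (𝒢.s_mul c).symm, divPair_mul]

theorem mul_divMap {γ δ : G} (h : 𝒢.s δ = 𝒢.s γ) : 𝒢.mul (𝒢.divMap γ δ) = γ := by
  rw [𝒢.divMap_of_eq h, mul_divPair]

theorem divMap_snd {γ δ : G} (h : 𝒢.s δ = 𝒢.s γ) : (𝒢.divMap γ δ).snd = δ := by
  rw [𝒢.divMap_of_eq h]; rfl

section Smooth

variable {E H N : Type*} [NormedAddCommGroup E] [NormedSpace ℝ E]
  [TopologicalSpace H] {I : ModelWithCorners ℝ E H} [TopologicalSpace N] [ChartedSpace H N]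
  {f₁ f₂ : N → G} {n : N}

/-- Composability on a whole neighbourhood keeps the default value of `mkComp` out of play. -/
theorem contMDiffAt_mkComp (h₁ : ContMDiffAt I (𝓡 (p + q)) ∞ f₁ n)
    (h₂ : ContMDiffAt I (𝓡 (p + q)) ∞ f₂ n) (h : ∀ᶠ m in 𝓝 n, 𝒢.s (f₁ m) = 𝒢.r (f₂ m)) :
    ContMDiffAt I 𝓘(ℝ, Euc (p + q) × Euc q) ∞ (fun m => 𝒢.mkComp (f₁ m) (f₂ m)) n := by
  refine 𝒢.contMDiffAt_of_val ((h₁.prodMk h₂).congr_of_eventuallyEq ?_)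
  filter_upwards [h] with m hm
  rw [𝒢.mkComp_of_eq hm]
  rfl

theorem contMDiffAt_divMap (h₁ : ContMDiffAt I (𝓡 (p + q)) ∞ f₁ n)
    (h₂ : ContMDiffAt I (𝓡 (p + q)) ∞ f₂ n) (h : ∀ᶠ m in 𝓝 n, 𝒢.s (f₂ m) = 𝒢.s (f₁ m)) :
    ContMDiffAt I 𝓘(ℝ, Euc (p + q) × Euc q) ∞ (fun m => 𝒢.divMap (f₁ m) (f₂ m)) n := by
  have hi : ContMDiffAt I (𝓡 (p + q)) ∞ (fun m => 𝒢.inv (f₂ m)) n :=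
    (𝒢.contMDiff_inv _).comp n h₂
  have h1 := 𝒢.contMDiffAt_mkComp h₁ hi (by
    filter_upwards [h] with m hm
    rw [𝒢.r_inv, hm])
  refine 𝒢.contMDiffAt_mkComp ((𝒢.contMDiff_mul _).comp n h1) h₂ ?_
  filter_upwards [h] with m hm
  rw [𝒢.s_mul, 𝒢.mkComp_of_eq (hm.symm.trans (𝒢.r_inv _).symm), 𝒢.s_inv]

end Smooth

/-! ### Charts -/

section FibredChart

variable {𝒢} {φ : OpenPartialHomeomorph G (Euc p × Euc q)} {ψ : OpenPartialHomeomorph X (Euc p)}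

theorem IsFibredChart.s_symm (h : 𝒢.IsFibredChart φ ψ) {w : Euc p × Euc q} (hw : w ∈ φ.target) :
    𝒢.s (φ.symm w) = ψ.symm w.1 := by
  have h1 := h.base_s _ (φ.map_target hw)
  rw [φ.right_inv hw] at h1
  rw [← h1, ψ.left_inv (h.mapsTo (φ.map_target hw))]

theorem IsFibredChart.apply_eq (h : 𝒢.IsFibredChart φ ψ) {γ : G} (hγ : γ ∈ φ.source) :
    φ γ = (ψ (𝒢.s γ), (φ γ).2) :=
  Prod.ext (h.base_s γ hγ).symm rfl

variable (𝒢) in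
theorem exists_isFibredChart (γ : G) :
    ∃ (φ : OpenPartialHomeomorph G (Euc p × Euc q)) (ψ : OpenPartialHomeomorph X (Euc p)),
      𝒢.IsFibredChart φ ψ ∧ γ ∈ φ.source := by
  set S := 𝒢.submersionAt γ with hS
  refine ⟨S.domChart.trans S.equiv.toHomeomorph.toOpenPartialHomeomorph, S.codChart, ⟨?_, ?_, ?_,
    ?_, ?_, ?_⟩, ?_⟩
  · have h1 := contMDiffOn_of_mem_maximalAtlas S.domChart_mem_maximalAtlas
    have h2 := S.equiv.contDiff (n := ∞).contMDiff.comp_contMDiffOn h1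
    exact h2.mono fun x hx => by simpa using hx
  · have h1 := contMDiffOn_symm_of_mem_maximalAtlas S.domChart_mem_maximalAtlas
    have h2 := S.equiv.symm.contDiff (n := ∞).contMDiff.contMDiffOn
      (s := S.equiv.symm ⁻¹' S.domChart.target)
    have h3 := h1.comp h2 fun _ h => h
    exact h3.mono fun x hx => by simpa using hx
  · exact contMDiffOn_of_mem_maximalAtlas S.codChart_mem_maximalAtlas
  · exact contMDiffOn_symm_of_mem_maximalAtlas S.codChart_mem_maximalAtlas
  · intro x hx
    exact S.source_subset_preimage_source (by simpa using hx)
  · intro x hx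
    have hx' : x ∈ S.domChart.source := by simpa using hx
    have hx'' : S.domChart x ∈ (S.domChart.extend (𝓡 (p + q))).target := by
      rw [OpenPartialHomeomorph.extend_target]
      simpa using S.domChart.map_source hx'
    have h2 := S.writtenInCharts hx''
    simpa [S.domChart.left_inv hx'] using h2
  · simpa using S.mem_domChart_source

variable (𝒢) in
-- In a fibred chart the units are the graph `b = β a`, being a section of `s`. The shear `(a, b) ↦
-- (a, b - β a)` moves them to `b = 0` and leaves the first coordinate alone, so the chart remains
-- fibred.
theorem exists_isFibredChart_isSliceChart (x : X) :
    ∃ (φ : OpenPartialHomeomorph G (Euc p × Euc q)) (ψ : OpenPartialHomeomorph X (Euc p)),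
      𝒢.IsFibredChart φ ψ ∧ IsSliceChart (Euc (p + q)) 𝒢.u φ ∧ 𝒢.u x ∈ φ.source := by
  obtain ⟨φ, ψ, h, hx⟩ := 𝒢.exists_isFibredChart (𝒢.u x)
  have hxψ : x ∈ ψ.source := by simpa only [𝒢.s_u] using h.mapsTo hx
  set O : Set (Euc p) := ψ.target ∩ ψ.symm ⁻¹' (𝒢.u ⁻¹' φ.source) with hOdef
  have hO : IsOpen O :=
    ψ.isOpen_inter_preimage_symm (φ.open_source.preimage 𝒢.contMDiff_u.continuous)
  set β : Euc p → Euc q := fun a => (φ (𝒢.u (ψ.symm a))).2 with hβdef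
  have hβ : ContDiffOn ℝ ∞ β O := by
    have h1 : ContMDiffOn (𝓡 p) 𝓘(ℝ, Euc p × Euc q) ∞ (fun a => φ (𝒢.u (ψ.symm a))) O :=
      h.contMDiffOn.comp (𝒢.contMDiff_u.comp_contMDiffOn
        (h.contMDiffOn_base_symm.mono inter_subset_left)) fun a ha => ha.2
    exact (contMDiffOn_iff_contDiffOn.1 h1).snd
  let e : OpenPartialHomeomorph (Euc p × Euc q) (Euc p × Euc q) :=
    { toFun := fun w => (w.1, w.2 - β w.1)
      invFun := fun w => (w.1, w.2 + β w.1)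
      source := O ×ˢ univ
      target := O ×ˢ univ
      map_source' := fun w hw => ⟨hw.1, mem_univ _⟩
      map_target' := fun w hw => ⟨hw.1, mem_univ _⟩
      left_inv' := fun w _ => by simp
      right_inv' := fun w _ => by simp
      open_source := hO.prod isOpen_univ
      open_target := hO.prod isOpen_univ
      continuousOn_toFun := continuousOn_fst.prodMk (continuousOn_snd.sub
        (hβ.continuousOn.comp continuousOn_fst fun w hw => hw.1))
      continuousOn_invFun := continuousOn_fst.prodMk (continuousOn_snd.add
        (hβ.continuousOn.comp continuousOn_fst fun w hw => hw.1)) }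
  have he : ContDiffOn ℝ ∞ e (O ×ˢ univ) :=
    contDiffOn_fst.prodMk (contDiffOn_snd.sub (hβ.comp contDiffOn_fst fun w hw => hw.1))
  have hes : ContDiffOn ℝ ∞ e.symm (O ×ˢ univ) :=
    contDiffOn_fst.prodMk (contDiffOn_snd.add (hβ.comp contDiffOn_fst fun w hw => hw.1))
  have hsrc : ∀ γ, γ ∈ (φ.trans e).source ↔ γ ∈ φ.source ∧ (φ γ).1 ∈ O := by
    intro γ
    rw [OpenPartialHomeomorph.trans_source]
    change γ ∈ φ.source ∧ ((φ γ).1 ∈ O ∧ True) ↔ _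
    rw [and_true]
  have htar : ∀ w, w ∈ (φ.trans e).target → w.1 ∈ O ∧ e.symm w ∈ φ.target := by
    intro w hw
    rw [OpenPartialHomeomorph.trans_target] at hw
    exact ⟨hw.1.1, hw.2⟩
  have h1 : ContMDiffOn (𝓡 (p + q)) 𝓘(ℝ, Euc p × Euc q) ∞ (φ.trans e) (φ.trans e).source :=
    he.contMDiffOn.comp (h.contMDiffOn.mono fun γ hγ => ((hsrc γ).1 hγ).1)
      fun γ hγ => ⟨((hsrc γ).1 hγ).2, mem_univ _⟩
  have h2 : ContMDiffOn 𝓘(ℝ, Euc p × Euc q) (𝓡 (p + q)) ∞ (φ.trans e).symm (φ.trans e).target :=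
    h.contMDiffOn_symm.comp (hes.contMDiffOn.mono fun w hw => ⟨(htar w hw).1, mem_univ _⟩)
      fun w hw => (htar w hw).2
  have hkey : ∀ γ ∈ (φ.trans e).source,
      𝒢.u (𝒢.s γ) ∈ φ.source ∧ (φ.trans e γ).2 = (φ γ).2 - (φ (𝒢.u (𝒢.s γ))).2 := by
    intro γ hγ
    obtain ⟨g1, g2⟩ := (hsrc γ).1 hγ
    have g3 : ψ.symm (φ γ).1 = 𝒢.s γ := by
      rw [← h.base_s γ g1, ψ.left_inv (h.mapsTo g1)]
    refine ⟨?_, ?_⟩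
    · rw [← g3]; exact g2.2
    · rw [← g3]; rfl
  refine ⟨φ.trans e, ψ, ⟨h1, h2, h.contMDiffOn_base, h.contMDiffOn_base_symm,
    fun γ hγ => h.mapsTo ((hsrc γ).1 hγ).1, fun γ hγ => h.base_s γ ((hsrc γ).1 hγ).1⟩,
    ⟨h1, h2, fun γ hγ => ?_⟩, ?_⟩
  · obtain ⟨g1, g2⟩ := hkey γ hγ
    rw [g2, sub_eq_zero]
    constructor
    · rintro ⟨v, rfl⟩
      rw [𝒢.s_u]
    -- Conversely, a point with second coordinate `0` has the same coordinates as the unit at its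
    -- source.
    · intro g3
      refine ⟨𝒢.s γ, (φ.injOn ((hsrc γ).1 hγ).1 g1 (Prod.ext ?_ g3)).symm⟩
      rw [← h.base_s γ ((hsrc γ).1 hγ).1, ← h.base_s _ g1, 𝒢.s_u]
  · rw [hsrc]
    refine ⟨hx, ?_⟩
    rw [← h.base_s _ hx, 𝒢.s_u]
    refine ⟨ψ.map_source hxψ, ?_⟩
    rw [mem_preimage, ψ.left_inv hxψ]
    exact hx

/-- The chart `(γ, δ) ↦ (a, b, d)` of the composable pairs, where `(a, b)` and `(a, d)` are the
coordinates of `γ δ` and of `δ` in a fibred chart. -/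
def compChart (h : 𝒢.IsFibredChart φ ψ) :
    OpenPartialHomeomorph 𝒢.Comp (Euc p × Euc q × Euc q) :=
  have hs : ∀ y : Euc p × Euc q × Euc q, (y.1, y.2.1) ∈ φ.target → (y.1, y.2.2) ∈ φ.target →
      𝒢.s (φ.symm (y.1, y.2.2)) = 𝒢.s (φ.symm (y.1, y.2.1)) := fun y h1 h2 => by
    rw [h.s_symm h1, h.s_symm h2]
  have hfst : ∀ c : 𝒢.Comp, 𝒢.mul c ∈ φ.source → c.snd ∈ φ.source →
      (φ (𝒢.mul c)).1 = (φ c.snd).1 := fun c h1 h2 => by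
    rw [← h.base_s _ h1, ← h.base_s _ h2, 𝒢.s_mul]
  have hopen : IsOpen {y : Euc p × Euc q × Euc q | (y.1, y.2.1) ∈ φ.target ∧
      (y.1, y.2.2) ∈ φ.target} :=
    (φ.open_target.preimage (by fun_prop : Continuous fun y : Euc p × Euc q × Euc q =>
      (y.1, y.2.1))).inter (φ.open_target.preimage
        (by fun_prop : Continuous fun y : Euc p × Euc q × Euc q => (y.1, y.2.2)))
  { toFun := fun c => ((φ (𝒢.mul c)).1, (φ (𝒢.mul c)).2, (φ c.snd).2)
    invFun := fun y => 𝒢.divMap (φ.symm (y.1, y.2.1)) (φ.symm (y.1, y.2.2))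
    source := {c | 𝒢.mul c ∈ φ.source ∧ c.snd ∈ φ.source}
    target := {y | (y.1, y.2.1) ∈ φ.target ∧ (y.1, y.2.2) ∈ φ.target}
    map_source' := by
      rintro c ⟨h1, h2⟩
      refine ⟨φ.map_source h1, ?_⟩
      simp only [hfst c h1 h2]
      exact φ.map_source h2
    map_target' := by
      rintro y ⟨h1, h2⟩
      refine ⟨?_, ?_⟩
      · rw [𝒢.mul_divMap (hs y h1 h2)]
        exact φ.map_target h1
      · rw [𝒢.divMap_snd (hs y h1 h2)]
        exact φ.map_target h2
    left_inv' := by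
      rintro c ⟨h1, h2⟩
      have e1 : φ.symm ((φ (𝒢.mul c)).1, (φ (𝒢.mul c)).2) = 𝒢.mul c := φ.left_inv h1
      have e2 : φ.symm ((φ (𝒢.mul c)).1, (φ c.snd).2) = c.snd := by
        rw [hfst c h1 h2]; exact φ.left_inv h2
      simp only [e1, e2, 𝒢.divMap_mul]
    right_inv' := by
      rintro y ⟨h1, h2⟩
      simp only [𝒢.mul_divMap (hs y h1 h2), 𝒢.divMap_snd (hs y h1 h2), φ.right_inv h1,
        φ.right_inv h2]
    open_source := (φ.open_source.preimage 𝒢.contMDiff_mul.continuous).inter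
      (φ.open_source.preimage 𝒢.contMDiff_snd.continuous)
    open_target := hopen
    continuousOn_toFun := by
      have h1 : ContinuousOn (fun c : 𝒢.Comp => φ (𝒢.mul c))
          {c | 𝒢.mul c ∈ φ.source ∧ c.snd ∈ φ.source} :=
        φ.continuousOn.comp 𝒢.contMDiff_mul.continuous.continuousOn fun c hc => hc.1
      have h2 : ContinuousOn (fun c : 𝒢.Comp => φ c.snd)
          {c | 𝒢.mul c ∈ φ.source ∧ c.snd ∈ φ.source} :=
        φ.continuousOn.comp 𝒢.contMDiff_snd.continuous.continuousOn fun c hc => hc.2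
      exact h1.fst.prodMk (h1.snd.prodMk h2.snd)
    continuousOn_invFun := fun y hy =>
      (𝒢.contMDiffAt_divMap (I := 𝓘(ℝ, Euc p × Euc q × Euc q))
        ((h.contMDiffOn_symm.contMDiffAt (φ.open_target.mem_nhds hy.1)).comp y
          (by fun_prop : ContDiff ℝ ∞ fun y : Euc p × Euc q × Euc q =>
            (y.1, y.2.1)).contMDiff.contMDiffAt)
        ((h.contMDiffOn_symm.contMDiffAt (φ.open_target.mem_nhds hy.2)).comp y
          (by fun_prop : ContDiff ℝ ∞ fun y : Euc p × Euc q × Euc q =>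
            (y.1, y.2.2)).contMDiff.contMDiffAt)
        (Filter.mem_of_superset (hopen.mem_nhds hy)
          fun y hy => hs y hy.1 hy.2)).continuousAt.continuousWithinAt }

theorem compChart_apply (h : 𝒢.IsFibredChart φ ψ) (c : 𝒢.Comp) :
    compChart h c = ((φ (𝒢.mul c)).1, (φ (𝒢.mul c)).2, (φ c.snd).2) := rfl

theorem compChart_symm_apply (h : 𝒢.IsFibredChart φ ψ) (y : Euc p × Euc q × Euc q) :
    (compChart h).symm y = 𝒢.divMap (φ.symm (y.1, y.2.1)) (φ.symm (y.1, y.2.2)) := rfl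

theorem s_symm_eq_s_symm (h : 𝒢.IsFibredChart φ ψ) {y : Euc p × Euc q × Euc q}
    (hy : y ∈ (compChart h).target) :
    𝒢.s (φ.symm (y.1, y.2.2)) = 𝒢.s (φ.symm (y.1, y.2.1)) := by
  rw [h.s_symm hy.1, h.s_symm hy.2]

/-- A pair `(γ, δ)` is a pair of equal units exactly when `γδ` and `δ` are units. The inverse chart
is division, which is smooth. -/
theorem isSliceChart_compChart (h : 𝒢.IsFibredChart φ ψ)
    (hφ : IsSliceChart (Euc (p + q)) 𝒢.u φ) :
    IsSliceChart (Euc (p + q) × Euc q) 𝒢.u₂ (compChart h) where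
  contMDiffOn := by
    have h1 : ContMDiffOn 𝓘(ℝ, Euc (p + q) × Euc q) 𝓘(ℝ, Euc p × Euc q) ∞
        (fun c : 𝒢.Comp => φ (𝒢.mul c)) (compChart h).source :=
      h.contMDiffOn.comp 𝒢.contMDiff_mul.contMDiffOn fun c hc => hc.1
    have h2 : ContMDiffOn 𝓘(ℝ, Euc (p + q) × Euc q) 𝓘(ℝ, Euc p × Euc q) ∞
        (fun c : 𝒢.Comp => φ c.snd) (compChart h).source :=
      h.contMDiffOn.comp 𝒢.contMDiff_snd.contMDiffOn fun c hc => hc.2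
    exact ((contDiff_fst (n := ∞)).contMDiff.comp_contMDiffOn h1).prodMk_space
      (((contDiff_snd (n := ∞)).contMDiff.comp_contMDiffOn h1).prodMk_space
        ((contDiff_snd (n := ∞)).contMDiff.comp_contMDiffOn h2))
  contMDiffOn_symm := fun y hy =>
    (𝒢.contMDiffAt_divMap (I := 𝓘(ℝ, Euc p × Euc q × Euc q))
      ((h.contMDiffOn_symm.contMDiffAt (φ.open_target.mem_nhds hy.1)).comp y
        (by fun_prop : ContDiff ℝ ∞ fun y : Euc p × Euc q × Euc q =>
          (y.1, y.2.1)).contMDiff.contMDiffAt)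
      ((h.contMDiffOn_symm.contMDiffAt (φ.open_target.mem_nhds hy.2)).comp y
        (by fun_prop : ContDiff ℝ ∞ fun y : Euc p × Euc q × Euc q =>
          (y.1, y.2.2)).contMDiff.contMDiffAt)
      (Filter.mem_of_superset ((compChart h).open_target.mem_nhds hy)
        fun y hy => s_symm_eq_s_symm h hy)).contMDiffWithinAt
  mem_range_iff := by
    rintro c ⟨h1, h2⟩
    rw [compChart_apply]
    change _ ↔ ((φ (𝒢.mul c)).2, (φ c.snd).2) = 0
    rw [Prod.mk_eq_zero, ← hφ.mem_range_iff _ h1, ← hφ.mem_range_iff _ h2]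
    constructor
    · rintro ⟨x, rfl⟩
      exact ⟨⟨x, (𝒢.mul_u₂ x).symm⟩, ⟨x, rfl⟩⟩
    · rintro ⟨⟨x, hx⟩, ⟨y, hy⟩⟩
      have hxy : x = y := by rw [← 𝒢.s_u x, hx, 𝒢.s_mul, ← hy, 𝒢.s_u]
      subst hxy
      refine ⟨x, ?_⟩
      rw [← 𝒢.divMap_mul c, ← hx, ← hy, ← 𝒢.divMap_mul (𝒢.u₂ x), 𝒢.mul_u₂]
      rfl

end FibredChart

/-! ### Separation properties -/

theorem t2Space_base [T2Space G] (𝒢 : LieGroupoid p q G X) : T2Space X :=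
  T2Space.of_injective_continuous 𝒢.u_injective 𝒢.contMDiff_u.continuous

instance [T2Space G] : T2Space 𝒢.Comp :=
  T2Space.of_injective_continuous 𝒢.isEmbedding_val.injective 𝒢.continuous_val

/-- The composable pairs are the equaliser of two continuous maps to the Hausdorff space `X`.
Compact subsets of `G × G` therefore have compact preimages. -/
theorem isClosedEmbedding_val [T2Space G] : Topology.IsClosedEmbedding 𝒢.val := by
  have := 𝒢.t2Space_base
  refine ⟨𝒢.isEmbedding_val, ?_⟩
  have : range 𝒢.val = {c : G × G | 𝒢.s c.1 = 𝒢.r c.2} := by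
    ext c
    exact ⟨fun ⟨d, hd⟩ => hd ▸ d.comp, fun h => ⟨⟨c.1, c.2, h⟩, rfl⟩⟩
  rw [this]
  exact isClosed_eq (𝒢.contMDiff_s.continuous.comp continuous_fst)
    (𝒢.contMDiff_r.continuous.comp continuous_snd)

end LieGroupoid

/-! ### Global functions of rapid decay -/

section Rapid

variable {P E Q Q' F : Type*} [NormedAddCommGroup P] [NormedSpace ℝ P]
  [NormedAddCommGroup E] [NormedSpace ℝ E]
  [NormedAddCommGroup Q] [NormedSpace ℝ Q] [NormedAddCommGroup Q'] [NormedSpace ℝ Q']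
  [NormedAddCommGroup F] [NormedSpace ℝ F]
  {X M : Type*} [TopologicalSpace X] [ChartedSpace P X] [TopologicalSpace M]
  [ChartedSpace E M]

theorem TameOn.of_rapid {U : Set ((P × Q) × ℝ)} {h : P × Q × ℝ → F}
    (hc : ∀ z ∈ Slab P Q, blow z ∈ U → ContDiffWithinAt ℝ ∞ h (Slab P Q) z)
    (hb : ∀ k n : ℕ, ∃ C : ℝ, ∀ z ∈ Slab P Q, blow z ∈ U →
      (1 + ‖z.2.1‖) ^ k * ‖iteratedFDerivWithin ℝ n h (Slab P Q) z‖ ≤ C) :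
    TameOn (fun z => 1 + ‖z.2.1‖) U h :=
  ⟨hc, fun n => ⟨0, fun k => by simpa using hb k n⟩⟩

/-- A cutoff with compact support in the chart extends the local representative by zero to the whole
slab, where integration over all of `Q'` makes sense. -/
theorem IsSrc.tameOn_mul {ι : X → M} {g : DNC P E ι → ℂ} (hg : IsSrc Q g)
    {φ : OpenPartialHomeomorph M (P × Q)} (hφ : IsSliceChart E ι φ) {κ : P × Q → ℂ}
    (hκ : ContDiffOn ℝ ∞ κ φ.target) {L : Set (P × Q)} (hL : IsCompact L) (hLφ : L ⊆ φ.target)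
    (hκL : ∀ y, y ∉ L → κ y = 0) :
    TameOn (fun z => 1 + ‖z.2.1‖) univ fun z : P × Q × ℝ =>
      localRep g φ z * κ (z.1, z.2.2 • z.2.1) := by
  set h : P × Q × ℝ → ℂ := fun z => localRep g φ z * κ (z.1, z.2.2 • z.2.1) with hdef
  have hloc := hg.rapid_decay φ hφ (fun w => κ (φ w.1))
    (hκ.contMDiffOn.comp (hφ.contMDiffOn.comp contMDiffOn_fst fun w hw => hw.1)
      fun w hw => φ.map_source hw.1)
    ⟨(φ.symm '' L) ×ˢ Icc 0 1,
      (hL.image_of_continuousOn (φ.continuousOn_symm.mono hLφ)).prod isCompact_Icc,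
      prod_mono (by rintro _ ⟨y, hy, rfl⟩; exact φ.map_target (hLφ hy)) subset_rfl,
      fun w hw hn => hκL _ fun hm => hn ⟨⟨_, hm, φ.left_inv hw.1⟩, hw.2⟩⟩
  set h' : P × Q × ℝ → ℂ := fun z =>
    localRep g φ z * κ (φ (φ.symm (z.1, z.2.2 • z.2.1))) with hdef'
  have heq : EqOn h h' (Omega φ.target) := by
    intro z hz
    simp only [hdef, hdef', φ.right_inv hz.2]
  have hO := isOpen_blow_fst_mem (P := P) (Q := Q) φ.open_target
  have hev : ∀ z ∈ Slab P Q, (blow z).1 ∉ L → h =ᶠ[𝓝[Slab P Q] z] fun _ => 0 := by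
    intro z hz hn
    filter_upwards [mem_nhdsWithin_of_mem_nhds
      ((isOpen_blow_fst_mem hL.isClosed.isOpen_compl).mem_nhds hn)] with z' hz'
    have : κ (z'.1, z'.2.2 • z'.2.1) = 0 := hκL _ hz'
    simp only [hdef, this, mul_zero]
  have hL0 : ∀ z, (blow z).1 ∉ L → h z = 0 := fun z hn => by
    have : κ (z.1, z.2.2 • z.2.1) = 0 := hκL _ hn
    simp only [hdef, this, mul_zero]
  refine TameOn.of_rapid (fun z hz _ => ?_) fun k n => ?_
  · by_cases hm : (blow z).1 ∈ L
    · have hzO : z ∈ Omega φ.target := ⟨hz, hLφ hm⟩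
      have h1 := (hloc.contDiffOn z hzO).congr (f₁ := h) heq (heq hzO)
      rw [omega_eq] at h1
      exact (contDiffWithinAt_inter (hO.mem_nhds (hLφ hm))).1 h1
    · exact contDiffWithinAt_const.congr_of_eventuallyEq (hev z hz hm) (hL0 z hm)
  · obtain ⟨C, hC⟩ := hloc.rapid_decay k n
    -- `1 + ‖ξ‖ ≤ 2 (1 + ‖ξ‖ ^ 2)` passes between the two families of weights.
    refine ⟨max (2 ^ k * C) 0, fun z hz _ => ?_⟩
    by_cases hm : (blow z).1 ∈ L
    · have hzO : z ∈ Omega φ.target := ⟨hz, hLφ hm⟩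
      refine le_trans ?_ (le_max_left _ _)
      have h1 := hC z hzO
      rw [← iteratedFDerivWithin_congr heq hzO, omega_eq,
        iteratedFDerivWithin_inter_open hO (hLφ hm)] at h1
      refine le_trans ?_ (mul_le_mul_of_nonneg_left h1 (by positivity))
      rw [← mul_assoc, ← mul_pow]
      gcongr
      nlinarith [sq_nonneg (‖z.2.1‖ - 1), norm_nonneg z.2.1]
    · rw [(hev z hz hm).iteratedFDerivWithin_eq (hL0 z hm)]
      simp

variable [MeasurableSpace Q'] [BorelSpace Q'] [FiniteDimensional ℝ Q']

/-- The decay in `(ξ, η)` is split: `k` powers are kept for `ξ` and a fixed number is spent on `η`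
to obtain an integrable bound that is uniform in the parameters. -/
theorem TameOn.integral [CompleteSpace F] {ν : Measure Q'} [ν.IsAddHaarMeasure]
    {h : P × (Q × Q') × ℝ → F} (hh : TameOn (fun z => 1 + ‖z.2.1‖) univ h) :
    TameOn (fun z => 1 + ‖z.2.1‖) univ fun z : P × Q × ℝ =>
      ∫ η, h (z.1, (z.2.1, η), z.2.2) ∂ν := by
  -- One more than the dimension is enough for `(1 + ‖η‖) ^ (-r)` to be integrable.
  set r : ℕ := Module.finrank ℝ Q' + 1 with hr
  have hint : Integrable (fun η : Q' => (1 + ‖η‖) ^ (-(r : ℝ))) ν :=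
    integrable_one_add_norm (by rw [hr]; push_cast; linarith)
  let A : P × Q × ℝ →L[ℝ] P × (Q × Q') × ℝ :=
    (ContinuousLinearMap.fst ℝ P (Q × ℝ)).prod
      (((ContinuousLinearMap.inl ℝ Q Q').comp ((ContinuousLinearMap.fst ℝ Q ℝ).comp
        (ContinuousLinearMap.snd ℝ P (Q × ℝ)))).prod
        ((ContinuousLinearMap.snd ℝ Q ℝ).comp (ContinuousLinearMap.snd ℝ P (Q × ℝ))))
  let B : Q' → P × (Q × Q') × ℝ := fun η => (0, (0, η), 0)
  have hAB : ∀ z η, A z + B η = (z.1, (z.2.1, η), z.2.2) := fun z η => by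
    simp [A, B]
  have hABm : ∀ z ∈ Slab P Q, ∀ η, A z + B η ∈ Slab P (Q × Q') := fun z hz η => by
    rw [hAB]; exact hz
  have hrap : ∀ k n : ℕ, ∃ C : ℝ, 0 ≤ C ∧ ∀ z ∈ Slab P Q, ∀ η,
      (1 + ‖z.2.1‖) ^ k * ‖iteratedFDerivWithin ℝ n h (Slab P (Q × Q')) (A z + B η)‖ ≤
        C * (1 + ‖η‖) ^ (-(r : ℝ)) := by
    intro k n
    obtain ⟨C, hC⟩ := hh.rapid (k + r) n
    refine ⟨max C 0, le_max_right _ _, fun z hz η => ?_⟩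
    have h1 := hC _ (hABm z hz η) (mem_univ _)
    have h2 : (A z + B η).2.1 = (z.2.1, η) := by rw [hAB]
    rw [h2, pow_add] at h1
    have h3 : ‖z.2.1‖ ≤ ‖(z.2.1, η)‖ := le_max_left _ _
    have h4 : ‖η‖ ≤ ‖(z.2.1, η)‖ := le_max_right _ _
    rw [Real.rpow_neg (by positivity), Real.rpow_natCast, ← div_eq_mul_inv,
      le_div_iff₀ (by positivity)]
    calc _ = (1 + ‖z.2.1‖) ^ k * (1 + ‖η‖) ^ r *
          ‖iteratedFDerivWithin ℝ n h (Slab P (Q × Q')) (A z + B η)‖ := by ring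
      _ ≤ (1 + ‖(z.2.1, η)‖) ^ k * (1 + ‖(z.2.1, η)‖) ^ r *
          ‖iteratedFDerivWithin ℝ n h (Slab P (Q × Q')) (A z + B η)‖ := by gcongr
      _ ≤ _ := h1.trans (le_max_left _ _)
  choose C hC0 hC using hrap
  have hbd : ∀ n : ℕ, ∀ᵐ η ∂ν, ∀ z ∈ Slab P Q,
      ‖iteratedFDerivWithin ℝ n h (Slab P (Q × Q')) (A z + B η)‖ ≤
        C 0 n * (1 + ‖η‖) ^ (-(r : ℝ)) := fun n =>
    Filter.Eventually.of_forall fun η z hz => by simpa using hC 0 n z hz η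
  have hhc : ContDiffOn ℝ ∞ h (Slab P (Q × Q')) := fun z hz =>
    hh.contDiffWithinAt z hz (mem_univ _)
  obtain ⟨h1, h2⟩ := contDiffOn_integral (ν := ν) convex_slab uniqueDiffOn_slab uniqueDiffOn_slab
    hhc A (B := B) (by fun_prop) hABm (fun n => hint.const_mul (C 0 n)) hbd
  simp only [hAB] at h1 h2
  refine TameOn.of_rapid (fun z hz _ => h1 z hz) fun k n =>
    ⟨‖A‖ ^ n * (C k n * ∫ η, (1 + ‖η‖) ^ (-(r : ℝ)) ∂ν), fun z hz _ => ?_⟩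
  refine (mul_le_mul_of_nonneg_left (h2 n z hz) (by positivity)).trans ?_
  have h3 : ∫ η, (1 + ‖z.2.1‖) ^ k *
      ‖iteratedFDerivWithin ℝ n h (Slab P (Q × Q')) (z.1, (z.2.1, η), z.2.2)‖ ∂ν ≤
      ∫ η, C k n * (1 + ‖η‖) ^ (-(r : ℝ)) ∂ν := by
    refine integral_mono_of_nonneg (Filter.Eventually.of_forall fun η => by positivity)
      (hint.const_mul (C k n)) (Filter.Eventually.of_forall fun η => ?_)
    have := hC k n z hz η
    rwa [hAB] at this
  rw [integral_const_mul, integral_const_mul] at h3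
  rw [mul_left_comm]
  exact mul_le_mul_of_nonneg_left h3 (pow_nonneg (norm_nonneg _) _)

theorem TameOn.integrable {ν : Measure Q'} [ν.IsAddHaarMeasure]
    {h : P × (Q × Q') × ℝ → F} (hh : TameOn (fun z => 1 + ‖z.2.1‖) univ h) {x : P} {ξ : Q}
    {t : ℝ} (ht : t ∈ Icc (0 : ℝ) 1) : Integrable (fun η => h (x, (ξ, η), t)) ν := by
  set r : ℕ := Module.finrank ℝ Q' + 1 with hr
  have hint : Integrable (fun η : Q' => (1 + ‖η‖) ^ (-(r : ℝ))) ν :=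
    integrable_one_add_norm (by rw [hr]; push_cast; linarith)
  obtain ⟨C, hC⟩ := hh.rapid r 0
  have hc : ContinuousOn h (Slab P (Q × Q')) := fun z hz =>
    (hh.contDiffWithinAt z hz (mem_univ _)).continuousWithinAt
  have hcη : Continuous fun η : Q' => h (x, (ξ, η), t) :=
    hc.comp_continuous (by fun_prop) fun η => ht
  refine (hint.const_mul C).mono' hcη.aestronglyMeasurable (Filter.Eventually.of_forall fun η => ?_)
  have h1 := hC (x, (ξ, η), t) ht (mem_univ _)
  rw [norm_iteratedFDerivWithin_zero] at h1
  rw [Real.rpow_neg (by positivity), Real.rpow_natCast, ← div_eq_mul_inv,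
    le_div_iff₀ (by positivity)]
  have h4 : ‖η‖ ≤ ‖(ξ, η)‖ := le_max_right _ _
  refine le_trans ?_ h1
  rw [mul_comm]
  gcongr

end Rapid

/-! ### The composable pairs of the tangent groupoid at `t = 0` -/

namespace LieGroupoid

variable {p q : ℕ} {G X : Type*}
  [TopologicalSpace G] [ChartedSpace (Euc (p + q)) G] [IsManifold (𝓡 (p + q)) ∞ G]
  [TopologicalSpace X] [ChartedSpace (Euc p) X] [IsManifold (𝓡 p) ∞ X]
  {𝒢 : LieGroupoid p q G X}
  {φ : OpenPartialHomeomorph G (Euc p × Euc q)} {ψ : OpenPartialHomeomorph X (Euc p)}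

theorem divMap_u (γ : G) : 𝒢.divMap γ (𝒢.u (𝒢.s γ)) = 𝒢.mkComp γ (𝒢.u (𝒢.s γ)) := by
  have h : 𝒢.mul (𝒢.mkComp γ (𝒢.u (𝒢.s γ))) = γ := by
    rw [𝒢.mkComp_of_eq (𝒢.r_u _).symm, 𝒢.mul_u]
  have h2 : (𝒢.mkComp γ (𝒢.u (𝒢.s γ))).snd = 𝒢.u (𝒢.s γ) := by
    rw [𝒢.mkComp_of_eq (𝒢.r_u _).symm]
  have := 𝒢.divMap_mul (𝒢.mkComp γ (𝒢.u (𝒢.s γ)))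
  rwa [h, h2] at this

/-- Together with `divMap_u` this computes division on the slices `d = b` and `d = 0` of
`compChart`; these two families of vectors span the normal directions. -/
theorem divMap_self (γ : G) : 𝒢.divMap γ γ = 𝒢.mkComp (𝒢.u (𝒢.r γ)) γ := by
  have h : 𝒢.mul (𝒢.mkComp (𝒢.u (𝒢.r γ)) γ) = γ := by
    rw [𝒢.mkComp_of_eq (𝒢.s_u _), 𝒢.u_mul]
  have h2 : (𝒢.mkComp (𝒢.u (𝒢.r γ)) γ).snd = γ := by
    rw [𝒢.mkComp_of_eq (𝒢.s_u _)]
  have := 𝒢.divMap_mul (𝒢.mkComp (𝒢.u (𝒢.r γ)) γ)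
  rwa [h, h2] at this

theorem compChart_symm_fst_zero (h : 𝒢.IsFibredChart φ ψ)
    (hφ : IsSliceChart (Euc (p + q)) 𝒢.u φ) {w : Euc p × Euc q} (hw : w ∈ φ.target)
    (hw0 : (w.1, (0 : Euc q)) ∈ φ.target) :
    ((compChart h).symm (w.1, w.2, 0)).fst = φ.symm w := by
  obtain ⟨v, hv⟩ := hφ.exists_eq hw0
  have h1 : 𝒢.s (φ.symm w) = v := by
    have := h.s_symm hw0
    rw [← hv, 𝒢.s_u] at this
    rw [h.s_symm hw, this]
  rw [compChart_symm_apply, ← hv, ← h1]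
  change (𝒢.divMap (φ.symm w) (𝒢.u (𝒢.s (φ.symm w)))).fst = _
  rw [divMap_u, 𝒢.mkComp_of_eq (𝒢.r_u _).symm]

theorem compChart_symm_fst_diag (h : 𝒢.IsFibredChart φ ψ) (w : Euc p × Euc q) :
    ((compChart h).symm (w.1, w.2, w.2)).fst = 𝒢.u (𝒢.r (φ.symm w)) := by
  rw [compChart_symm_apply]
  change (𝒢.divMap (φ.symm w) (φ.symm w)).fst = _
  rw [divMap_self, 𝒢.mkComp_of_eq (𝒢.s_u _)]

theorem compChart_symm_snd (h : 𝒢.IsFibredChart φ ψ) {y : Euc p × Euc q × Euc q}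
    (hy : y ∈ (compChart h).target) :
    ((compChart h).symm y).snd = φ.symm (y.1, y.2.2) := by
  rw [compChart_symm_apply, 𝒢.divMap_snd (s_symm_eq_s_symm h hy)]

theorem mfderiv_compChart_symm_snd (h : 𝒢.IsFibredChart φ ψ) {a : Euc p}
    (ha : (a, (0 : Euc q)) ∈ φ.target) (ξ η : Euc q) :
    (mfderiv 𝓘(ℝ, Euc p × Euc q × Euc q) (𝓡 (p + q)) (fun y => ((compChart h).symm y).snd)
      (a, (0 : Euc q × Euc q)) ((0, (ξ, η)) : Euc p × Euc q × Euc q) : Euc (p + q)) =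
    fibreDeriv φ (a, 0) η := by
  let j : Euc p × Euc q × Euc q →L[ℝ] Euc p × Euc q :=
    (ContinuousLinearMap.fst ℝ _ _).prod
      ((ContinuousLinearMap.snd ℝ _ _).comp (ContinuousLinearMap.snd ℝ _ _))
  have hd : MDifferentiableAt 𝓘(ℝ, Euc p × Euc q) (𝓡 (p + q)) φ.symm (j (a, 0)) :=
    (h.contMDiffOn_symm.contMDiffAt (φ.open_target.mem_nhds ha)).mdifferentiableAt (by simp)
  have he : (fun y => ((compChart h).symm y).snd) =ᶠ[𝓝 (a, (0 : Euc q × Euc q))] φ.symm ∘ j := by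
    filter_upwards [(compChart h).open_target.mem_nhds
      (show (a, (0 : Euc q × Euc q)) ∈ (compChart h).target from ⟨ha, ha⟩)] with y hy
    exact compChart_symm_snd h hy
  have h1 := mfderiv_comp (a, (0 : Euc q × Euc q)) hd j.mdifferentiableAt
  have h2 := congrArg (fun L : Euc p × Euc q × Euc q →L[ℝ] Euc (p + q) => L (0, (ξ, η)))
    (he.mfderiv_eq.trans h1)
  refine h2.trans ?_
  have h3 : mfderiv 𝓘(ℝ, Euc p × Euc q × Euc q) 𝓘(ℝ, Euc p × Euc q) j (a, (0 : Euc q × Euc q)) =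
      j := j.mfderiv_eq
  rw [h3]
  rfl

/-- Write `(ξ, η) = (ξ - η, 0) + (η, η)`. Along `(ζ, 0)` one divides by a unit and gets the
derivative of `φ⁻¹`; along the diagonal `δδ⁻¹` runs through the units and contributes only tangent
vectors. Division therefore becomes subtraction at `t = 0`. -/
theorem mfderiv_compChart_symm_fst (h : 𝒢.IsFibredChart φ ψ)
    (hφ : IsSliceChart (Euc (p + q)) 𝒢.u φ) {a : Euc p}
    (ha : (a, (0 : Euc q)) ∈ φ.target) {v : X} (hv : 𝒢.u v = φ.symm (a, 0))
    {L : Euc p × Euc q × Euc q →L[ℝ] Euc (p + q)}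
    (hL : L = mfderiv 𝓘(ℝ, Euc p × Euc q × Euc q) (𝓡 (p + q))
      (fun y => ((compChart h).symm y).fst) (a, (0 : Euc q × Euc q))) (ξ η : Euc q) :
    L (0, (ξ, η)) - (fibreDeriv φ (a, 0) ξ - fibreDeriv φ (a, 0) η) ∈
      LinearMap.range (mfderiv (𝓡 p) (𝓡 (p + q)) 𝒢.u v).toLinearMap := by
  let j₁ : Euc p × Euc q →L[ℝ] Euc p × Euc q × Euc q :=
    (ContinuousLinearMap.fst ℝ _ _).prod ((ContinuousLinearMap.snd ℝ _ _).prod 0)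
  let j₂ : Euc p × Euc q →L[ℝ] Euc p × Euc q × Euc q :=
    (ContinuousLinearMap.fst ℝ _ _).prod
      ((ContinuousLinearMap.snd ℝ _ _).prod (ContinuousLinearMap.snd ℝ _ _))
  have hat : (a, (0 : Euc q × Euc q)) ∈ (compChart h).target := ⟨ha, ha⟩
  have hdφ : MDifferentiableAt 𝓘(ℝ, Euc p × Euc q) (𝓡 (p + q)) φ.symm (a, 0) :=
    (h.contMDiffOn_symm.contMDiffAt (φ.open_target.mem_nhds ha)).mdifferentiableAt (by simp)
  have hd : MDifferentiableAt 𝓘(ℝ, Euc p × Euc q × Euc q) (𝓡 (p + q))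
      (fun y => ((compChart h).symm y).fst) (a, (0 : Euc q × Euc q)) :=
    ((𝒢.contMDiff_fst _).mdifferentiableAt (by simp)).comp _
      (((isSliceChart_compChart h hφ).contMDiffOn_symm.contMDiffAt
        ((compChart h).open_target.mem_nhds hat)).mdifferentiableAt (by simp))
  have e₁ : (fun y => ((compChart h).symm y).fst) ∘ j₁ =ᶠ[𝓝 (a, (0 : Euc q))] φ.symm := by
    have hc : Continuous fun w : Euc p × Euc q => (w.1, (0 : Euc q)) := by fun_prop
    filter_upwards [φ.open_target.mem_nhds ha, (φ.open_target.preimage hc).mem_nhds ha]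
      with w hw hw0
    exact compChart_symm_fst_zero h hφ hw hw0
  have e₂ : (fun y => ((compChart h).symm y).fst) ∘ j₂ = fun w => 𝒢.u (𝒢.r (φ.symm w)) := by
    funext w
    exact compChart_symm_fst_diag h w
  have hr : 𝒢.r (φ.symm (a, 0)) = v := by rw [← hv, 𝒢.r_u]
  have hdr : MDifferentiableAt 𝓘(ℝ, Euc p × Euc q) (𝓡 p) (fun w => 𝒢.r (φ.symm w)) (a, 0) :=
    ((𝒢.contMDiff_r _).mdifferentiableAt (by simp)).comp _ hdφ
  have c₁ := mfderiv_comp (I := 𝓘(ℝ, Euc p × Euc q)) (a, (0 : Euc q)) (f := j₁) hd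
    j₁.mdifferentiableAt
  have c₂ := mfderiv_comp (I := 𝓘(ℝ, Euc p × Euc q)) (a, (0 : Euc q)) (f := j₂) hd
    j₂.mdifferentiableAt
  have c₃ := mfderiv_comp (a, (0 : Euc q)) (f := fun w => 𝒢.r (φ.symm w))
    ((𝒢.contMDiff_u _).mdifferentiableAt (by simp)) hdr
  have hj₁ : mfderiv 𝓘(ℝ, Euc p × Euc q) 𝓘(ℝ, Euc p × Euc q × Euc q) j₁ (a, (0 : Euc q)) = j₁ :=
    j₁.mfderiv_eq
  have hj₂ : mfderiv 𝓘(ℝ, Euc p × Euc q) 𝓘(ℝ, Euc p × Euc q × Euc q) j₂ (a, (0 : Euc q)) = j₂ :=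
    j₂.mfderiv_eq
  set D : Euc p × Euc q →L[ℝ] Euc (p + q) :=
    mfderiv 𝓘(ℝ, Euc p × Euc q) (𝓡 (p + q)) φ.symm (a, 0) with hD
  have k₁ : ∀ ζ : Euc q, L (0, (ζ, 0)) = D (0, ζ) := fun ζ => by
    have := congrArg (fun L : Euc p × Euc q →L[ℝ] Euc (p + q) => L (0, ζ))
      (c₁.symm.trans e₁.mfderiv_eq)
    refine Eq.trans ?_ this
    rw [hj₁, hL]
    rfl
  have k₂ : L (0, (η, η)) ∈ LinearMap.range (mfderiv (𝓡 p) (𝓡 (p + q)) 𝒢.u v).toLinearMap := by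
    subst hr
    refine ⟨mfderiv 𝓘(ℝ, Euc p × Euc q) (𝓡 p) (fun w => 𝒢.r (φ.symm w)) (a, 0)
      ((0, η) : Euc p × Euc q), ?_⟩
    have e₃ : (mfderiv 𝓘(ℝ, Euc p × Euc q) (𝓡 (p + q)) (𝒢.u ∘ fun w => 𝒢.r (φ.symm w))
        (a, (0 : Euc q)) : Euc p × Euc q →L[ℝ] Euc (p + q)) =
        mfderiv 𝓘(ℝ, Euc p × Euc q) (𝓡 (p + q)) ((fun y => ((compChart h).symm y).fst) ∘ j₂)
          (a, (0 : Euc q)) := by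
      rw [e₂]; rfl
    have := congrArg (fun L : Euc p × Euc q →L[ℝ] Euc (p + q) => L (0, η))
      (c₃.symm.trans (e₃.trans c₂))
    refine Eq.trans this ?_
    rw [hj₂, hL]
    rfl
  have k₃ : L (0, (ξ, η)) - (D (0, ξ) - D (0, η)) = L (0, (η, η)) := by
    rw [← k₁, ← k₁, ← map_sub, ← map_sub]
    congr 1
    simp
  exact k₃ ▸ k₂

/-- A function on the composable pairs of the tangent groupoid read in the chart `compChart` at
`t = 0`. -/
theorem localRep_compChart_zero (F : 𝒢.TangentComp → ℂ) (h : 𝒢.IsFibredChart φ ψ)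
    (hφ : IsSliceChart (Euc (p + q)) 𝒢.u φ) {a : Euc p}
    (ha : (a, (0 : Euc q)) ∈ φ.target) {v : X} (hv : 𝒢.u v = φ.symm (a, 0)) (ξ η : Euc q) :
    localRep (F ∘ 𝒢.compIdent) (compChart h) (a, (ξ, η), 0) =
      F (TangentComp.zero 𝒢 v
        ((Submodule.Quotient.mk (fibreDeriv φ (a, 0) ξ) :
            NormalSpace (Euc p) (Euc (p + q)) 𝒢.u v) -
          (Submodule.Quotient.mk (fibreDeriv φ (a, 0) η) :
            NormalSpace (Euc p) (Euc (p + q)) 𝒢.u v))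
        (Submodule.Quotient.mk (fibreDeriv φ (a, 0) η) :
          NormalSpace (Euc p) (Euc (p + q)) 𝒢.u v)) := by
  have hat : (a, (0 : Euc q × Euc q)) ∈ (compChart h).target := ⟨ha, ha⟩
  have hv₂ : 𝒢.u₂ v = (compChart h).symm (a, 0) := by
    rw [compChart_symm_apply]
    change _ = 𝒢.divMap (φ.symm (a, 0)) (φ.symm (a, 0))
    rw [← hv, ← 𝒢.divMap_mul (𝒢.u₂ v), 𝒢.mul_u₂]
    rfl
  have hds : MDifferentiableAt 𝓘(ℝ, Euc p × Euc q × Euc q) 𝓘(ℝ, Euc (p + q) × Euc q)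
      (compChart h).symm (a, (0 : Euc q × Euc q)) :=
    ((isSliceChart_compChart h hφ).contMDiffOn_symm.contMDiffAt
        ((compChart h).open_target.mem_nhds hat)).mdifferentiableAt (by simp)
  have c₁ := mfderiv_comp (a, (0 : Euc q × Euc q))
    ((𝒢.contMDiff_fst _).mdifferentiableAt (by simp)) hds
  have c₂ := mfderiv_comp (a, (0 : Euc q × Euc q))
    ((𝒢.contMDiff_snd _).mdifferentiableAt (by simp)) hds
  refine (localRep_of_zero 𝒢.u₂_injective _ _ _ hv₂).trans ?_
  refine congrArg F ?_
  simp only [compIdent]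
  have k₁ := mfderiv_compChart_symm_fst h hφ ha hv rfl ξ η
  have k₂ := mfderiv_compChart_symm_snd h ha ξ η
  have q₁ := congrArg (fun L : Euc p × Euc q × Euc q →L[ℝ] Euc (p + q) => L (0, (ξ, η))) c₁
  have q₂ := congrArg (fun L : Euc p × Euc q × Euc q →L[ℝ] Euc (p + q) => L (0, (ξ, η))) c₂
  have w₁ := (Submodule.Quotient.eq _).2 k₁
  rw [← hv₂] at q₁ q₂
  congr 1
  · refine Eq.trans ?_ w₁
    exact congrArg (Submodule.Quotient.mk (p := LinearMap.range
      (mfderiv (𝓡 p) (𝓡 (p + q)) 𝒢.u v).toLinearMap)) q₁.symm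
  · exact congrArg (Submodule.Quotient.mk (p := LinearMap.range
      (mfderiv (𝓡 p) (𝓡 (p + q)) 𝒢.u v).toLinearMap)) (q₂.symm.trans k₂)

end LieGroupoid

/-! ### Integration in fibred charts -/

namespace LieGroupoid

variable {p q : ℕ} {G X : Type*}
  [TopologicalSpace G] [ChartedSpace (Euc (p + q)) G] [IsManifold (𝓡 (p + q)) ∞ G]
  [TopologicalSpace X] [ChartedSpace (Euc p) X] [IsManifold (𝓡 p) ∞ X]
  {𝒢 : LieGroupoid p q G X}
  {φ : OpenPartialHomeomorph G (Euc p × Euc q)} {ψ : OpenPartialHomeomorph X (Euc p)}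

theorem isClosed_fibre [T2Space G] (𝒢 : LieGroupoid p q G X) (x : X) :
    IsClosed {γ : G | 𝒢.s γ = x} := by
  have := 𝒢.t2Space_base
  exact isClosed_eq 𝒢.contMDiff_s.continuous continuous_const

/-- `b ↦ d(φ⁻¹)_w (0, b)` as a continuous linear map. -/
def fibreDerivCLM (φ : OpenPartialHomeomorph G (Euc p × Euc q)) (w : Euc p × Euc q) :
    Euc q →L[ℝ] Euc (p + q) :=
  (mfderiv 𝓘(ℝ, Euc p × Euc q) (𝓡 (p + q)) φ.symm w : Euc p × Euc q →L[ℝ] Euc (p + q)).comp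
    (ContinuousLinearMap.inr ℝ (Euc p) (Euc q))

theorem IsFibredChart.mfderiv_mfderiv_symm (h : 𝒢.IsFibredChart φ ψ) {w : Euc p × Euc q}
    (hw : w ∈ φ.target) (v : Euc p × Euc q) :
    (mfderiv (𝓡 (p + q)) 𝓘(ℝ, Euc p × Euc q) φ (φ.symm w)
      (mfderiv 𝓘(ℝ, Euc p × Euc q) (𝓡 (p + q)) φ.symm w v : Euc (p + q)) :
        Euc p × Euc q) = v := by
  have hd : MDifferentiableAt 𝓘(ℝ, Euc p × Euc q) (𝓡 (p + q)) φ.symm w :=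
    (h.contMDiffOn_symm.contMDiffAt (φ.open_target.mem_nhds hw)).mdifferentiableAt (by simp)
  have hd' : MDifferentiableAt (𝓡 (p + q)) 𝓘(ℝ, Euc p × Euc q) φ (φ.symm w) :=
    (h.contMDiffOn.contMDiffAt
      (φ.open_source.mem_nhds (φ.map_target hw))).mdifferentiableAt (by simp)
  have hc := mfderiv_comp w hd' hd
  have he : φ ∘ φ.symm =ᶠ[𝓝 w] id := by
    filter_upwards [φ.open_target.mem_nhds hw] with w hw
    exact φ.right_inv hw
  exact congrArg (fun L : Euc p × Euc q →L[ℝ] Euc p × Euc q => L v)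
    (hc.symm.trans (he.mfderiv_eq.trans mfderiv_id))

theorem IsFibredChart.mfderiv_symm_mfderiv (h : 𝒢.IsFibredChart φ ψ) {γ : G}
    (hγ : γ ∈ φ.source) (v : Euc (p + q)) :
    (mfderiv 𝓘(ℝ, Euc p × Euc q) (𝓡 (p + q)) φ.symm (φ γ)
      (mfderiv (𝓡 (p + q)) 𝓘(ℝ, Euc p × Euc q) φ γ v : Euc p × Euc q) : Euc (p + q)) = v := by
  have hd : MDifferentiableAt 𝓘(ℝ, Euc p × Euc q) (𝓡 (p + q)) φ.symm (φ γ) :=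
    (h.contMDiffOn_symm.contMDiffAt (φ.open_target.mem_nhds (φ.map_source hγ))).mdifferentiableAt
      (by simp)
  have hd' : MDifferentiableAt (𝓡 (p + q)) 𝓘(ℝ, Euc p × Euc q) φ γ :=
    (h.contMDiffOn.contMDiffAt (φ.open_source.mem_nhds hγ)).mdifferentiableAt (by simp)
  have hc := mfderiv_comp γ hd hd'
  have he : φ.symm ∘ φ =ᶠ[𝓝 γ] id := by
    filter_upwards [φ.open_source.mem_nhds hγ] with w hw
    exact φ.left_inv hw
  exact congrArg (fun L : Euc (p + q) →L[ℝ] Euc (p + q) => L v)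
    (hc.symm.trans (he.mfderiv_eq.trans mfderiv_id))

theorem IsFibredChart.fibreDeriv_injective (h : 𝒢.IsFibredChart φ ψ) {γ : G}
    (hγ : γ ∈ φ.source) : Function.Injective (fibreDerivCLM φ (φ γ)) := by
  intro b c hbc
  have h1 := h.mfderiv_mfderiv_symm (φ.map_source hγ) (0, b)
  have h2 := h.mfderiv_mfderiv_symm (φ.map_source hγ) (0, c)
  have h3 : (mfderiv 𝓘(ℝ, Euc p × Euc q) (𝓡 (p + q)) φ.symm (φ γ) ((0, b) : Euc p × Euc q) :
      Euc (p + q)) = mfderiv 𝓘(ℝ, Euc p × Euc q) (𝓡 (p + q)) φ.symm (φ γ)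
        ((0, c) : Euc p × Euc q) := hbc
  rw [h3] at h1
  exact congrArg Prod.snd (h1.symm.trans h2)

/-- In slice coordinates a vector splits into a part along the slice, which is tangent to the units,
and a part along the fibre of `s`; only the latter matters in the quotient. -/
theorem exists_mk_fibreDeriv (h : 𝒢.IsFibredChart φ ψ) (hφ : IsSliceChart (Euc (p + q)) 𝒢.u φ)
    {x : X} (hx : 𝒢.u x ∈ φ.source) (ξ : NormalSpace (Euc p) (Euc (p + q)) 𝒢.u x) :
    ∃ b : Euc q, ξ = Submodule.Quotient.mk (fibreDeriv φ (φ (𝒢.u x)) b) := by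
  obtain ⟨v, rfl⟩ := Submodule.Quotient.mk_surjective _ ξ
  set w : Euc p × Euc q := mfderiv (𝓡 (p + q)) 𝓘(ℝ, Euc p × Euc q) φ (𝒢.u x) v with hw
  have hv := h.mfderiv_symm_mfderiv hx v
  refine ⟨w.2, (Submodule.Quotient.eq _).2 ?_⟩
  have ht : ((φ (𝒢.u x)).1, (0 : Euc q)) ∈ φ.target := by
    rw [← hφ.apply_eq hx]; exact φ.map_source hx
  have hxv : 𝒢.u x = φ.symm ((φ (𝒢.u x)).1, 0) := by
    rw [← hφ.apply_eq hx, φ.left_inv hx]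
  have h1 := hφ.mfderiv_symm_mem_range 𝒢.contMDiff_u 𝒢.contMDiff_s 𝒢.s_u ht hxv w.1
  rw [← hφ.apply_eq hx] at h1
  let D : Euc p × Euc q →L[ℝ] Euc (p + q) :=
    mfderiv 𝓘(ℝ, Euc p × Euc q) (𝓡 (p + q)) φ.symm (φ (𝒢.u x))
  let v' : Euc (p + q) := v
  have h2 : v' - D (0, w.2) = D (w.1, 0) := by
    have h3 : D w = v' := hv
    rw [← h3, ← map_sub]
    congr 1
    refine Prod.ext ?_ ?_ <;> simp
  have h3 : D (w.1, 0) ∈ LinearMap.range (mfderiv (𝓡 p) (𝓡 (p + q)) 𝒢.u x).toLinearMap := h1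
  rw [← h2] at h3
  exact h3

variable [T2Space G] [SecondCountableTopology G] [MeasurableSpace G] [BorelSpace G]

theorem measurableEmbedding_fibre (𝒢 : LieGroupoid p q G X) (x : X) :
    MeasurableEmbedding (Subtype.val : 𝒢.Fibre x → G) :=
  MeasurableEmbedding.subtype_coe (𝒢.isClosed_fibre x).measurableSet

variable {ρ : Euc p × Euc q → ℝ} {x : X} (μ : 𝒢.HaarSystem)

theorem isOpen_fibre_target (φ : OpenPartialHomeomorph G (Euc p × Euc q)) (a : Euc p) :
    IsOpen {b : Euc q | (a, b) ∈ φ.target} :=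
  φ.open_target.preimage (by fun_prop : Continuous fun b : Euc q => (a, b))

theorem aemeasurable_symm_fibre (φ : OpenPartialHomeomorph G (Euc p × Euc q)) (a : Euc p) :
    AEMeasurable (fun b : Euc q => φ.symm (a, b))
      (volume.restrict {b : Euc q | (a, b) ∈ φ.target}) :=
  (φ.continuousOn_symm.comp (s := {b : Euc q | (a, b) ∈ φ.target}) (by fun_prop) fun b hb => hb).aemeasurable
    (isOpen_fibre_target φ a).measurableSet

theorem aemeasurable_density (hρ : ContDiffOn ℝ ∞ ρ φ.target) (a : Euc p) :
    AEMeasurable (fun b : Euc q => ENNReal.ofReal (ρ (a, b)))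
      (volume.restrict {b : Euc q | (a, b) ∈ φ.target}) :=
  ((hρ.continuousOn.comp (s := {b : Euc q | (a, b) ∈ φ.target}) (by fun_prop) fun b hb => hb).aemeasurable
    (isOpen_fibre_target φ a).measurableSet).ennreal_ofReal

/-- Integrals along the fibres of the source map in a fibred chart. -/
theorem HaarSystem.integral_fibre (hρ : ContDiffOn ℝ ∞ ρ φ.target)
    (hρ0 : ∀ w ∈ φ.target, 0 < ρ w)
    (hμ : ((μ.fibre x).map Subtype.val).restrict φ.source =
        ((volume.restrict {b | (ψ x, b) ∈ φ.target}).withDensity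
          fun b => ENNReal.ofReal (ρ (ψ x, b))).map fun b => φ.symm (ψ x, b))
    {f : G → ℂ} (hf : Continuous fun δ : 𝒢.Fibre x => f δ.1)
    (hf0 : ∀ δ : 𝒢.Fibre x, δ.1 ∉ φ.source → f δ.1 = 0) :
    ∫ δ, f δ.1 ∂μ.fibre x =
      ∫ b in {b | (ψ x, b) ∈ φ.target}, ρ (ψ x, b) • f (φ.symm (ψ x, b)) := by
  have hemb := 𝒢.measurableEmbedding_fibre x
  have hB := isOpen_fibre_target φ (ψ x)
  have hm := aemeasurable_symm_fibre φ (ψ x)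
  have hmeas : AEStronglyMeasurable f ((μ.fibre x).map Subtype.val) :=
    hemb.aestronglyMeasurable_map_iff.2 hf.aestronglyMeasurable
  rw [← hemb.integral_map]
  have h1 : ∫ δ in φ.source, f δ ∂(μ.fibre x).map Subtype.val =
      ∫ δ, f δ ∂(μ.fibre x).map Subtype.val := by
    refine setIntegral_eq_integral_of_ae_compl_eq_zero ?_
    rw [hemb.ae_map_iff]
    exact Filter.Eventually.of_forall hf0
  have hm' : AEStronglyMeasurable f (((volume.restrict {b | (ψ x, b) ∈ φ.target}).withDensity
          fun b => ENNReal.ofReal (ρ (ψ x, b))).map fun b => φ.symm (ψ x, b)) := by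
    rw [← hμ]; exact hmeas.restrict
  rw [← h1, hμ, integral_map (hm.mono_ac (withDensity_absolutelyContinuous _ _)) hm',
    integral_withDensity_eq_integral_toReal_smul₀ (aemeasurable_density hρ _)
      (Filter.Eventually.of_forall fun b => ENNReal.ofReal_lt_top)]
  refine setIntegral_congr_fun hB.measurableSet fun b hb => ?_
  simp only [ENNReal.toReal_ofReal (hρ0 _ hb).le]

/-- In a fibred chart the density is bounded on a closed ball, which has finite volume. Local
finiteness makes continuous functions of compact support integrable and permits Fubini. -/
theorem HaarSystem.isLocallyFiniteMeasure_fibre (x : X) :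
    IsLocallyFiniteMeasure (μ.fibre x) := by
  refine ⟨fun γ => ?_⟩
  obtain ⟨φ, ψ, h, hγ⟩ := 𝒢.exists_isFibredChart γ.1
  obtain ⟨ρ, hρ, hρ0, hμ, -⟩ := μ.smooth_density φ ψ h
  have hxs : x ∈ ψ.source := by
    have := h.mapsTo hγ
    rwa [γ.2] at this
  have hμ := hμ x hxs
  have hB := isOpen_fibre_target φ (ψ x)
  have hγt : (φ γ.1).2 ∈ {b : Euc q | (ψ x, b) ∈ φ.target} := by
    have := h.apply_eq hγ
    rw [γ.2] at this
    rw [mem_ofPred_eq, ← this]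
    exact φ.map_source hγ
  obtain ⟨r, hr, hrB⟩ := Metric.nhds_basis_closedBall.mem_iff.1 (hB.mem_nhds hγt)
  have hcont : ContinuousOn (fun b => ρ (ψ x, b)) (Metric.closedBall (φ γ.1).2 r) :=
    hρ.continuousOn.comp (by fun_prop) hrB
  obtain ⟨C, hC⟩ := (isCompact_closedBall _ _).exists_bound_of_continuousOn hcont
  set N : Set G := φ.source ∩ φ ⁻¹' (univ ×ˢ Metric.ball (φ γ.1).2 r) with hN
  have hNo : IsOpen N := φ.isOpen_inter_preimage (isOpen_univ.prod Metric.isOpen_ball)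
  have hemb := 𝒢.measurableEmbedding_fibre x
  refine ⟨Subtype.val ⁻¹' N, (hNo.preimage continuous_subtype_val).mem_nhds
    ⟨hγ, mem_univ _, Metric.mem_ball_self hr⟩, ?_⟩
  have hNs : N ∩ φ.source = N := inter_eq_self_of_subset_left inter_subset_left
  rw [← hemb.map_apply, ← hNs, ← Measure.restrict_apply hNo.measurableSet, hμ,
    Measure.map_apply_of_aemeasurable
      ((aemeasurable_symm_fibre φ (ψ x)).mono_ac (withDensity_absolutelyContinuous _ _))
      hNo.measurableSet]
  set μ' := volume.restrict {b | (ψ x, b) ∈ φ.target} with hμ'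
  have hsub : ∀ᵐ b ∂μ', b ∈ (fun b => φ.symm (ψ x, b)) ⁻¹' N →
      b ∈ Metric.closedBall (φ γ.1).2 r := by
    filter_upwards [ae_restrict_mem hB.measurableSet] with b hb hbN
    have := hbN.2.2
    rw [φ.right_inv hb] at this
    exact Metric.ball_subset_closedBall this
  calc _ ≤ (μ'.withDensity fun b => ENNReal.ofReal (ρ (ψ x, b)))
        (Metric.closedBall (φ γ.1).2 r) :=
        measure_mono_ae (withDensity_absolutelyContinuous _ _ |>.ae_le hsub)
    _ = ∫⁻ b in Metric.closedBall (φ γ.1).2 r, ENNReal.ofReal (ρ (ψ x, b)) ∂μ' :=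
        withDensity_apply _ Metric.isClosed_closedBall.measurableSet
    _ ≤ ∫⁻ b in Metric.closedBall (φ γ.1).2 r, ENNReal.ofReal C ∂μ' :=
        setLIntegral_mono' Metric.isClosed_closedBall.measurableSet fun b hb =>
          ENNReal.ofReal_le_ofReal ((le_abs_self _).trans (hC b hb))
    _ = ENNReal.ofReal C * μ' (Metric.closedBall (φ γ.1).2 r) := setLIntegral_const _ _
    _ < ⊤ := ENNReal.mul_lt_top ENNReal.ofReal_lt_top
        ((Measure.restrict_apply_le _ _).trans_lt measure_closedBall_lt_top)

theorem measurableEmbedding_fibreDeriv (h : 𝒢.IsFibredChart φ ψ) {γ : G} (hγ : γ ∈ φ.source) :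
    MeasurableEmbedding (fibreDeriv φ (φ γ)) :=
  (LinearMap.isClosedEmbedding_of_injective (f := (fibreDerivCLM φ (φ γ)).toLinearMap)
    (LinearMap.ker_eq_bot.2 (h.fibreDeriv_injective hγ))).measurableEmbedding

theorem measurableEmbedding_fibreTangent (𝒢 : LieGroupoid p q G X) (x : X) :
    MeasurableEmbedding (Subtype.val : 𝒢.FibreTangent x → Euc (p + q)) :=
  MeasurableEmbedding.subtype_coe (𝒢.FibreTangent x).closed_of_finiteDimensional.measurableSet

theorem HaarSystem.integrable_tangent (h : 𝒢.IsFibredChart φ ψ) (hx : 𝒢.u x ∈ φ.source)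
    {c : ENNReal} (hc : c ≠ ⊤) (hμ : (μ.tangent x).map Subtype.val =
        c • (volume : Measure (Euc q)).map (fibreDeriv φ (φ (𝒢.u x))))
    {g : Euc (p + q) → ℂ} (hg : Integrable fun b => g (fibreDeriv φ (φ (𝒢.u x)) b)) :
    Integrable (fun η : 𝒢.FibreTangent x => g η.1) (μ.tangent x) := by
  have h1 := (𝒢.measurableEmbedding_fibreTangent x).integrable_map_iff (μ := μ.tangent x) (g := g)
  refine h1.1 ?_
  rw [hμ]
  exact ((measurableEmbedding_fibreDeriv h hx).integrable_map_iff.2 hg).smul_measure hc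

theorem HaarSystem.integral_tangent (h : 𝒢.IsFibredChart φ ψ) (hx : 𝒢.u x ∈ φ.source)
    {c : ENNReal} (hμ : (μ.tangent x).map Subtype.val =
        c • (volume : Measure (Euc q)).map (fibreDeriv φ (φ (𝒢.u x)))) (g : Euc (p + q) → ℂ) :
    ∫ η, g η.1 ∂μ.tangent x = c.toReal • ∫ b, g (fibreDeriv φ (φ (𝒢.u x)) b) := by
  rw [← (𝒢.measurableEmbedding_fibreTangent x).integral_map, hμ, integral_smul_measure,
    (measurableEmbedding_fibreDeriv h hx).integral_map]

end LieGroupoid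

/-! ### Integration over the fibres: smoothness for positive parameters -/

theorem IsSrc.continuous_pos {P E Q : Type*} [NormedAddCommGroup P] [NormedSpace ℝ P]
    [NormedAddCommGroup E] [NormedSpace ℝ E] [NormedAddCommGroup Q] [NormedSpace ℝ Q]
    {X M : Type*} [TopologicalSpace X] [ChartedSpace P X] [TopologicalSpace M]
    [ChartedSpace E M] {ι : X → M} {g : DNC P E ι → ℂ} (hg : IsSrc Q g) (t : Ioc (0 : ℝ) 1) :
    Continuous fun m => g (.pos m t) := by
  have h := hg.contMDiffOn_pos.continuousOn.comp_continuous (f := fun m : M => (m, (t : ℝ)))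
    (by fun_prop) fun m => ⟨mem_univ _, t.2⟩
  exact h.congr fun m => posPart_of_pos g m t.2

namespace LieGroupoid

variable {p q : ℕ} {G X : Type*}
  [TopologicalSpace G] [ChartedSpace (Euc (p + q)) G] [IsManifold (𝓡 (p + q)) ∞ G]
  [TopologicalSpace X] [ChartedSpace (Euc p) X] [IsManifold (𝓡 p) ∞ X]
  {𝒢 : LieGroupoid p q G X}
  {φ : OpenPartialHomeomorph G (Euc p × Euc q)} {ψ : OpenPartialHomeomorph X (Euc p)}

theorem continuous_divPair (γ : G) : Continuous (𝒢.divPair γ) := by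
  have h1 : Continuous fun δ : 𝒢.Fibre (𝒢.s γ) =>
      (⟨γ, 𝒢.inv δ.1, δ.2.symm.trans (𝒢.r_inv δ.1).symm⟩ : 𝒢.Comp) :=
    𝒢.isEmbedding_val.isInducing.continuous_iff.2
      (continuous_const.prodMk (𝒢.contMDiff_inv.continuous.comp continuous_subtype_val))
  exact 𝒢.isEmbedding_val.isInducing.continuous_iff.2
    ((𝒢.contMDiff_mul.continuous.comp h1).prodMk continuous_subtype_val)

variable [T2Space G] [SecondCountableTopology G] [MeasurableSpace G] [BorelSpace G]
  (μ : 𝒢.HaarSystem)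

/-- Only `δ`, the variable of integration, has to stay in a compact set; the closed fibre meets it
in a compact set. -/
theorem HaarSystem.integrable_divPair {e : 𝒢.Comp → ℂ} (he : Continuous e) {C : Set G}
    (hC : IsCompact C) (heC : ∀ c : 𝒢.Comp, c.snd ∉ C → e c = 0) (γ : G) :
    Integrable (fun δ => e (𝒢.divPair γ δ)) (μ.fibre (𝒢.s γ)) := by
  have := μ.isLocallyFiniteMeasure_fibre (𝒢.s γ)
  refine (he.comp (continuous_divPair γ)).integrable_of_hasCompactSupport
    (HasCompactSupport.intro ((𝒢.isClosed_fibre _).isClosedEmbedding_subtypeVal.isCompact_preimage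
      hC) fun δ hδ => heC _ hδ)

/-- Smooth dependence on parameters of an integral over the fibres, for an integrand that is
supported in a fibred chart. -/
theorem HaarSystem.contMDiffOn_integral_divMap (h : 𝒢.IsFibredChart φ ψ) {e : 𝒢.Comp × ℝ → ℂ}
    (he : ContMDiffOn (𝓘(ℝ, Euc (p + q) × Euc q).prod 𝓘(ℝ, ℝ)) 𝓘(ℝ, ℂ) ∞ e
      (univ ×ˢ Ioc (0 : ℝ) 1)) {L : Set G} (hL : IsCompact L) (hLφ : L ⊆ φ.source)
    (heL : ∀ c t, c.snd ∉ L → e (c, t) = 0) :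
    ContMDiffOn ((𝓡 (p + q)).prod 𝓘(ℝ, ℝ)) 𝓘(ℝ, ℂ) ∞
      (fun z : G × ℝ => ∫ δ, e (𝒢.divPair z.1 δ, z.2) ∂μ.fibre (𝒢.s z.1))
      (univ ×ˢ Ioc (0 : ℝ) 1) := by
  have := 𝒢.t2Space_base
  rintro ⟨γ₀, t₀⟩ ⟨-, ht₀⟩
  have hs := 𝒢.contMDiff_s
  -- If the fibre over `s γ₀` misses `L`, so do all nearby fibres and the integral vanishes.
  -- Otherwise `s γ₀` lies in the domain of `ψ`.
  by_cases hsL : 𝒢.s γ₀ ∈ 𝒢.s '' L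
  swap
  · have hcl : IsClosed (𝒢.s '' L) := (hL.image hs.continuous).isClosed
    have hev : (fun z : G × ℝ => ∫ δ, e (𝒢.divPair z.1 δ, z.2) ∂μ.fibre (𝒢.s z.1)) =ᶠ[𝓝 (γ₀, t₀)]
        fun _ => 0 := by
      filter_upwards [(hcl.isOpen_compl.preimage (hs.continuous.comp continuous_fst)).mem_nhds
        (show (γ₀, t₀) ∈ _ from hsL)] with z hz
      refine integral_eq_zero_of_ae (Filter.Eventually.of_forall fun δ => heL _ _ fun hδ => hz ?_)
      exact ⟨δ.1, hδ, δ.2⟩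
    exact (contMDiffAt_const.congr_of_eventuallyEq hev).contMDiffWithinAt
  obtain ⟨ρ, hρ, hρ0, hμ, -⟩ := μ.smooth_density φ ψ h
  set χ := chartAt (Euc (p + q)) γ₀ with hχ
  set N : Set G := 𝒢.s ⁻¹' ψ.source with hN
  have hNo : IsOpen N := ψ.open_source.preimage hs.continuous
  have hγN : γ₀ ∈ N := by
    obtain ⟨δ, hδ, hδs⟩ := hsL
    rw [hN, mem_preimage, ← hδs]
    exact h.mapsTo (hLφ hδ)
  have hφL : IsCompact (φ '' L) := hL.image_of_continuousOn (φ.continuousOn.mono hLφ)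
  set a : Euc (p + q) → Euc p := fun y => ψ (𝒢.s (χ.symm y)) with ha
  set O : Set (Euc (p + q)) := χ.target ∩ χ.symm ⁻¹' N with hO
  have hOo : IsOpen O := χ.isOpen_inter_preimage_symm hNo
  have hy₀ : χ γ₀ ∈ O := ⟨mem_chart_target _ γ₀, by
    rw [mem_preimage, χ.left_inv (mem_chart_source _ γ₀)]; exact hγN⟩
  have hχs : ContMDiffOn 𝓘(ℝ, Euc (p + q)) (𝓡 (p + q)) ∞ χ.symm χ.target := contMDiffOn_chart_symm
  have haO : ContDiffOn ℝ ∞ a O := by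
    rw [← contMDiffOn_iff_contDiffOn]
    exact h.contMDiffOn_base.comp (hs.comp_contMDiffOn (hχs.mono inter_subset_left))
      fun y hy => hy.2
  obtain ⟨r, hr, hrO⟩ := Metric.isOpen_iff.1 hOo _ hy₀
  -- The integrand with its density in coordinates, extended by zero. The extension is smooth over
  -- `O` because the support lies over the compact set `φ '' L`.
  set J : (Euc (p + q) × ℝ) × Euc q → ℂ :=
    {z | (a z.1.1, z.2) ∈ φ.target}.indicator fun z =>
      ρ (a z.1.1, z.2) • e (𝒢.divMap (χ.symm z.1.1) (φ.symm (a z.1.1, z.2)), z.1.2) with hJ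
  -- A compact interval inside `(0, 1]`, so that derivative bounds are uniform in `t`.
  set I₀ : Set ℝ := Icc (t₀ / 2) 1 with hI₀
  have hI₀s : I₀ ⊆ Ioc (0 : ℝ) 1 := fun t ht => ⟨by linarith [ht₀.1, ht.1], ht.2⟩
  have ht₀2 : t₀ / 2 < 1 := by linarith [ht₀.1, ht₀.2]
  set S' : Set ((Euc (p + q) × ℝ) × Euc q) := (Metric.ball (χ γ₀) r ×ˢ I₀) ×ˢ univ with hS'
  have hsdiv : ∀ y ∈ O, ∀ b, (a y, b) ∈ φ.target → 𝒢.s (φ.symm (a y, b)) = 𝒢.s (χ.symm y) :=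
    fun y hy b hb => by rw [h.s_symm hb, ha, ψ.left_inv hy.2]
  have hJ0 : ∀ z : (Euc (p + q) × ℝ) × Euc q, z.1.1 ∈ O → (a z.1.1, z.2) ∉ φ '' L → J z = 0 := by
    intro z hz hn
    by_cases hm : (a z.1.1, z.2) ∈ φ.target
    · rw [hJ, indicator_of_mem (by exact hm)]
      rw [heL _ _ fun hmL => hn ?_, smul_zero]
      rw [𝒢.divMap_snd (hsdiv _ hz _ hm)] at hmL
      exact ⟨_, hmL, φ.right_inv hm⟩
    · exact indicator_of_notMem (by exact hm) _
  have hac : ContinuousOn (fun z : (Euc (p + q) × ℝ) × Euc q => (a z.1.1, z.2))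
      {z | z.1.1 ∈ O} :=
    (haO.continuousOn.comp (f := fun z : (Euc (p + q) × ℝ) × Euc q => z.1.1)
      (s := {z | z.1.1 ∈ O}) (by fun_prop) fun z hz => hz).prodMk continuous_snd.continuousOn
  have hOz : IsOpen {z : (Euc (p + q) × ℝ) × Euc q | z.1.1 ∈ O} := hOo.preimage (by fun_prop)
  have hJc : ContDiffOn ℝ ∞ J S' := by
    intro z hz
    have hzO : z.1.1 ∈ O := hrO hz.1.1
    by_cases hm : (a z.1.1, z.2) ∈ φ.target
    · have hopen : IsOpen {z : (Euc (p + q) × ℝ) × Euc q | z.1.1 ∈ O ∧ (a z.1.1, z.2) ∈ φ.target} :=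
        hac.isOpen_inter_preimage hOz φ.open_target
      have hev : J =ᶠ[𝓝 z] fun z =>
          ρ (a z.1.1, z.2) • e (𝒢.divMap (χ.symm z.1.1) (φ.symm (a z.1.1, z.2)), z.1.2) := by
        filter_upwards [hopen.mem_nhds ⟨hzO, hm⟩] with z hz
        exact indicator_of_mem (by exact hz.2) _
      have hpair : ContDiffAt ℝ ∞ (fun z : (Euc (p + q) × ℝ) × Euc q => (a z.1.1, z.2)) z :=
        (ContDiffAt.comp (g := a) (f := fun z : (Euc (p + q) × ℝ) × Euc q => z.1.1) z
          (haO.contDiffAt (hOo.mem_nhds hzO)) (by fun_prop)).prodMk (by fun_prop)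
      have h1 : ContDiffAt ℝ ∞ (fun z : (Euc (p + q) × ℝ) × Euc q => ρ (a z.1.1, z.2)) z :=
        (hρ.contDiffAt (φ.open_target.mem_nhds hm)).comp z hpair
      have h2 : ContMDiffAt 𝓘(ℝ, (Euc (p + q) × ℝ) × Euc q) 𝓘(ℝ, Euc (p + q) × Euc q) ∞
          (fun z : (Euc (p + q) × ℝ) × Euc q =>
            𝒢.divMap (χ.symm z.1.1) (φ.symm (a z.1.1, z.2))) z := by
        refine 𝒢.contMDiffAt_divMap ?_ ?_ ?_
        · exact (hχs.contMDiffAt (χ.open_target.mem_nhds hzO.1)).comp z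
            (by fun_prop : ContDiffAt ℝ ∞ (fun z : (Euc (p + q) × ℝ) × Euc q => z.1.1) z).contMDiffAt
        · exact (h.contMDiffOn_symm.contMDiffAt (φ.open_target.mem_nhds hm)).comp z
            hpair.contMDiffAt
        · filter_upwards [hopen.mem_nhds ⟨hzO, hm⟩] with z hz
          exact hsdiv _ hz.1 _ hz.2
      have h3 : ContMDiffWithinAt 𝓘(ℝ, (Euc (p + q) × ℝ) × Euc q) 𝓘(ℝ, ℂ) ∞
          (fun z : (Euc (p + q) × ℝ) × Euc q =>
            e (𝒢.divMap (χ.symm z.1.1) (φ.symm (a z.1.1, z.2)), z.1.2)) S' z := by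
        refine ContMDiffWithinAt.comp z
          (he (𝒢.divMap (χ.symm z.1.1) (φ.symm (a z.1.1, z.2)), z.1.2)
            ⟨mem_univ _, hI₀s hz.1.2⟩)
          (h2.contMDiffWithinAt.prodMk (by fun_prop : ContDiffWithinAt ℝ ∞
            (fun z : (Euc (p + q) × ℝ) × Euc q => z.1.2) S' z).contMDiffWithinAt)
          fun z hz => ⟨mem_univ _, hI₀s hz.1.2⟩
      exact (h1.contDiffWithinAt.smul (contMDiffWithinAt_iff_contDiffWithinAt.1
        h3)).congr_of_eventuallyEq (hev.filter_mono nhdsWithin_le_nhds) hev.eq_of_nhds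
    · have hm' : (a z.1.1, z.2) ∉ φ '' L := fun ⟨δ, hδ, hδe⟩ =>
        hm (hδe ▸ φ.map_source (hLφ hδ))
      have hev : J =ᶠ[𝓝 z] fun _ => 0 := by
        filter_upwards [(hac.isOpen_inter_preimage hOz hφL.isClosed.isOpen_compl).mem_nhds
          ⟨hzO, hm'⟩] with z hz
        exact hJ0 z hz.1 hz.2
      exact contDiffWithinAt_const.congr_of_eventuallyEq
        (hev.filter_mono nhdsWithin_le_nhds) hev.eq_of_nhds
  -- One ball contains the supports in `b` for all parameters in `O`; its indicator gives the
  -- integrable bound.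
  obtain ⟨R, hR⟩ := (hφL.image continuous_snd).isBounded.subset_closedBall (0 : Euc q)
  have hJR : ∀ z : (Euc (p + q) × ℝ) × Euc q, z.1.1 ∈ O → z.2 ∉ Metric.closedBall (0 : Euc q) R →
      J z = 0 := fun z hz hn => hJ0 z hz fun hm => hn (hR ⟨_, hm, rfl⟩)
  have hI₀u : UniqueDiffOn ℝ I₀ := uniqueDiffOn_Icc ht₀2
  have hS'u : UniqueDiffOn ℝ S' :=
    (Metric.isOpen_ball.uniqueDiffOn.prod hI₀u).prod uniqueDiffOn_univ
  set S : Set (Euc (p + q) × ℝ) := Metric.ball (χ γ₀) (r / 2) ×ˢ I₀ with hS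
  have hSu : UniqueDiffOn ℝ S := Metric.isOpen_ball.uniqueDiffOn.prod hI₀u
  have hSc : Convex ℝ S := (convex_ball _ _).prod (convex_Icc _ _)
  have hbound : ∀ n : ℕ, ∃ C : ℝ, ∀ z ∈ (Metric.closedBall (χ γ₀) (r / 2) ×ˢ I₀) ×ˢ
      Metric.closedBall (0 : Euc q) R, ‖iteratedFDerivWithin ℝ n J S' z‖ ≤ C := fun n => by
    refine (((isCompact_closedBall _ _).prod isCompact_Icc).prod
      (isCompact_closedBall _ _)).exists_bound_of_continuousOn
        ((hJc.continuousOn_iteratedFDerivWithin (mod_cast le_top) hS'u).mono ?_)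
    exact prod_mono (prod_mono (Metric.closedBall_subset_ball (by linarith)) subset_rfl)
      (subset_univ _)
  choose C hC using hbound
  have hfin : ∀ n, Integrable ((Metric.closedBall (0 : Euc q) R).indicator fun _ => C n) := fun n =>
    (integrable_indicator_iff Metric.isClosed_closedBall.measurableSet).2
      (integrableOn_const measure_closedBall_lt_top.ne)
  have hAB : ∀ (v : Euc (p + q) × ℝ) (b : Euc q),
      ContinuousLinearMap.inl ℝ (Euc (p + q) × ℝ) (Euc q) v + (0, b) = (v, b) := fun v b => by simp
  have hmain := (contDiffOn_integral (ν := (volume : Measure (Euc q))) hSc hSu hS'u hJc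
    (ContinuousLinearMap.inl ℝ (Euc (p + q) × ℝ) (Euc q)) (B := fun b => (0, b)) (by fun_prop)
    (fun v hv b => by
      rw [hAB]
      exact ⟨⟨Metric.ball_subset_ball (by linarith) hv.1, hv.2⟩, mem_univ _⟩) hfin
    fun n => Filter.Eventually.of_forall fun b v hv => by
      rw [hAB]
      have hvO : v.1 ∈ O := hrO (Metric.ball_subset_ball (by linarith) hv.1)
      by_cases hb : b ∈ Metric.closedBall (0 : Euc q) R
      · rw [indicator_of_mem hb]
        exact hC n _ ⟨⟨Metric.ball_subset_closedBall hv.1, hv.2⟩, hb⟩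
      · rw [indicator_of_notMem hb]
        have hev : J =ᶠ[𝓝 (v, b)] fun _ => 0 := by
          filter_upwards [(hOz.inter (Metric.isClosed_closedBall.isOpen_compl.preimage
            continuous_snd)).mem_nhds ⟨hvO, hb⟩] with z hz
          exact hJR z hz.1 hz.2
        rw [(hev.filter_mono nhdsWithin_le_nhds).iteratedFDerivWithin_eq hev.eq_of_nhds]
        simp).1
  simp only [hAB] at hmain
  have hkey : ∀ z : G × ℝ, z.1 ∈ χ.source → z.1 ∈ N → z.2 ∈ Ioc (0 : ℝ) 1 →
      ∫ δ, e (𝒢.divPair z.1 δ, z.2) ∂μ.fibre (𝒢.s z.1) = ∫ b, J ((χ z.1, z.2), b) := by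
    intro z hz hzN hzt
    have h1 : (fun δ : 𝒢.Fibre (𝒢.s z.1) => e (𝒢.divPair z.1 δ, z.2)) =
        fun δ : 𝒢.Fibre (𝒢.s z.1) => e (𝒢.divMap z.1 δ.1, z.2) := by
      funext δ
      rw [𝒢.divMap_of_eq δ.2]
    have hec : Continuous fun c : 𝒢.Comp => e (c, z.2) :=
      he.continuousOn.comp_continuous (by fun_prop) fun c => ⟨mem_univ _, hzt⟩
    rw [h1, μ.integral_fibre hρ hρ0 (hμ _ hzN) (f := fun δ => e (𝒢.divMap z.1 δ, z.2))
      (h1 ▸ hec.comp (continuous_divPair z.1))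
      fun δ hδ => heL _ _ fun hm => hδ (hLφ (by rwa [𝒢.divMap_snd δ.2] at hm)),
      ← integral_indicator (isOpen_fibre_target φ _).measurableSet]
    refine integral_congr_ae (Filter.Eventually.of_forall fun b => ?_)
    have haz : a (χ z.1) = ψ (𝒢.s z.1) := by rw [ha]; simp only [χ.left_inv hz]
    have hJb : J ((χ z.1, z.2), b) = {w : (Euc (p + q) × ℝ) × Euc q | (a w.1.1, w.2) ∈
        φ.target}.indicator (fun w => ρ (a w.1.1, w.2) •
          e (𝒢.divMap (χ.symm w.1.1) (φ.symm (a w.1.1, w.2)), w.1.2)) ((χ z.1, z.2), b) := rfl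
    simp only [hJb]
    by_cases hb : (ψ (𝒢.s z.1), b) ∈ φ.target
    · rw [indicator_of_mem (by exact hb), indicator_of_mem (by rw [mem_ofPred_eq, haz]; exact hb)]
      simp only [haz, χ.left_inv hz]
    · rw [indicator_of_notMem (by exact hb),
        indicator_of_notMem (by rw [mem_ofPred_eq, haz]; exact hb)]
  have hnhds : 𝓝[univ ×ˢ Ioc (0 : ℝ) 1] (γ₀, t₀) ≤ 𝓝[univ ×ˢ I₀] (γ₀, t₀) := by
    refine nhdsWithin_le_iff.2 ?_
    filter_upwards [self_mem_nhdsWithin, nhdsWithin_le_nhds ((isOpen_lt continuous_const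
      continuous_snd).mem_nhds (show t₀ / 2 < (γ₀, t₀).2 by simp only; linarith [ht₀.1]))]
      with z hz hz'
    exact ⟨mem_univ _, le_of_lt hz', hz.2.2⟩
  have hmem : (χ γ₀, t₀) ∈ S := ⟨Metric.mem_ball_self (by linarith), by linarith [ht₀.1], ht₀.2⟩
  have hV : ∀ᶠ z in 𝓝 (γ₀, t₀), z.1 ∈ χ.source ∧ z.1 ∈ N ∧ χ z.1 ∈ Metric.ball (χ γ₀) (r / 2) := by
    have h1 : ∀ᶠ γ in 𝓝 γ₀, γ ∈ χ.source ∧ γ ∈ N ∧ χ γ ∈ Metric.ball (χ γ₀) (r / 2) := by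
      filter_upwards [χ.open_source.mem_nhds (mem_chart_source _ γ₀), hNo.mem_nhds hγN,
        (χ.continuousAt (mem_chart_source _ γ₀)).preimage_mem_nhds
          (Metric.ball_mem_nhds _ (by linarith : 0 < r / 2))] with γ h1 h2 h3
      exact ⟨h1, h2, h3⟩
    exact (continuous_fst.continuousAt (x := (γ₀, t₀))).eventually h1
  set V : Set (G × ℝ) := {z | z.1 ∈ χ.source ∧ z.1 ∈ N ∧ χ z.1 ∈ Metric.ball (χ γ₀) (r / 2)}
    with hVdef
  have h1 : ContMDiffWithinAt ((𝓡 (p + q)).prod 𝓘(ℝ, ℝ)) 𝓘(ℝ, ℂ) ∞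
      (fun z : G × ℝ => ∫ b, J ((χ z.1, z.2), b)) ((univ ×ˢ I₀) ∩ V) (γ₀, t₀) := by
    have h2 : ContMDiffWithinAt ((𝓡 (p + q)).prod 𝓘(ℝ, ℝ)) 𝓘(ℝ, Euc (p + q) × ℝ) ∞
        (fun z : G × ℝ => (χ z.1, z.2)) ((univ ×ˢ I₀) ∩ V) (γ₀, t₀) :=
      (((contMDiffOn_chart (I := 𝓡 (p + q))).contMDiffAt
        (χ.open_source.mem_nhds (mem_chart_source _ γ₀))).comp (γ₀, t₀)
          contMDiffAt_fst).contMDiffWithinAt.prodMk_space contMDiffWithinAt_snd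
    exact ContMDiffWithinAt.comp (g := fun v : Euc (p + q) × ℝ => ∫ b, J (v, b)) (γ₀, t₀)
      (hmain _ hmem).contMDiffWithinAt h2 fun z hz => ⟨hz.2.2.2, hz.1.2⟩
  have h2 : ContMDiffWithinAt ((𝓡 (p + q)).prod 𝓘(ℝ, ℝ)) 𝓘(ℝ, ℂ) ∞
      (fun z : G × ℝ => ∫ b, J ((χ z.1, z.2), b)) (univ ×ˢ Ioc (0 : ℝ) 1) (γ₀, t₀) := by
    refine h1.mono_of_mem_nhdsWithin ?_
    exact Filter.inter_mem (hnhds self_mem_nhdsWithin) (nhdsWithin_le_nhds hV)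
  refine h2.congr_of_eventuallyEq ?_ (hkey _ (mem_chart_source _ γ₀) hγN ht₀)
  filter_upwards [self_mem_nhdsWithin, nhdsWithin_le_nhds hV] with z hz hzV
  exact hkey z hzV.1 hzV.2.1 hz.2

end LieGroupoid

/-! ### The integral over the fibres of the product -/

namespace LieGroupoid

variable {p q : ℕ} {G X : Type*}
  [TopologicalSpace G] [ChartedSpace (Euc (p + q)) G] [IsManifold (𝓡 (p + q)) ∞ G]
  [TopologicalSpace X] [ChartedSpace (Euc p) X] [IsManifold (𝓡 p) ∞ X]
  {𝒢 : LieGroupoid p q G X}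
  {φ : OpenPartialHomeomorph G (Euc p × Euc q)} {ψ : OpenPartialHomeomorph X (Euc p)}

theorem mem_srcT₂ {F : 𝒢.TangentComp → ℂ} :
    F ∈ 𝒢.SrcT₂ ↔ IsSrc (Euc q × Euc q) (F ∘ 𝒢.compIdent) := Iff.rfl

theorem mem_srcT {f : 𝒢.Tangent → ℂ} : f ∈ 𝒢.SrcT ↔ IsSrc (Euc q) f := Iff.rfl

/-- The part of `K` outside `V` has compact image under the product. This image misses `(u x, 0)`,
since at `t = 0` the set `K` contains only unit pairs, and the unit pair with product `u x` is `u₂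
x`. Hence for `(γ, t)` near `(u x, 0)` the whole integrand is supported in `V`. -/
theorem eventually_mem_of_mul_eq [T2Space G] {K : Set (𝒢.Comp × ℝ)} (hK : IsCompact K)
    (hK0 : ∀ c, (c, (0 : ℝ)) ∈ K → c ∈ range 𝒢.u₂) {x : X} {V : Set 𝒢.Comp} (hV : IsOpen V)
    (hxV : 𝒢.u₂ x ∈ V) :
    ∀ᶠ w : G × ℝ in 𝓝 (𝒢.u x, 0), ∀ c, 𝒢.mul c = w.1 → (c, w.2) ∈ K → c ∈ V := by
  have hc : Continuous fun z : 𝒢.Comp × ℝ => (𝒢.mul z.1, z.2) :=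
    (𝒢.contMDiff_mul.continuous.comp continuous_fst).prodMk continuous_snd
  have hK' : IsClosed ((fun z : 𝒢.Comp × ℝ => (𝒢.mul z.1, z.2)) '' (K \ Prod.fst ⁻¹' V)) :=
    ((hK.diff (hV.preimage continuous_fst)).image hc).isClosed
  filter_upwards [hK'.isOpen_compl.mem_nhds (x := (𝒢.u x, (0 : ℝ))) (by
    rintro ⟨⟨c, t⟩, ⟨h1, h2⟩, h3⟩
    obtain ⟨h4, h5⟩ := Prod.mk.inj h3
    dsimp only at h4 h5
    subst h5
    obtain ⟨y, rfl⟩ := hK0 c h1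
    rw [mul_u₂] at h4
    exact h2 (𝒢.u_injective h4 ▸ hxV))] with w hw c hcw hcK
  by_contra hn
  exact hw ⟨(c, w.2), ⟨hcK, hn⟩, Prod.ext hcw rfl⟩

theorem compChart_u₂ (h : 𝒢.IsFibredChart φ ψ) (hφ : IsSliceChart (Euc (p + q)) 𝒢.u φ) {x : X}
    (hx : 𝒢.u x ∈ φ.source) : compChart h (𝒢.u₂ x) = ((φ (𝒢.u x)).1, 0) := by
  have h0 : (φ (𝒢.u x)).2 = 0 := by rw [hφ.apply_eq hx]
  have h1 : (𝒢.u₂ x).snd = 𝒢.u x := rfl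
  rw [compChart_apply, mul_u₂, h1, h0]
  rfl

theorem u₂_mem_compChart_source (h : 𝒢.IsFibredChart φ ψ) {x : X} (hx : 𝒢.u x ∈ φ.source) :
    𝒢.u₂ x ∈ (compChart h).source :=
  ⟨by rw [mul_u₂]; exact hx, hx⟩

theorem mk_zero_mem_target (hφ : IsSliceChart (Euc (p + q)) 𝒢.u φ) {x : X}
    (hx : 𝒢.u x ∈ φ.source) : ((φ (𝒢.u x)).1, (0 : Euc q)) ∈ φ.target := by
  rw [← hφ.apply_eq hx]
  exact φ.map_source hx

theorem exists_contDiffBump (h : 𝒢.IsFibredChart φ ψ) (hφ : IsSliceChart (Euc (p + q)) 𝒢.u φ)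
    {x : X} (hx : 𝒢.u x ∈ φ.source) :
    ∃ k : ContDiffBump (((φ (𝒢.u x)).1, 0) : Euc p × Euc q × Euc q),
      Metric.closedBall ((φ (𝒢.u x)).1, 0) k.rOut ⊆ (compChart h).target := by
  have ht : (((φ (𝒢.u x)).1, 0) : Euc p × Euc q × Euc q) ∈ (compChart h).target :=
    ⟨mk_zero_mem_target hφ hx, mk_zero_mem_target hφ hx⟩
  obtain ⟨r, hr, hrt⟩ := Metric.nhds_basis_closedBall.mem_iff.1
    ((compChart h).open_target.mem_nhds ht)
  exact ⟨⟨r / 2, r, by linarith, by linarith⟩, hrt⟩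

theorem tameOn_localRep_compChart {H : DNC (Euc p) (Euc (p + q) × Euc q) 𝒢.u₂ → ℂ}
    (hH : IsSrc (Euc q × Euc q) H) (h : 𝒢.IsFibredChart φ ψ)
    (hφ : IsSliceChart (Euc (p + q)) 𝒢.u φ) {y : Euc p × Euc q × Euc q} (k : ContDiffBump y)
    (hk : Metric.closedBall y k.rOut ⊆ (compChart h).target) {ρ : Euc p × Euc q × Euc q → ℝ}
    (hρ : ContDiffOn ℝ ∞ ρ (compChart h).target) :
    TameOn (fun z => 1 + ‖z.2.1‖) univ fun z : Euc p × (Euc q × Euc q) × ℝ =>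
      localRep H (compChart h) z *
        ((k (z.1, z.2.2 • z.2.1) * ρ (z.1, z.2.2 • z.2.1) : ℝ) : ℂ) :=
  hH.tameOn_mul (isSliceChart_compChart h hφ) (κ := fun y => ((k y * ρ y : ℝ) : ℂ))
    (Complex.ofRealCLM.contDiff.comp_contDiffOn (k.contDiff.contDiffOn.mul hρ))
    (isCompact_closedBall y k.rOut) hk fun w hw => by
      rw [k.zero_of_le_dist (by simpa using (not_le.1 hw).le), zero_mul, Complex.ofReal_zero]

variable [T2Space G] [SecondCountableTopology G] [MeasurableSpace G] [BorelSpace G]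
  (μ : 𝒢.HaarSystem)

theorem integrandZero_fibreDeriv (F : 𝒢.TangentComp → ℂ) (h : 𝒢.IsFibredChart φ ψ)
    (hφ : IsSliceChart (Euc (p + q)) 𝒢.u φ) {v : X} (hv : 𝒢.u v ∈ φ.source) (ξ b : Euc q) :
    F (TangentComp.zero 𝒢 v
        ((Submodule.Quotient.mk (fibreDeriv φ (φ (𝒢.u v)) ξ) :
            NormalSpace (Euc p) (Euc (p + q)) 𝒢.u v) -
          (Submodule.Quotient.mk (fibreDeriv φ (φ (𝒢.u v)) b) :
            NormalSpace (Euc p) (Euc (p + q)) 𝒢.u v))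
        (Submodule.Quotient.mk (fibreDeriv φ (φ (𝒢.u v)) b) :
          NormalSpace (Euc p) (Euc (p + q)) 𝒢.u v)) =
      localRep (F ∘ 𝒢.compIdent) (compChart h) ((φ (𝒢.u v)).1, (ξ, b), 0) := by
  have hv' : 𝒢.u v = φ.symm ((φ (𝒢.u v)).1, 0) := by rw [← hφ.apply_eq hv, φ.left_inv hv]
  rw [localRep_compChart_zero F h hφ (mk_zero_mem_target hφ hv) hv', ← hφ.apply_eq hv]

/-- At `t = 0` integrability is rapid decay in a fibred slice chart; for `t > 0` the integrand is
continuous with compact support in the fibre. -/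
theorem HaarSystem.fibreIntegrable {F : 𝒢.TangentComp → ℂ} (hF : F ∈ 𝒢.SrcT₂) :
    μ.FibreIntegrable F where
  zero x ξ := by
    obtain ⟨φ, ψ, h, hφ, hx⟩ := 𝒢.exists_isFibredChart_isSliceChart x
    obtain ⟨ρ, hρ, hρ0, -, hμ⟩ := μ.smooth_density φ ψ h
    obtain ⟨ζ, rfl⟩ := exists_mk_fibreDeriv h hφ hx ξ
    -- At `t = 0` the cutoff is evaluated at its centre, where it is `1`, so it does not affect the
    -- integrand.
    obtain ⟨k, hk⟩ := exists_contDiffBump h hφ hx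
    have ht := (tameOn_localRep_compChart (mem_srcT₂.1 hF) h hφ k hk
      (contDiffOn_const (c := (1 : ℝ)))).integrable (ν := (volume : Measure (Euc q)))
      (x := (φ (𝒢.u x)).1) (ξ := ζ) (t := 0) ⟨le_rfl, zero_le_one⟩
    refine μ.integrable_tangent h hx ENNReal.ofReal_ne_top (hμ x hx)
      (g := fun w : Euc (p + q) => F (TangentComp.zero 𝒢 x
        ((Submodule.Quotient.mk (fibreDeriv φ (φ (𝒢.u x)) ζ) :
            NormalSpace (Euc p) (Euc (p + q)) 𝒢.u x) -
          (Submodule.Quotient.mk w : NormalSpace (Euc p) (Euc (p + q)) 𝒢.u x))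
        (Submodule.Quotient.mk w : NormalSpace (Euc p) (Euc (p + q)) 𝒢.u x))) ?_
    refine ht.congr (Filter.Eventually.of_forall fun b => ?_)
    dsimp only
    rw [integrandZero_fibreDeriv F h hφ hx, zero_smul, k.one_of_mem_closedBall
      (Metric.mem_closedBall_self k.rIn_pos.le), one_mul, Complex.ofReal_one, mul_one]
  pos γ t := by
    have hH := mem_srcT₂.1 hF
    obtain ⟨K, hK, -, -, hKF⟩ := hH.conic_compact_support
    have hc : Continuous fun z : 𝒢.Comp × ℝ => z.1.snd :=
      𝒢.contMDiff_snd.continuous.comp continuous_fst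
    exact (μ.integrable_divPair (hH.continuous_pos t) (hK.image hc) (fun c hcK =>
      hKF c t fun hm => hcK ⟨_, hm, rfl⟩) γ).mul_const _

/-- The integral over the fibres near a unit. -/
theorem HaarSystem.exists_tameOn_fibreIntegral {F : 𝒢.TangentComp → ℂ} (hF : F ∈ 𝒢.SrcT₂)
    (x : X) : ∃ φ : OpenPartialHomeomorph G (Euc p × Euc q), IsSliceChart (Euc (p + q)) 𝒢.u φ ∧
      𝒢.u x ∈ φ.source ∧ ∃ r > 0, TameOn (fun z => 1 + ‖z.2.1‖)
        (Metric.ball (φ (𝒢.u x), (0 : ℝ)) r) (localRep (μ.fibreIntegral F) φ) := by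
  obtain ⟨φ, ψ, h, hφ, hx⟩ := 𝒢.exists_isFibredChart_isSliceChart x
  obtain ⟨ρ, hρ, hρ0, hμ, hμt⟩ := μ.smooth_density φ ψ h
  set y₀ : Euc p × Euc q × Euc q := ((φ (𝒢.u x)).1, 0) with hy₀
  obtain ⟨k, hk⟩ : ∃ k : ContDiffBump y₀, Metric.closedBall y₀ k.rOut ⊆ (compChart h).target :=
    exists_contDiffBump h hφ hx
  have hH := mem_srcT₂.1 hF
  obtain ⟨K, hK, -, hK0, hKF⟩ := hH.conic_compact_support
  -- The integral in blown-up coordinates that the local representative will be shown to equal. The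
  -- density enters as `ρ (a, tη)`.
  have htame := (tameOn_localRep_compChart hH h hφ k hk (ρ := fun y => ρ (y.1, y.2.2))
    (hρ.comp (f := fun y : Euc p × Euc q × Euc q => (y.1, y.2.2)) (by fun_prop)
      fun y hy => hy.2)).integral (ν := (volume : Measure (Euc q)))
  set V : Set 𝒢.Comp := (compChart h).source ∩ compChart h ⁻¹' Metric.ball y₀ k.rIn with hV
  have hVo : IsOpen V := (compChart h).isOpen_inter_preimage Metric.isOpen_ball
  have hxV : 𝒢.u₂ x ∈ V := ⟨u₂_mem_compChart_source h hx, by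
    rw [mem_preimage, compChart_u₂ h hφ hx]
    exact Metric.mem_ball_self k.rIn_pos⟩
  have hev1 := eventually_mem_of_mul_eq hK hK0 hVo hxV
  have hsc : ContinuousAt (fun w : (Euc p × Euc q) × ℝ => (φ.symm w.1, w.2)) (φ (𝒢.u x), 0) :=
    ContinuousAt.prodMk (ContinuousAt.comp (f := Prod.fst) (g := φ.symm)
      (φ.continuousAt_symm (φ.map_source hx)) continuousAt_fst) continuousAt_snd
  have hev2 : ∀ᶠ w : (Euc p × Euc q) × ℝ in 𝓝 (φ (𝒢.u x), 0),
      w.1 ∈ φ.target ∧ (w.1.1, (0 : Euc q × Euc q)) ∈ Metric.ball y₀ k.rIn ∧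
      ∀ c, 𝒢.mul c = φ.symm w.1 → (c, w.2) ∈ K → c ∈ V := by
    have h1 : Filter.Tendsto (fun w : (Euc p × Euc q) × ℝ => (φ.symm w.1, w.2))
        (𝓝 (φ (𝒢.u x), 0)) (𝓝 (𝒢.u x, 0)) := by
      have := hsc.tendsto
      simp only [φ.left_inv hx] at this
      exact this
    have h2 : Continuous fun w : (Euc p × Euc q) × ℝ => (w.1.1, (0 : Euc q × Euc q)) := by fun_prop
    filter_upwards [(φ.open_target.preimage continuous_fst).mem_nhds
      (show (φ (𝒢.u x), (0 : ℝ)) ∈ _ from φ.map_source hx),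
      (Metric.isOpen_ball.preimage h2).mem_nhds (show (φ (𝒢.u x), (0 : ℝ)) ∈ _ from
        Metric.mem_ball_self k.rIn_pos), h1.eventually hev1] with w h1 h2 h3
    exact ⟨h1, h2, h3⟩
  obtain ⟨r, hr, hball⟩ := Metric.eventually_nhds_iff_ball.1 hev2
  refine ⟨φ, hφ, hx, r, hr, (htame.mono (subset_univ _)).congr Metric.isOpen_ball ?_⟩
  rintro ⟨a, ξ, t⟩ hz hzb
  obtain ⟨hwt, hwk, hwK⟩ := hball _ hzb
  dsimp only [blow] at hwt hwk hwK
  -- At `t = 0` the density is frozen at the unit, which is exactly how `μ.tangent` is normalised.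
  rcases eq_or_lt_of_le (show 0 ≤ t from hz.1) with h0 | h0
  · subst h0
    rw [zero_smul] at hwt
    obtain ⟨v, hv⟩ := hφ.exists_eq hwt
    have hvs : 𝒢.u v ∈ φ.source := hv ▸ φ.map_target hwt
    have hφv : φ (𝒢.u v) = (a, 0) := by rw [hv, φ.right_inv hwt]
    refine (localRep_of_zero 𝒢.u_injective _ _ ξ hv).trans ?_
    have h1 := μ.integral_tangent h hvs (hμt v hvs)
      (g := fun w : Euc (p + q) => F (TangentComp.zero 𝒢 v
        ((Submodule.Quotient.mk (fibreDeriv φ (φ (𝒢.u v)) ξ) :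
            NormalSpace (Euc p) (Euc (p + q)) 𝒢.u v) -
          (Submodule.Quotient.mk w : NormalSpace (Euc p) (Euc (p + q)) 𝒢.u v))
        (Submodule.Quotient.mk w : NormalSpace (Euc p) (Euc (p + q)) 𝒢.u v)))
    simp only [integrandZero_fibreDeriv F h hφ hvs] at h1
    rw [hφv] at h1
    refine h1.trans ?_
    rw [ENNReal.toReal_ofReal (hρ0 _ hwt).le, ← integral_smul]
    refine integral_congr_ae (Filter.Eventually.of_forall fun b => ?_)
    dsimp only
    rw [zero_smul, k.one_of_mem_closedBall (Metric.ball_subset_closedBall hwk), one_mul,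
      Complex.real_smul, mul_comm]
    rfl
  · have ht : t ∈ Ioc (0 : ℝ) 1 := ⟨h0, hz.2⟩
    have ht0 : t ≠ 0 := h0.ne'
    set γ := φ.symm (a, t • ξ) with hγ
    have hγs : γ ∈ φ.source := φ.map_target hwt
    have hψ : ψ (𝒢.s γ) = a := by
      rw [h.base_s γ hγs, hγ, φ.right_inv hwt]
    rw [localRep_of_pos _ _ ht]
    have h1 : (fun δ : 𝒢.Fibre (𝒢.s γ) => 𝒢.integrandPos F γ ⟨t, ht⟩ δ) =
        fun δ : 𝒢.Fibre (𝒢.s γ) => F (TangentComp.pos 𝒢 (𝒢.divMap γ δ.1) ⟨t, ht⟩) *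
          (((t ^ q)⁻¹ : ℝ) : ℂ) := by
      funext δ
      rw [𝒢.divMap_of_eq δ.2]
      rfl
    have hcont : Continuous fun δ : 𝒢.Fibre (𝒢.s γ) => 𝒢.integrandPos F γ ⟨t, ht⟩ δ :=
      ((hH.continuous_pos ⟨t, ht⟩).comp (continuous_divPair γ)).mul continuous_const
    change ∫ δ, 𝒢.integrandPos F γ ⟨t, ht⟩ δ ∂μ.fibre (𝒢.s γ) = _
    rw [h1] at hcont ⊢
    -- Wherever the integrand is nonzero the pair lies in the chart, in the region where the cutoff
    -- is `1`.
    have hsupp : ∀ δ, 𝒢.s δ = 𝒢.s γ → F (TangentComp.pos 𝒢 (𝒢.divMap γ δ) ⟨t, ht⟩) ≠ 0 →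
        𝒢.divMap γ δ ∈ V := fun δ hδ hn => by
      refine hwK _ (𝒢.mul_divMap hδ) ?_
      by_contra hm
      exact hn (hKF _ ⟨t, ht⟩ hm)
    rw [μ.integral_fibre hρ hρ0 (hμ _ (h.mapsTo hγs)) (f := fun δ =>
      F (TangentComp.pos 𝒢 (𝒢.divMap γ δ) ⟨t, ht⟩) * (((t ^ q)⁻¹ : ℝ) : ℂ)) hcont ?_, hψ,
      ← integral_indicator (isOpen_fibre_target φ _).measurableSet]
    swap
    · intro δ hδ
      by_contra hn
      have := (hsupp δ.1 δ.2 (left_ne_zero_of_mul hn)).1.2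
      rw [𝒢.divMap_snd δ.2] at this
      exact hδ this
    set I : Euc q → ℂ := fun η => localRep (F ∘ 𝒢.compIdent) (compChart h) (a, (ξ, η), t) *
      ((k (a, t • (ξ, η)) * ρ (a, t • η) : ℝ) : ℂ) with hI
    -- With `η = t⁻¹ b` the two integrands agree pointwise. Where the original one is nonzero the
    -- cutoff is `1`; outside the chart the cutoff vanishes.
    have hkey : ∀ b : Euc q, {b : Euc q | (a, b) ∈ φ.target}.indicator (fun b => ρ (a, b) •
        (F (TangentComp.pos 𝒢 (𝒢.divMap γ (φ.symm (a, b))) ⟨t, ht⟩) * (((t ^ q)⁻¹ : ℝ) : ℂ))) b =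
        (t ^ q)⁻¹ • I (t⁻¹ • b) := by
      intro b
      have e1 : t • (ξ, t⁻¹ • b) = (t • ξ, b) := by
        rw [Prod.smul_mk, smul_inv_smul₀ ht0]
      have e2 : localRep (F ∘ 𝒢.compIdent) (compChart h) (a, (ξ, t⁻¹ • b), t) =
          F (TangentComp.pos 𝒢 (𝒢.divMap γ (φ.symm (a, b))) ⟨t, ht⟩) := by
        rw [localRep_of_pos _ _ ht, e1]
        rfl
      simp only [hI, e1, e2, smul_inv_smul₀ ht0]
      by_cases hb : (a, b) ∈ φ.target
      · rw [indicator_of_mem (by exact hb)]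
        have hmem : (a, t • ξ, b) ∈ (compChart h).target := ⟨hwt, hb⟩
        by_cases hF0 : F (TangentComp.pos 𝒢 (𝒢.divMap γ (φ.symm (a, b))) ⟨t, ht⟩) = 0
        · simp [hF0]
        · have hVm := (hsupp _ (s_symm_eq_s_symm h hmem) hF0).2
          have e3 : compChart h (𝒢.divMap γ (φ.symm (a, b))) = (a, t • ξ, b) :=
            (compChart h).right_inv hmem
          rw [mem_preimage, e3] at hVm
          rw [k.one_of_mem_closedBall (Metric.ball_subset_closedBall hVm), one_mul,
            Complex.real_smul, Complex.real_smul]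
          ring
      · rw [indicator_of_notMem (by exact hb)]
        have hk0 : k (a, t • ξ, b) = 0 := by
          refine k.zero_of_le_dist (le_of_not_ge fun hle => hb ?_)
          exact (hk (Metric.mem_closedBall.2 hle)).2
        rw [hk0, zero_mul, Complex.ofReal_zero, mul_zero, smul_zero]
    simp only [hkey]
    -- The substitution `b = tη` contributes `t ^ q`, which cancels the factor `t^{-q}`.
    rw [integral_smul, Measure.integral_comp_inv_smul, finrank_euclideanSpace_fin,
      abs_of_nonneg (by positivity), smul_smul, inv_mul_cancel₀ (by positivity), one_smul]
    rfl

end LieGroupoid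

/-! ### Smoothness, membership and linearity of the fibre integral -/

namespace LieGroupoid

variable {p q : ℕ} {G X : Type*}
  [TopologicalSpace G] [ChartedSpace (Euc (p + q)) G] [IsManifold (𝓡 (p + q)) ∞ G]
  [TopologicalSpace X] [ChartedSpace (Euc p) X] [IsManifold (𝓡 p) ∞ X]
  {𝒢 : LieGroupoid p q G X}
  [T2Space G] [SecondCountableTopology G] [MeasurableSpace G] [BorelSpace G]
  (μ : 𝒢.HaarSystem)

theorem HaarSystem.posPart_fibreIntegral (F : 𝒢.TangentComp → ℂ) (z : G × ℝ) :
    posPart (μ.fibreIntegral F) z = ∫ δ, posPart (F ∘ 𝒢.compIdent) (𝒢.divPair z.1 δ, z.2) *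
      (((z.2 ^ q)⁻¹ : ℝ) : ℂ) ∂μ.fibre (𝒢.s z.1) := by
  by_cases ht : z.2 ∈ Ioc (0 : ℝ) 1
  · refine (posPart_of_pos _ z.1 ht).trans ?_
    refine integral_congr_ae (Filter.Eventually.of_forall fun δ => ?_)
    dsimp only
    rw [posPart_of_pos _ _ ht]
    rfl
  · simp only [posPart, dif_neg ht, zero_mul, integral_zero]

/-- The integral over the fibres is smooth for positive parameters. -/
theorem HaarSystem.contMDiffOn_posPart_fibreIntegral {F : 𝒢.TangentComp → ℂ}
    (hF : F ∈ 𝒢.SrcT₂) :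
    ContMDiffOn ((𝓡 (p + q)).prod 𝓘(ℝ, ℝ)) 𝓘(ℝ, ℂ) ∞ (posPart (μ.fibreIntegral F))
      (univ ×ˢ Ioc (0 : ℝ) 1) := by
  have hH := mem_srcT₂.1 hF
  obtain ⟨K, hK, -, -, hKF⟩ := hH.conic_compact_support
  -- All `δ` that contribute to any of the integrals lie in this compact set, so finitely many
  -- members of the partition of unity suffice.
  set C : Set G := (fun z : 𝒢.Comp × ℝ => z.1.snd) '' K with hC
  have hCc : IsCompact C := hK.image (𝒢.contMDiff_snd.continuous.comp continuous_fst)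
  have hHC : ∀ c t, c.snd ∉ C → posPart (F ∘ 𝒢.compIdent) (c, t) = 0 := by
    intro c t hc
    by_cases ht : t ∈ Ioc (0 : ℝ) 1
    · rw [posPart_of_pos _ _ ht]
      exact hKF c ⟨t, ht⟩ fun hm => hc ⟨_, hm, rfl⟩
    · exact dif_neg ht
  choose φ ψ hφψ hmem using 𝒢.exists_isFibredChart
  have : LocallyCompactSpace G := ChartedSpace.locallyCompactSpace (Euc (p + q)) G
  obtain ⟨f, hf⟩ := SmoothPartitionOfUnity.exists_isSubordinate (𝓡 (p + q)) (s := (univ : Set G))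
    isClosed_univ (fun γ => (φ γ).source) (fun γ => (φ γ).open_source)
    fun γ _ => mem_iUnion.2 ⟨γ, hmem γ⟩
  have hfin := f.locallyFinite.finite_nonempty_inter_compact hCc
  set T := hfin.toFinset with hT
  have hsum : ∀ δ ∈ C, ∑ i ∈ T, f i δ = 1 := by
    intro δ hδ
    rw [← f.sum_eq_one (mem_univ δ), finsum_eq_sum_of_support_subset]
    intro i hi
    rw [Finset.mem_coe, hT, Set.Finite.mem_toFinset]
    exact ⟨δ, hi, hδ⟩
  -- The partition of unity is evaluated at `δ`, which confines the integration variable of each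
  -- summand to one fibred chart.
  set e : G → 𝒢.Comp × ℝ → ℂ := fun i z => ((f i z.1.snd : ℝ) : ℂ) *
    (posPart (F ∘ 𝒢.compIdent) z * (((z.2 ^ q)⁻¹ : ℝ) : ℂ)) with he
  have hpow : ContMDiffOn (𝓘(ℝ, Euc (p + q) × Euc q).prod 𝓘(ℝ, ℝ)) 𝓘(ℝ, ℂ) ∞
      (fun z : 𝒢.Comp × ℝ => (((z.2 ^ q)⁻¹ : ℝ) : ℂ)) (univ ×ˢ Ioc (0 : ℝ) 1) := by
    have h1 : ContDiffOn ℝ ∞ (fun t : ℝ => (((t ^ q)⁻¹ : ℝ) : ℂ)) (Ioc 0 1) :=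
      Complex.ofRealCLM.contDiff.comp_contDiffOn
        (ContDiffOn.inv (by fun_prop) fun t ht => pow_ne_zero _ ht.1.ne')
    exact h1.contMDiffOn.comp contMDiffOn_snd fun z hz => hz.2
  have hes : ∀ i, ContMDiffOn (𝓘(ℝ, Euc (p + q) × Euc q).prod 𝓘(ℝ, ℝ)) 𝓘(ℝ, ℂ) ∞ (e i)
      (univ ×ˢ Ioc (0 : ℝ) 1) := by
    intro i
    have h1 : ContMDiff (𝓘(ℝ, Euc (p + q) × Euc q).prod 𝓘(ℝ, ℝ)) 𝓘(ℝ, ℂ) ∞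
        (fun z : 𝒢.Comp × ℝ => ((f i z.1.snd : ℝ) : ℂ)) :=
      Complex.ofRealCLM.contDiff.contMDiff.comp
        ((f i).contMDiff.comp (𝒢.contMDiff_snd.comp _root_.contMDiff_fst))
    exact contDiff_mul.contMDiff.comp_contMDiffOn (h1.contMDiffOn.prodMk_space
      (contDiff_mul.contMDiff.comp_contMDiffOn (hH.contMDiffOn_pos.prodMk_space hpow)))
  have hterm : ∀ i, ContMDiffOn ((𝓡 (p + q)).prod 𝓘(ℝ, ℝ)) 𝓘(ℝ, ℂ) ∞
      (fun z : G × ℝ => ∫ δ, e i (𝒢.divPair z.1 δ, z.2) ∂μ.fibre (𝒢.s z.1))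
      (univ ×ˢ Ioc (0 : ℝ) 1) := by
    intro i
    refine μ.contMDiffOn_integral_divMap (hφψ i) (hes i)
      (hCc.inter_right (isClosed_tsupport (f i))) (inter_subset_right.trans (hf i)) ?_
    intro c t hc
    by_cases h1 : c.snd ∈ C
    · have h2 : f i c.snd = 0 := image_eq_zero_of_notMem_tsupport fun h2 => hc ⟨h1, h2⟩
      simp only [he, h2, Complex.ofReal_zero, zero_mul]
    · simp only [he, hHC _ _ h1, zero_mul, mul_zero]
  refine (contMDiffOn_finsetSum fun i (_ : i ∈ T) => hterm i).congr ?_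
  rintro ⟨γ, t⟩ ⟨-, ht⟩
  rw [μ.posPart_fibreIntegral, ← integral_finsetSum]
  · refine integral_congr_ae (Filter.Eventually.of_forall fun δ => ?_)
    simp only [he]
    rw [← Finset.sum_mul, ← Complex.ofReal_sum]
    by_cases h1 : (𝒢.divPair γ δ).snd ∈ C
    · rw [hsum _ h1, Complex.ofReal_one, one_mul]
    · rw [hHC _ _ h1, zero_mul, mul_zero]
  · intro i _
    refine μ.integrable_divPair (e := fun c => e i (c, t)) ?_ hCc (fun c hc => ?_) γ
    · exact (hes i).continuousOn.comp_continuous (by fun_prop) fun c => ⟨mem_univ _, ht⟩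
    · simp only [he, hHC _ _ hc, zero_mul, mul_zero]

/-- The image of a conic compact under the product is conic, because a product of equal units is
that unit; it supports the integral since `(γδ⁻¹)δ = γ`. Smoothness and the estimates near the units
are the two preceding results. -/
theorem HaarSystem.fibreIntegral_mem {F : 𝒢.TangentComp → ℂ} (hF : F ∈ 𝒢.SrcT₂) :
    μ.fibreIntegral F ∈ 𝒢.SrcT := by
  rw [mem_srcT]
  have hH := mem_srcT₂.1 hF
  obtain ⟨K, hK, hKI, hK0, hKF⟩ := hH.conic_compact_support
  refine isSrc_of_tameOn_localRep 𝒢.contMDiff_u 𝒢.contMDiff_s 𝒢.s_u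
    (μ.contMDiffOn_posPart_fibreIntegral hF)
    ⟨(fun z : 𝒢.Comp × ℝ => (𝒢.mul z.1, z.2)) '' K,
      hK.image ((𝒢.contMDiff_mul.continuous.comp continuous_fst).prodMk continuous_snd), ?_, ?_,
      ?_⟩ (μ.exists_tameOn_fibreIntegral hF)
  · rintro _ ⟨z, hz, rfl⟩
    exact ⟨mem_univ _, (hKI hz).2⟩
  · rintro _ ⟨⟨c, t⟩, hz, h⟩
    obtain ⟨rfl, rfl⟩ := Prod.mk.inj h
    obtain ⟨x, rfl⟩ := hK0 c hz
    exact ⟨x, (𝒢.mul_u₂ x).symm⟩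
  · intro γ t hn
    refine integral_eq_zero_of_ae (Filter.Eventually.of_forall fun δ => ?_)
    have h1 : F (TangentComp.pos 𝒢 (𝒢.divPair γ δ) t) = 0 :=
      hKF _ t fun hm => hn ⟨_, hm, Prod.ext (𝒢.mul_divPair γ δ) rfl⟩
    exact mul_eq_zero_of_left h1 _

theorem HaarSystem.fibreIntegral_add {F F' : 𝒢.TangentComp → ℂ} (hF : F ∈ 𝒢.SrcT₂)
    (hF' : F' ∈ 𝒢.SrcT₂) :
    μ.fibreIntegral (F + F') = μ.fibreIntegral F + μ.fibreIntegral F' := by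
  funext z
  rcases z with ⟨x, ξ⟩ | ⟨γ, t⟩
  · exact integral_add ((μ.fibreIntegrable hF).zero x ξ) ((μ.fibreIntegrable hF').zero x ξ)
  · refine Eq.trans ?_
      (integral_add ((μ.fibreIntegrable hF).pos γ t) ((μ.fibreIntegrable hF').pos γ t))
    refine integral_congr_ae (Filter.Eventually.of_forall fun δ => ?_)
    exact add_mul _ _ _

theorem HaarSystem.fibreIntegral_smul (c : ℂ) (F : 𝒢.TangentComp → ℂ) :
    μ.fibreIntegral (c • F) = c • μ.fibreIntegral F := by
  funext z
  rcases z with ⟨x, ξ⟩ | ⟨γ, t⟩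
  · exact integral_smul (μ := μ.tangent x) c (𝒢.integrandZero F x ξ)
  · refine Eq.trans ?_ (integral_smul (μ := μ.fibre (𝒢.s γ)) c (𝒢.integrandPos F γ t))
    refine integral_congr_ae (Filter.Eventually.of_forall fun δ => ?_)
    exact _root_.mul_assoc _ _ _

/-- Integration over the fibres of the product as a linear map. -/
def HaarSystem.fibreIntegralₗ : 𝒢.SrcT₂ →ₗ[ℂ] 𝒢.SrcT where
  toFun F := ⟨μ.fibreIntegral F, μ.fibreIntegral_mem F.2⟩
  map_add' F F' := Subtype.ext (μ.fibreIntegral_add F.2 F'.2)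
  map_smul' c F := Subtype.ext (μ.fibreIntegral_smul c F)

end LieGroupoid

/-! ### Products of functions on the tangent groupoid -/

/-- A bump function equal to `1` near `y` turns the decay of the cut off function into decay of the
local representative itself. -/
theorem IsSrc.exists_tameOn {P E Q : Type*} [NormedAddCommGroup P] [NormedSpace ℝ P]
    [NormedAddCommGroup E] [NormedSpace ℝ E] [NormedAddCommGroup Q] [NormedSpace ℝ Q]
    [FiniteDimensional ℝ P] [FiniteDimensional ℝ Q]
    {X M : Type*} [TopologicalSpace X] [ChartedSpace P X] [TopologicalSpace M]
    [ChartedSpace E M] {ι : X → M} {g : DNC P E ι → ℂ} (hg : IsSrc Q g)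
    {φ : OpenPartialHomeomorph M (P × Q)} (hφ : IsSliceChart E ι φ) {y : P × Q}
    (hy : y ∈ φ.target) :
    ∃ r > 0, TameOn (fun z => 1 + ‖z.2.1‖) (Metric.ball (y, (0 : ℝ)) r) (localRep g φ) := by
  obtain ⟨r, hr, hrt⟩ := Metric.nhds_basis_closedBall.mem_iff.1 (φ.open_target.mem_nhds hy)
  let k : ContDiffBump y := ⟨r / 2, r, by linarith, by linarith⟩
  have h := hg.tameOn_mul hφ (κ := fun y => ((k y : ℝ) : ℂ))
    (Complex.ofRealCLM.contDiff.comp_contDiffOn k.contDiff.contDiffOn)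
    (isCompact_closedBall y r) hrt fun w hw => by
      rw [k.zero_of_le_dist (by simpa using (not_le.1 hw).le), Complex.ofReal_zero]
  refine ⟨r / 2, by linarith, (h.mono (subset_univ _)).congr Metric.isOpen_ball fun z _ hz => ?_⟩
  have h1 : (z.1, z.2.2 • z.2.1) ∈ Metric.closedBall y (r / 2) := by
    have h2 : dist (blow z).1 y ≤ dist (blow z) (y, (0 : ℝ)) := by
      rw [Prod.dist_eq]; exact le_max_left _ _
    exact h2.trans (Metric.mem_ball.1 hz).le
  have h3 : k (z.1, z.2.2 • z.2.1) = 1 := k.one_of_mem_closedBall h1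
  simp only [h3, Complex.ofReal_one, mul_one]

namespace LieGroupoid

variable {p q : ℕ} {G X : Type*}
  [TopologicalSpace G] [ChartedSpace (Euc (p + q)) G] [IsManifold (𝓡 (p + q)) ∞ G]
  [TopologicalSpace X] [ChartedSpace (Euc p) X] [IsManifold (𝓡 p) ∞ X]
  {𝒢 : LieGroupoid p q G X}
  {φ : OpenPartialHomeomorph G (Euc p × Euc q)} {ψ : OpenPartialHomeomorph X (Euc p)}

theorem localRep_prodComp (f g : 𝒢.Tangent → ℂ)
    (Ψ : OpenPartialHomeomorph 𝒢.Comp (Euc p × Euc q × Euc q))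
    (z : Euc p × (Euc q × Euc q) × ℝ) :
    localRep (prodComp f g ∘ 𝒢.compIdent) Ψ z =
      localRep (fun w => f (𝒢.compIdent w).fst) Ψ z *
        localRep (fun w => g (𝒢.compIdent w).snd) Ψ z := by
  unfold localRep
  split_ifs
  · rfl
  · rfl
  · simp

theorem posPart_prodComp (f g : 𝒢.Tangent → ℂ) (z : 𝒢.Comp × ℝ) :
    posPart (prodComp f g ∘ 𝒢.compIdent) z =
      posPart f (z.1.fst, z.2) * posPart g (z.1.snd, z.2) := by
  unfold posPart
  dsimp only
  split_ifs
  · rfl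
  · simp

/-- On the slice `B₂ (b, d) = d` and `B₁ (b, 0) = b`, so a vector killed by both is zero. Full
knowledge of `B₁` is not needed. -/
theorem prod_injective_of_eventually (h : 𝒢.IsFibredChart φ ψ)
    (hφ : IsSliceChart (Euc (p + q)) 𝒢.u φ) {x : X} (hx : 𝒢.u x ∈ φ.source)
    {T₁ T₂ : Euc p × Euc q × Euc q → Euc p}
    {B₁ B₂ : Euc p × Euc q × Euc q → Euc q × Euc q →L[ℝ] Euc q}
    (hB₁ : Continuous B₁) (hB₂ : Continuous B₂)
    (h₁ : ∀ᶠ y in 𝓝 (compChart h (𝒢.u₂ x)),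
      φ ((compChart h).symm y).fst = (T₁ y, B₁ y y.2))
    (h₂ : ∀ᶠ y in 𝓝 (compChart h (𝒢.u₂ x)),
      φ ((compChart h).symm y).snd = (T₂ y, B₂ y y.2)) :
    Function.Injective ((B₁ (compChart h (𝒢.u₂ x))).prod (B₂ (compChart h (𝒢.u₂ x)))) := by
  set a := (φ (𝒢.u x)).1 with ha
  have ht := mk_zero_mem_target hφ hx
  have htend : ∀ ζ : Euc q × Euc q,
      Filter.Tendsto (fun s : ℝ => (a, s • ζ)) (𝓝 0) (𝓝 (a, (0 : Euc q × Euc q))) := fun ζ => by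
    have : Continuous fun s : ℝ => (a, s • ζ) := by fun_prop
    simpa using this.tendsto 0
  have htend' : ∀ b : Euc q,
      Filter.Tendsto (fun s : ℝ => (a, s • b)) (𝓝 0) (𝓝 (a, (0 : Euc q))) := fun b => by
    have : Continuous fun s : ℝ => (a, s • b) := by fun_prop
    simpa using this.tendsto 0
  rw [compChart_u₂ h hφ hx] at h₁ h₂ ⊢
  have k₂ : ∀ b d : Euc q, B₂ (a, 0) (b, d) = d := fun b d => by
    refine apply_eq_of_eventually hB₂.continuousAt ?_
    filter_upwards [(htend (b, d)).eventually h₂, (htend' b).eventually (φ.open_target.eventually_mem ht),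
      (htend' d).eventually (φ.open_target.eventually_mem ht)] with s hs hb hd
    rw [compChart_symm_snd h (y := (a, s • (b, d))) ⟨hb, hd⟩] at hs
    have := congrArg Prod.snd hs
    dsimp only at this
    rw [← this]
    exact congrArg Prod.snd (φ.right_inv hd)
  have k₁ : ∀ b : Euc q, B₁ (a, 0) (b, 0) = b := fun b => by
    refine apply_eq_of_eventually hB₁.continuousAt ?_
    filter_upwards [(htend (b, 0)).eventually h₁, (htend' b).eventually (φ.open_target.eventually_mem ht)]
      with s hs hb
    have e : (s • (b, (0 : Euc q))) = (s • b, 0) := by rw [Prod.smul_mk, smul_zero]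
    rw [e] at hs ⊢
    have h3 := compChart_symm_fst_zero h hφ (w := (a, s • b)) hb ht
    dsimp only at h3
    rw [h3, φ.right_inv hb] at hs
    exact (congrArg Prod.snd hs).symm
  refine (injective_iff_map_eq_zero _).2 ?_
  rintro ⟨b, d⟩ hbd
  rw [ContinuousLinearMap.prod_apply, Prod.mk_eq_zero] at hbd
  obtain ⟨e₁, e₂⟩ := hbd
  rw [k₂] at e₂
  subst e₂
  rw [k₁] at e₁
  rw [e₁]
  rfl

/-- The factor from `f` decays in `B₁ ζ` and that from `g` in `B₂ ζ`, for `ζ` the normal variable of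
the pair. The product of the weights dominates `1 + ‖(B₁ ζ, B₂ ζ)‖`, and joint injectivity makes
this decay in `ζ`. -/
theorem exists_tameOn_prodComp {f g : 𝒢.Tangent → ℂ} (hf : f ∈ 𝒢.SrcT) (hg : g ∈ 𝒢.SrcT)
    (x : X) : ∃ Ψ : OpenPartialHomeomorph 𝒢.Comp (Euc p × Euc q × Euc q),
      IsSliceChart (Euc (p + q) × Euc q) 𝒢.u₂ Ψ ∧ 𝒢.u₂ x ∈ Ψ.source ∧
      ∃ r > 0, TameOn (fun z => 1 + ‖z.2.1‖) (Metric.ball (Ψ (𝒢.u₂ x), (0 : ℝ)) r)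
        (localRep (prodComp f g ∘ 𝒢.compIdent) Ψ) := by
  obtain ⟨φ, ψ, h, hφ, hx⟩ := 𝒢.exists_isFibredChart_isSliceChart x
  have hΨ := isSliceChart_compChart h hφ
  have hx₂ := u₂_mem_compChart_source h hx
  refine ⟨compChart h, hΨ, hx₂, ?_⟩
  obtain ⟨T₁, B₁, hT₁, hB₁, hTB₁, -, hloc₁⟩ := exists_localRep_eq_blowMap
    (g := fun w => f (𝒢.compIdent w).fst) (f := f) 𝒢.contMDiff_fst 𝒢.contMDiff_u 𝒢.contMDiff_s
    (fun _ => rfl) 𝒢.s_u (fun _ _ => rfl) (fun _ _ => rfl) hΨ hφ hx₂ hx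
  obtain ⟨T₂, B₂, hT₂, hB₂, hTB₂, -, hloc₂⟩ := exists_localRep_eq_blowMap
    (g := fun w => g (𝒢.compIdent w).snd) (f := g) 𝒢.contMDiff_snd 𝒢.contMDiff_u 𝒢.contMDiff_s
    (fun _ => rfl) 𝒢.s_u (fun _ _ => rfl) (fun _ _ => rfl) hΨ hφ hx₂ hx
  set y₀ := compChart h (𝒢.u₂ x) with hy₀
  have e₁ : (T₁ y₀, B₁ y₀ y₀.2) = φ (𝒢.u x) := by
    have := hTB₁.self_of_nhds
    rw [hy₀, (compChart h).left_inv hx₂] at this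
    exact this.symm
  have e₂ : (T₂ y₀, B₂ y₀ y₀.2) = φ (𝒢.u x) := by
    have := hTB₂.self_of_nhds
    rw [hy₀, (compChart h).left_inv hx₂] at this
    exact this.symm
  obtain ⟨r₁, hr₁, h₁⟩ := (mem_srcT.1 hf).exists_tameOn hφ (φ.map_source hx)
  obtain ⟨r₂, hr₂, h₂⟩ := (mem_srcT.1 hg).exists_tameOn hφ (φ.map_source hx)
  rw [← e₁] at h₁
  rw [← e₂] at h₂
  obtain ⟨s₁, hs₁, k₁⟩ := h₁.comp_blowMap hT₁ hB₁ hr₁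
  obtain ⟨s₂, hs₂, k₂⟩ := h₂.comp_blowMap hT₂ hB₂ hr₂
  have k := TameOn.bilinear (ContinuousLinearMap.mul ℝ ℂ)
    (k₁.mono (Metric.ball_subset_ball (min_le_left s₁ s₂)))
    (k₂.mono (Metric.ball_subset_ball (min_le_right s₁ s₂)))
    (fun z => by positivity) (fun z => by positivity)
  have hB : ContDiff ℝ ∞ fun y => (B₁ y).prod (B₂ y) := by
    have e : (fun y => (B₁ y).prod (B₂ y)) = fun y =>
        (ContinuousLinearMap.inl ℝ (Euc q) (Euc q)).comp (B₁ y) +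
          (ContinuousLinearMap.inr ℝ (Euc q) (Euc q)).comp (B₂ y) := by
      funext y
      ext z <;> simp
    rw [e]
    exact (contDiff_const.clm_comp hB₁).add (contDiff_const.clm_comp hB₂)
  obtain ⟨s, hs, k'⟩ := TameOn.of_injective hB
    (prod_injective_of_eventually h hφ hx hB₁.continuous hB₂.continuous hTB₁ hTB₂)
    (fun z => by positivity) (lt_min hs₁ hs₂) k fun z hz => by
      have n₁ := norm_nonneg (B₁ (blow z).1 z.2.1)
      have n₂ := norm_nonneg (B₂ (blow z).1 z.2.1)
      have : ‖((B₁ (blow z).1).prod (B₂ (blow z).1)) z.2.1‖ ≤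
          ‖B₁ (blow z).1 z.2.1‖ + ‖B₂ (blow z).1 z.2.1‖ := by
        rw [ContinuousLinearMap.prod_apply, Prod.norm_def]
        exact max_le (by linarith) (by linarith)
      nlinarith
  obtain ⟨r₃, hr₃, hloc⟩ := Metric.mem_nhds_iff.1 (hloc₁.and hloc₂)
  refine ⟨min s r₃, lt_min hs hr₃, (k'.mono (Metric.ball_subset_ball (min_le_left _ _))).congr
    Metric.isOpen_ball fun z hz hU => ?_⟩
  have h4 : dist (blow z).1 y₀ ≤ dist (blow z) (y₀, (0 : ℝ)) := by
    rw [Prod.dist_eq]; exact le_max_left _ _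
  obtain ⟨l₁, l₂⟩ := hloc
    (show (blow z).1 ∈ _ from h4.trans_lt ((Metric.mem_ball.1 hU).trans_le (min_le_right _ _)))
  rw [localRep_prodComp, l₁ z hz rfl, l₂ z hz rfl]
  rfl

/-- The support lies over both given conic compacts and is compact because the pairs are closed in
`G × G`. At `t = 0` both entries are units, and composability forces them to be equal. -/
theorem prodComp_mem [T2Space G] {f g : 𝒢.Tangent → ℂ} (hf : f ∈ 𝒢.SrcT) (hg : g ∈ 𝒢.SrcT) :
    prodComp f g ∈ 𝒢.SrcT₂ := by
  rw [mem_srcT₂]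
  obtain ⟨K, hK, hKI, hK0, hKf⟩ := (mem_srcT.1 hf).conic_compact_support
  obtain ⟨L, hL, hLI, hL0, hLg⟩ := (mem_srcT.1 hg).conic_compact_support
  have hc₁ : Continuous fun z : 𝒢.Comp × ℝ => (z.1.fst, z.2) :=
    (𝒢.contMDiff_fst.continuous.comp continuous_fst).prodMk continuous_snd
  have hc₂ : Continuous fun z : 𝒢.Comp × ℝ => (z.1.snd, z.2) :=
    (𝒢.contMDiff_snd.continuous.comp continuous_fst).prodMk continuous_snd
  -- The retraction onto the units is the source of the second entry.
  refine isSrc_of_tameOn_localRep (σ := fun c : 𝒢.Comp => 𝒢.s c.snd) 𝒢.contMDiff_u₂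
    (𝒢.contMDiff_s.comp 𝒢.contMDiff_snd) 𝒢.s_u ?_
    ⟨(fun z : 𝒢.Comp × ℝ => (z.1.fst, z.2)) ⁻¹' K ∩ (fun z : 𝒢.Comp × ℝ => (z.1.snd, z.2)) ⁻¹' L,
      ?_, ?_, ?_, ?_⟩ (exists_tameOn_prodComp hf hg)
  · have h₁ : ContMDiffOn (𝓘(ℝ, Euc (p + q) × Euc q).prod 𝓘(ℝ, ℝ)) 𝓘(ℝ, ℂ) ∞
        (fun z : 𝒢.Comp × ℝ => posPart f (z.1.fst, z.2)) (univ ×ˢ Ioc (0 : ℝ) 1) :=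
      (mem_srcT.1 hf).contMDiffOn_pos.comp ((𝒢.contMDiff_fst.comp
        _root_.contMDiff_fst).prodMk _root_.contMDiff_snd).contMDiffOn
        fun z hz => ⟨mem_univ _, hz.2⟩
    have h₂ : ContMDiffOn (𝓘(ℝ, Euc (p + q) × Euc q).prod 𝓘(ℝ, ℝ)) 𝓘(ℝ, ℂ) ∞
        (fun z : 𝒢.Comp × ℝ => posPart g (z.1.snd, z.2)) (univ ×ˢ Ioc (0 : ℝ) 1) :=
      (mem_srcT.1 hg).contMDiffOn_pos.comp ((𝒢.contMDiff_snd.comp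
        _root_.contMDiff_fst).prodMk _root_.contMDiff_snd).contMDiffOn
        fun z hz => ⟨mem_univ _, hz.2⟩
    exact (contDiff_mul.contMDiff.comp_contMDiffOn (h₁.prodMk_space h₂)).congr
      fun z _ => posPart_prodComp f g z
  · have hemb := 𝒢.isClosedEmbedding_val.prodMap (Topology.IsClosedEmbedding.id (X := ℝ))
    refine (hemb.isCompact_preimage (((hK.image continuous_fst).prod
      (hL.image continuous_fst)).prod (isCompact_Icc (a := (0 : ℝ)) (b := 1)))).of_isClosed_subset
      ((hK.isClosed.preimage hc₁).inter (hL.isClosed.preimage hc₂)) ?_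
    rintro ⟨c, t⟩ ⟨h1, h2⟩
    exact ⟨⟨⟨_, h1, rfl⟩, ⟨_, h2, rfl⟩⟩, (hKI h1).2⟩
  · exact fun z hz => ⟨mem_univ _, (hKI hz.1).2⟩
  · rintro c ⟨h1, h2⟩
    obtain ⟨v, hv⟩ := hK0 _ h1
    obtain ⟨w, hw⟩ := hL0 _ h2
    have hvw : v = w := by
      rw [← 𝒢.s_u v, ← 𝒢.r_u w, hv, hw]
      exact c.comp
    subst hvw
    exact ⟨v, SubmersionPair.Composable.ext hv hw⟩
  · intro c t hn
    by_cases h1 : (c.fst, (t : ℝ)) ∈ K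
    · exact mul_eq_zero_of_right _ (hLg _ t fun h2 => hn ⟨h1, h2⟩)
    · exact mul_eq_zero_of_left (hKf _ t h1) _

end LieGroupoid

/-! ### Associativity of the convolution -/

namespace LieGroupoid

variable {p q : ℕ} {G X : Type*}
  [TopologicalSpace G] [ChartedSpace (Euc (p + q)) G] [IsManifold (𝓡 (p + q)) ∞ G]
  [TopologicalSpace X] [ChartedSpace (Euc p) X] [IsManifold (𝓡 p) ∞ X]
  {𝒢 : LieGroupoid p q G X}

variable (𝒢) in
/-- `γ δ⁻¹`, if `γ` and `δ` have the same source. -/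
def div (γ δ : G) : G := (𝒢.divMap γ δ).fst

theorem divPair_fst (γ : G) (δ : 𝒢.Fibre (𝒢.s γ)) : (𝒢.divPair γ δ).fst = 𝒢.div γ δ.1 := by
  rw [div, 𝒢.divMap_of_eq δ.2]

theorem s_div {γ δ : G} (h : 𝒢.s δ = 𝒢.s γ) : 𝒢.s (𝒢.div γ δ) = 𝒢.r δ := by
  rw [div, (𝒢.divMap γ δ).comp, 𝒢.divMap_snd h]

theorem div_mul (c : 𝒢.Comp) : 𝒢.div (𝒢.mul c) c.snd = c.fst := by
  rw [div, divMap_mul]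

theorem mul_div {γ δ : G} (h : 𝒢.s δ = 𝒢.s γ) : 𝒢.mul ⟨𝒢.div γ δ, δ, s_div h⟩ = γ := by
  refine Eq.trans ?_ (𝒢.mul_divMap h)
  exact 𝒢.mul_congr rfl (𝒢.divMap_snd h).symm

/-- Multiplying either side by `εδ` gives `γ`, and right division undoes the product. This is the
identity behind the change of variables in associativity. -/
theorem div_div {γ δ ε : G} (h : 𝒢.s δ = 𝒢.s γ) (h' : 𝒢.s ε = 𝒢.r δ) :
    𝒢.div (𝒢.div γ δ) ε = 𝒢.div γ (𝒢.mul ⟨ε, δ, h'⟩) := by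
  have h₁ : 𝒢.s ε = 𝒢.s (𝒢.div γ δ) := h'.trans (s_div h).symm
  have h₂ := 𝒢.mul_assoc (𝒢.div (𝒢.div γ δ) ε) ε δ (s_div h₁) h'
  have h₃ : 𝒢.mul ⟨𝒢.mul ⟨𝒢.div (𝒢.div γ δ) ε, ε, s_div h₁⟩, δ,
      (𝒢.s_mul ⟨𝒢.div (𝒢.div γ δ) ε, ε, s_div h₁⟩).trans h'⟩ = γ := by
    refine Eq.trans ?_ (mul_div h)
    exact 𝒢.mul_congr (mul_div h₁) rfl
  rw [h₃] at h₂
  have h₄ := div_mul (𝒢 := 𝒢) ⟨𝒢.div (𝒢.div γ δ) ε, 𝒢.mul ⟨ε, δ, h'⟩,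
    (s_div h₁).trans (𝒢.r_mul ⟨ε, δ, h'⟩).symm⟩
  rw [h₂] at h₄
  exact h₄.symm

theorem continuous_div (x : X) :
    Continuous fun z : 𝒢.Fibre x × 𝒢.Fibre x => 𝒢.div z.1.1 z.2.1 := by
  have h1 : Continuous fun z : 𝒢.Fibre x × 𝒢.Fibre x =>
      (⟨z.1.1, 𝒢.inv z.2.1, z.1.2.trans (z.2.2.symm.trans (𝒢.r_inv z.2.1).symm)⟩ : 𝒢.Comp) :=
    𝒢.isEmbedding_val.isInducing.continuous_iff.2
      ((continuous_subtype_val.comp continuous_fst).prodMk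
        (𝒢.contMDiff_inv.continuous.comp (continuous_subtype_val.comp continuous_snd)))
  refine (𝒢.contMDiff_mul.continuous.comp h1).congr fun z => ?_
  have h2 : 𝒢.s z.2.1 = 𝒢.s z.1.1 := z.2.2.trans z.1.2.symm
  rw [← divPair_fst z.1.1 ⟨z.2.1, h2⟩]
  rfl

theorem exists_compact_support {f : 𝒢.Tangent → ℂ} (hf : f ∈ 𝒢.SrcT) :
    ∃ C : Set G, IsCompact C ∧ ∀ γ t, γ ∉ C → f (.pos γ t) = 0 := by
  obtain ⟨K, hK, -, -, hKf⟩ := (mem_srcT.1 hf).conic_compact_support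
  exact ⟨Prod.fst '' K, hK.image continuous_fst, fun γ t hn => hKf γ t fun h => hn ⟨_, h, rfl⟩⟩

/-- Elements of `𝒮_{r,c}(Gᵀ)` are determined by their values for positive parameters. -/
theorem eq_of_pos {f g : 𝒢.Tangent → ℂ} (hf : f ∈ 𝒢.SrcT) (hg : g ∈ 𝒢.SrcT)
    (h : ∀ γ t, f (.pos γ t) = g (.pos γ t)) : f = g := by
  funext z
  rcases z with ⟨x, ξ⟩ | ⟨γ, t⟩
  swap
  · exact h γ t
  obtain ⟨φ, ψ, hφψ, hφ, hx⟩ := 𝒢.exists_isFibredChart_isSliceChart x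
  obtain ⟨b, rfl⟩ := exists_mk_fibreDeriv hφψ hφ hx ξ
  set a := (φ (𝒢.u x)).1 with ha
  have hxa : 𝒢.u x = φ.symm (a, 0) := by rw [ha, ← hφ.apply_eq hx, φ.left_inv hx]
  have hrep : ∀ f : 𝒢.Tangent → ℂ, localRep f φ (a, b, 0) =
      f (.zero x (Submodule.Quotient.mk (fibreDeriv φ (φ (𝒢.u x)) b))) := fun f => by
    rw [localRep_of_zero 𝒢.u_injective f φ b hxa, hφ.apply_eq hx]
    rfl
  have ht := mk_zero_mem_target hφ hx
  have hc : Continuous fun s : ℝ => (a, b, s) := by fun_prop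
  -- In the chart, the value at `t = 0` is the limit along `(a, b, s)` as `s` decreases to `0`.
  have hev : ∀ᶠ s : ℝ in 𝓝[>] 0, s ∈ Ioc (0 : ℝ) 1 ∧ (a, b, s) ∈ Omega φ.target := by
    have h1 : ∀ᶠ s : ℝ in 𝓝 0, (a, s • b) ∈ φ.target :=
      (φ.open_target.preimage (by fun_prop : Continuous fun s : ℝ => (a, s • b))).eventually_mem
        (by rw [mem_preimage, zero_smul]; exact ht)
    filter_upwards [nhdsWithin_le_nhds h1, Ioc_mem_nhdsGT (zero_lt_one' ℝ)] with s h1 h2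
    exact ⟨h2, ⟨h2.1.le, h2.2⟩, h1⟩
  have hlim : ∀ f ∈ 𝒢.SrcT, Filter.Tendsto (fun s : ℝ => localRep f φ (a, b, s)) (𝓝[>] 0)
      (𝓝 (localRep f φ (a, b, 0))) := fun f hf => by
    have h0 : (a, b, (0 : ℝ)) ∈ Omega φ.target :=
      ⟨⟨le_rfl, zero_le_one⟩, by simp only [zero_smul]; exact ht⟩
    refine (((mem_srcT.1 hf).contDiffOn_localRep φ hφ).continuousOn _ h0).tendsto.comp ?_
    exact tendsto_nhdsWithin_iff.2 ⟨(hc.tendsto 0).mono_left nhdsWithin_le_nhds,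
      hev.mono fun s hs => hs.2⟩
  refine (hrep f).symm.trans (Eq.trans ?_ (hrep g))
  refine tendsto_nhds_unique (hlim f hf) ((hlim g hg).congr' ?_)
  filter_upwards [hev] with s hs
  rw [localRep_of_pos _ _ hs.1, localRep_of_pos _ _ hs.1, h]

variable [T2Space G] [SecondCountableTopology G] [MeasurableSpace G] [BorelSpace G]
  (μ : 𝒢.HaarSystem)

/-- The base point `x` is kept apart from `s γ`, so that integrals over fibres with provably equal
base points can be compared without transport. -/
theorem HaarSystem.conv_pos (f g : 𝒢.Tangent → ℂ) (γ : G) (t : Ioc (0 : ℝ) 1) {x : X}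
    (hx : 𝒢.s γ = x) :
    μ.conv f g (.pos γ t) = (((t : ℝ) ^ q)⁻¹ : ℝ) *
      ∫ δ, f (.pos (𝒢.div γ δ.1) t) * g (.pos δ.1 t) ∂μ.fibre x := by
  subst hx
  rw [← integral_const_mul]
  refine integral_congr_ae (Filter.Eventually.of_forall fun δ => ?_)
  change f (.pos (𝒢.divPair γ δ).fst t) * g (.pos δ.1 t) * _ = _
  rw [divPair_fst, mul_comm]

theorem HaarSystem.integral_mul_right (δ : G) {k : G → ℂ}
    (hk : Continuous fun ε : 𝒢.Fibre (𝒢.s δ) => k ε.1) {x : X} (hx : 𝒢.s δ = x) :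
    ∫ ε, k ε.1 ∂μ.fibre x = ∫ ε, k (𝒢.mul ⟨ε.1, δ, ε.2⟩) ∂μ.fibre (𝒢.r δ) := by
  subst hx
  have hm : Continuous fun ε : 𝒢.Fibre (𝒢.r δ) =>
      (⟨𝒢.mul ⟨ε.1, δ, ε.2⟩, 𝒢.s_mul _⟩ : 𝒢.Fibre (𝒢.s δ)) := by
    refine Continuous.subtype_mk (𝒢.contMDiff_mul.continuous.comp
      (𝒢.isEmbedding_val.isInducing.continuous_iff.2 ?_)) _
    exact continuous_subtype_val.prodMk continuous_const
  rw [← μ.right_invariant δ, integral_map hm.measurable.aemeasurable hk.aestronglyMeasurable]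

/-- Both sides are `t^{-2q}` times the double integral of `f(γε⁻¹) g(εδ⁻¹) h(δ)` over the fibre of
`s γ`: the right one directly, the left one after replacing `ε` by `εδ` through right invariance.
The kernel is continuous with compact support, so the order of integration may be exchanged. -/
theorem HaarSystem.conv_assoc_pos {f g h : 𝒢.Tangent → ℂ} (hf : f ∈ 𝒢.SrcT) (hg : g ∈ 𝒢.SrcT)
    (hh : h ∈ 𝒢.SrcT) (γ : G) (t : Ioc (0 : ℝ) 1) :
    μ.conv (μ.conv f g) h (.pos γ t) = μ.conv f (μ.conv g h) (.pos γ t) := by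
  set x := 𝒢.s γ with hx
  set c : ℂ := ((((t : ℝ) ^ q)⁻¹ : ℝ) : ℂ) with hc
  have hfc := (mem_srcT.1 hf).continuous_pos t
  have hgc := (mem_srcT.1 hg).continuous_pos t
  have hhc := (mem_srcT.1 hh).continuous_pos t
  set k : 𝒢.Fibre x → 𝒢.Fibre x → ℂ := fun ε δ =>
    f (.pos (𝒢.div γ ε.1) t) * g (.pos (𝒢.div ε.1 δ.1) t) * h (.pos δ.1 t) with hk
  have hdγ : Continuous fun ε : 𝒢.Fibre x => 𝒢.div γ ε.1 :=
    (continuous_div x).comp (f := fun ε : 𝒢.Fibre x => ((⟨γ, rfl⟩ : 𝒢.Fibre x), ε)) (by fun_prop)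
  have hkc : Continuous k.uncurry :=
    ((hfc.comp (hdγ.comp continuous_fst)).mul (hgc.comp (continuous_div x))).mul
      (hhc.comp (continuous_subtype_val.comp continuous_snd))
  obtain ⟨C, hC, hgC⟩ := exists_compact_support hg
  obtain ⟨D, hD, hhD⟩ := exists_compact_support hh
  -- The supports of `g` and `h` suffice: `ε = (εδ⁻¹)δ` is a product of elements of `C` and `D`.
  have hks : HasCompactSupport k.uncurry := by
    have hemb := (𝒢.isClosed_fibre x).isClosedEmbedding_subtypeVal
    have hE : IsCompact (𝒢.mul '' (𝒢.val ⁻¹' (C ×ˢ D))) :=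
      (𝒢.isClosedEmbedding_val.isCompact_preimage (hC.prod hD)).image 𝒢.contMDiff_mul.continuous
    refine HasCompactSupport.intro ((hemb.isCompact_preimage hE).prod
      (hemb.isCompact_preimage hD)) ?_
    rintro ⟨ε, δ⟩ hn
    by_contra hne
    have h1 : h (.pos δ.1 t) ≠ 0 := right_ne_zero_of_mul hne
    have h2 : g (.pos (𝒢.div ε.1 δ.1) t) ≠ 0 := right_ne_zero_of_mul (left_ne_zero_of_mul hne)
    have h3 : δ.1 ∈ D := by
      by_contra h3
      exact h1 (hhD _ t h3)
    have h4 : 𝒢.div ε.1 δ.1 ∈ C := by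
      by_contra h4
      exact h2 (hgC _ t h4)
    exact hn ⟨⟨⟨𝒢.div ε.1 δ.1, δ.1, s_div (δ.2.trans ε.2.symm)⟩, ⟨h4, h3⟩,
      mul_div (δ.2.trans ε.2.symm)⟩, h3⟩
  have := μ.isLocallyFiniteMeasure_fibre x
  have hL : μ.conv (μ.conv f g) h (.pos γ t) = c * ∫ δ, c * ∫ ε, k ε δ ∂μ.fibre x ∂μ.fibre x := by
    rw [μ.conv_pos _ _ γ t hx.symm]
    congr 1
    refine integral_congr_ae (Filter.Eventually.of_forall fun δ => ?_)
    have hδ : 𝒢.s δ.1 = 𝒢.s γ := δ.2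
    dsimp only
    rw [μ.conv_pos f g _ t (s_div hδ), _root_.mul_assoc]
    congr 1
    have hkδ : Continuous fun ε : 𝒢.Fibre x =>
        f (.pos (𝒢.div γ ε.1) t) * g (.pos (𝒢.div ε.1 δ.1) t) :=
      (hfc.comp hdγ).mul (hgc.comp ((continuous_div x).comp
        (f := fun ε : 𝒢.Fibre x => (ε, δ)) (by fun_prop)))
    have hkδ' : Continuous fun ε : 𝒢.Fibre (𝒢.s δ.1) =>
        f (.pos (𝒢.div γ ε.1) t) * g (.pos (𝒢.div ε.1 δ.1) t) := by
      rw [hδ]; exact hkδ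
    have h1 := μ.integral_mul_right δ.1 (k := fun ε =>
      f (.pos (𝒢.div γ ε) t) * g (.pos (𝒢.div ε δ.1) t)) hkδ' hδ
    simp only [hk]
    rw [integral_mul_const, h1]
    congr 1
    refine integral_congr_ae (Filter.Eventually.of_forall fun ε => ?_)
    dsimp only
    rw [div_div hδ ε.2, div_mul ⟨ε.1, δ.1, ε.2⟩]
  have hR : μ.conv f (μ.conv g h) (.pos γ t) = c * ∫ ε, c * ∫ δ, k ε δ ∂μ.fibre x ∂μ.fibre x := by
    rw [μ.conv_pos _ _ γ t hx.symm]
    congr 1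
    refine integral_congr_ae (Filter.Eventually.of_forall fun ε => ?_)
    dsimp only
    rw [μ.conv_pos g h _ t ε.2, mul_left_comm]
    congr 1
    rw [← integral_const_mul]
    simp only [hk, _root_.mul_assoc]
  rw [hL, hR, integral_const_mul, integral_const_mul,
    integral_integral_swap_of_hasCompactSupport hkc hks]

theorem HaarSystem.conv_mem {f g : 𝒢.Tangent → ℂ} (hf : f ∈ 𝒢.SrcT) (hg : g ∈ 𝒢.SrcT) :
    μ.conv f g ∈ 𝒢.SrcT :=
  μ.fibreIntegral_mem (prodComp_mem hf hg)

theorem HaarSystem.conv_assoc {f g h : 𝒢.Tangent → ℂ} (hf : f ∈ 𝒢.SrcT) (hg : g ∈ 𝒢.SrcT)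
    (hh : h ∈ 𝒢.SrcT) : μ.conv (μ.conv f g) h = μ.conv f (μ.conv g h) :=
  eq_of_pos (μ.conv_mem (μ.conv_mem hf hg) hh) (μ.conv_mem hf (μ.conv_mem hg hh))
    (μ.conv_assoc_pos hf hg hh)

/-- The convolution product as a bilinear map. -/
def HaarSystem.convₗ : 𝒢.SrcT →ₗ[ℂ] 𝒢.SrcT →ₗ[ℂ] 𝒢.SrcT :=
  LinearMap.mk₂ ℂ (fun f g => μ.fibreIntegralₗ ⟨prodComp f g, prodComp_mem f.2 g.2⟩)
    (fun f f' g => by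
      rw [← map_add]
      exact congrArg _ (Subtype.ext (funext fun c => add_mul _ _ _)))
    (fun a f g => by
      rw [← map_smul]
      exact congrArg _ (Subtype.ext (funext fun c => _root_.mul_assoc _ _ _)))
    (fun f g g' => by
      rw [← map_add]
      exact congrArg _ (Subtype.ext (funext fun c => mul_add _ _ _)))
    fun a f g => by
      rw [← map_smul]
      exact congrArg _ (Subtype.ext (funext fun c => mul_left_comm _ _ _))

end LieGroupoid

end TangentGroupoid

end

/-! ### The theorem -/

theorem mainTheorem4 {p q : ℕ} {G X : Type*}
    [TopologicalSpace G] [T2Space G] [SecondCountableTopology G]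
    [ChartedSpace (TangentGroupoid.Euc (p + q)) G]
    [IsManifold (𝓡 (p + q)) ∞ G]
    [TopologicalSpace X] [ChartedSpace (TangentGroupoid.Euc p) X] [IsManifold (𝓡 p) ∞ X]
    [MeasurableSpace G] [BorelSpace G]
    (𝒢 : TangentGroupoid.LieGroupoid p q G X) (μ : 𝒢.HaarSystem) :
    (∀ F ∈ 𝒢.SrcT₂, μ.FibreIntegrable F) ∧
    (∃ m : 𝒢.SrcT₂ →ₗ[ℂ] 𝒢.SrcT, ∀ F : 𝒢.SrcT₂, (m F : 𝒢.Tangent → ℂ) = μ.fibreIntegral F) ∧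
    (∀ f ∈ 𝒢.SrcT, ∀ g ∈ 𝒢.SrcT,
      μ.FibreIntegrable (TangentGroupoid.LieGroupoid.prodComp f g)) ∧
    ∃ conv : 𝒢.SrcT →ₗ[ℂ] 𝒢.SrcT →ₗ[ℂ] 𝒢.SrcT,
      (∀ f g : 𝒢.SrcT, (conv f g : 𝒢.Tangent → ℂ) = μ.conv f g) ∧
      ∀ f g h : 𝒢.SrcT, conv (conv f g) h = conv f (conv g h) :=
  ⟨fun _ hF => μ.fibreIntegrable hF, ⟨μ.fibreIntegralₗ, fun _ => rfl⟩,
    fun _ hf _ hg => μ.fibreIntegrable (TangentGroupoid.LieGroupoid.prodComp_mem hf hg),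
    μ.convₗ, fun _ _ => rfl, fun f g h => Subtype.ext (μ.conv_assoc f.2 g.2 h.2)⟩
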